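/- All groups are finite and all characters are complex; $\operatorname{Irr}(G)$ is the set of irreducible characters of $G$. Let $p$ be a prime, and for an integer $m\ge 1$ write $m_p$ for the largest power of $p$ dividing $m$ and $m_{p'}=m/m_p$. Fix a maximal ideal $M$ containing $p$ of the ring $\mathbf R$ of algebraic integers in $\mathbb C$. Two characters $\chi,\chi'\in\operatorname{Irr}(G)$ lie in the same $p$-block if $\frac{|K|\chi(x_K)}{\chi(1)}\equiv\frac{|K|\chi'(x_K)}{\chi'(1)} \pmod M$ for every conjugacy class $K$ of $G$, where $x_K\in K$; $\chi$ has height zero if $\chi(1)_p$ is the minimum of the numbers $\chi'(1)_p$, with $\chi'\in\operatorname{Irr}(G)$ in the $p$-block of $\chi$. Let $\mathbb Q_m=\mathbb Q(e^{2\pi i/m})$, let $\mathbb Q(\chi)$ be the field generated by the values of $\chi$, let $\mathbb Q_m(\chi)=\langle\mathbb Q_m,\mathbb Q(\chi)\rangle$, and let the conductor $c(\chi)$ be the smallest $m\ge 1$ with $\mathbb Q(\chi)\subseteq\mathbb Q_m$. Theorem. Let $G$ be a finite group, let $p$ be a prime, and suppose that $\chi\in\operatorname{Irr}(G)$ has height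 zero in its $p$-block. Let $N\trianglelefteq G$, let $\theta\in\operatorname{Irr}(N)$ be an irreducible constituent of the restriction $\chi_N$, let $T$ be the stabilizer of $\theta$ in $G$, and let $\psi\in\operatorname{Irr}(T)$ be the Clifford correspondent of $\chi$ over $\theta$, that is, the character $\psi\in\operatorname{Irr}(T)$ lying over $\theta$ with $\psi^G=\chi$. Then: 1. $\psi$ and $\theta$ have height zero in their $p$-blocks (of $T$ and of $N$, respectively); 2. $\mathbb Q_{pn}(\chi)=\mathbb Q_{pn}(\psi)$, where $n=|G|_{p'}$; 3. if $p=2$, or if $p$ is odd and $c(\chi)_p\ge p$, then $c(\chi)_p=c(\psi)_p$. -/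

import Mathlib

namespace FinChar

noncomputable section

/-- The set `Irr(G)` of irreducible complex characters of `G`, as functions `G → ℂ`. -/
def Irr (G : Type*) [Group G] : Set (G → ℂ) :=
  {χ | ∃ (n : ℕ) (ρ : Representation ℂ G (Fin n → ℂ)), ρ.IsIrreducible ∧ χ = ρ.character}

theorem Irr.conj_apply {G : Type*} [Group G] {χ : G → ℂ} (hχ : χ ∈ Irr G) (g h : G) :
    χ (h * g * h⁻¹) = χ g := by
  obtain ⟨n, ρ, -, rfl⟩ := hχ
  exact ρ.char_conj g h

/-- The degree `χ(1)` of a character, as a natural number. -/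
def degree {G : Type*} [Group G] (χ : G → ℂ) : ℕ := ⌊(χ 1).re⌋₊

theorem Irr.degree_eq {G : Type*} [Group G] {χ : G → ℂ} (hχ : χ ∈ Irr G) :
    (degree χ : ℂ) = χ 1 := by
  obtain ⟨n, ρ, -, rfl⟩ := hχ
  simp [degree]

/-- The usual inner product `[φ, ψ] = |G|⁻¹ ∑ φ(g) conj(ψ(g))` of functions on a finite group. -/
def charInner {G : Type*} [Group G] (φ ψ : G → ℂ) : ℂ :=
  (Nat.card G : ℂ)⁻¹ * ∑ᶠ g : G, φ g * (starRingEnd ℂ) (ψ g)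

/-- For a subgroup `N` of `G` (embedded through `i : N →* G`), `θ` lies under `χ`, that is
`[χ_N, θ] ≠ 0`; for `θ ∈ Irr(N)` this says that `θ` is an irreducible constituent of `χ_N`. -/
def LiesUnder {N G : Type*} [Group N] [Group G] (i : N →* G) (θ : N → ℂ) (χ : G → ℂ) : Prop :=
  charInner (fun n => χ (i n)) θ ≠ 0

open Classical in
/-- The induced class function
`ψ^G(g) = |H|⁻¹ ∑_{x ∈ G, x g x⁻¹ ∈ H} ψ(x g x⁻¹)`. -/
def induce {G : Type*} [Group G] {H : Subgroup G} (ψ : H → ℂ) : G → ℂ := fun g =>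
  (Nat.card H : ℂ)⁻¹ * ∑ᶠ x : G, if h : x * g * x⁻¹ ∈ H then ψ ⟨x * g * x⁻¹, h⟩ else 0

/-- The stabilizer (inertia group) `G_θ = {g ∈ G | θ^g = θ}` of a function `θ` on a normal
subgroup, where `θ^g(n) = θ(g n g⁻¹)`. -/
def inertia {G : Type*} [Group G] {N : Subgroup G} [N.Normal] (θ : N → ℂ) : Subgroup G where
  carrier := {g | ∀ n : N, θ (MulAut.conjNormal g n) = θ n}
  one_mem' := by simp
  mul_mem' := by
    intro a b ha hb n
    rw [map_mul, MulAut.mul_apply, ha, hb]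
  inv_mem' := by
    intro a ha n
    rw [← ha, ← MulAut.mul_apply, ← map_mul, mul_inv_cancel, map_one, MulAut.one_apply]

theorem le_inertia {G : Type*} [Group G] {N : Subgroup G} [N.Normal] {θ : N → ℂ}
    (hθ : θ ∈ Irr N) : N ≤ inertia θ := by
  intro g hg n
  have h : MulAut.conjNormal g n = ⟨g, hg⟩ * n * (⟨g, hg⟩ : N)⁻¹ := by
    ext; simp
  rw [h, Irr.conj_apply hθ]

/-- `ψ` is the Clifford correspondent of `χ` over `θ ∈ Irr(N)`: `ψ ∈ Irr(T | θ)`, where `T` is the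
stabilizer of `θ` in `G`, and `ψ^G = χ`. -/
def IsCliffordCorrespondent {G : Type*} [Group G] {N : Subgroup G} [N.Normal] {θ : N → ℂ}
    (hθ : θ ∈ Irr N) (χ : G → ℂ) (ψ : inertia θ → ℂ) : Prop :=
  ψ ∈ Irr (inertia θ) ∧ LiesUnder (Subgroup.inclusion (le_inertia hθ)) θ ψ ∧ induce ψ = χ

/-- The value `ω_χ(K̂) = |K| χ(x) / χ(1)` of the central character of `χ` at the class sum of the
conjugacy class `K` of `x`. For `χ ∈ Irr(G)`, `G` finite, it is an algebraic integer. -/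
def centralChar {G : Type*} [Group G] (χ : G → ℂ) (x : G) : ℂ :=
  (Nat.card (ConjClasses.mk x).carrier : ℂ) * χ x / χ 1

/-- `Irr(B)` for the `p`-block `B` containing `χ`, where `M` is a maximal ideal containing `p` of
the ring of algebraic integers in `ℂ`: the characters `ψ ∈ Irr(G)` such that
`ω_ψ(K̂) ≡ ω_χ(K̂) mod M` for all conjugacy classes `K`, i.e. `λ_ψ = λ_χ`. -/
def block {G : Type*} [Group G] (M : Ideal (integralClosure ℤ ℂ)) (χ : G → ℂ) : Set (G → ℂ) :=
  {ψ | ψ ∈ Irr G ∧ ∀ x : G, ∃ r ∈ M, (r : ℂ) = centralChar ψ x - centralChar χ x}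

/-- The `p`-height `h` of `χ` in its `p`-block `B`: `χ(1)_p = p ^ h * min {ψ(1)_p | ψ ∈ Irr(B)}`,
that is `χ(1)_p = p ^ (a - d + h)` where `p ^ a = |G|_p` and `d` is the defect of `B`. -/
def height {G : Type*} [Group G] (p : ℕ) (M : Ideal (integralClosure ℤ ℂ)) (χ : G → ℂ) : ℕ :=
  padicValNat p (degree χ) - sInf ((fun ψ => padicValNat p (degree ψ)) '' block M χ)

theorem Irr.mem_block {G : Type*} [Group G] (M : Ideal (integralClosure ℤ ℂ)) {χ : G → ℂ}
    (hχ : χ ∈ Irr G) : χ ∈ block M χ :=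
  ⟨hχ, fun _ => ⟨0, M.zero_mem, by simp⟩⟩

theorem Irr.height_eq_zero_iff {G : Type*} [Group G] (p : ℕ) (M : Ideal (integralClosure ℤ ℂ))
    {χ : G → ℂ} (hχ : χ ∈ Irr G) :
    height p M χ = 0 ↔
      ∀ ψ ∈ block M χ, padicValNat p (degree χ) ≤ padicValNat p (degree ψ) := by
  rw [height, Nat.sub_eq_zero_iff_le]
  constructor
  · intro h ψ hψ
    exact h.trans (Nat.sInf_le ⟨ψ, hψ, rfl⟩)
  · intro h
    refine le_csInf ⟨_, χ, Irr.mem_block M hχ, rfl⟩ ?_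
    rintro _ ⟨ψ, hψ, rfl⟩
    exact h ψ hψ

/-- The field of values `ℚ(χ)`, as a subfield of `ℂ`. -/
def fieldOfValues {G : Type*} (χ : G → ℂ) : IntermediateField ℚ ℂ :=
  IntermediateField.adjoin ℚ (Set.range χ)

/-- The cyclotomic field `ℚ_m = ℚ(e^{2πi/m})`, as a subfield of `ℂ` (for `m ≥ 1`). -/
def cyclotomic (m : ℕ) : IntermediateField ℚ ℂ :=
  IntermediateField.adjoin ℚ {Complex.exp (2 * Real.pi * Complex.I / m)}

/-- The field `ℚ_m(χ) = ⟨ℚ_m, ℚ(χ)⟩`. -/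
def cyclotomicValues {G : Type*} (m : ℕ) (χ : G → ℂ) : IntermediateField ℚ ℂ :=
  cyclotomic m ⊔ fieldOfValues χ

/-- The conductor `c(χ)`: the smallest `m ≥ 1` such that `ℚ(χ) ⊆ ℚ_m`. -/
def conductor {G : Type*} (χ : G → ℂ) : ℕ :=
  sInf {m : ℕ | 0 < m ∧ fieldOfValues χ ≤ cyclotomic m}

/-- The `p`-part `n_p` of `n ≥ 1`. -/
def pPart (p n : ℕ) : ℕ := p ^ padicValNat p n

/-- The `p'`-part `n_{p'} = n / n_p` of `n ≥ 1`. -/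
def pPrimePart (p n : ℕ) : ℕ := n / pPart p n

end

end FinChar

/-! ### Automorphisms of ℂ extending embeddings of algebraic fields -/

namespace FinChar

/-! Choose a valuation ring of ℂ lying over `M`, with multiplicative valuation v. For a positive
integer n, v(n) depends only on n_p and decreases as n_p grows, so height zero says that v(χ(1)) is
the largest v(η(1)) for η in the block. The key fact is `exists_valuation_eq_one`: a height-zero χ
has an element x at which χ(x) and the central character value ω_χ(x) are both units. Indeed the
block idempotent e has integral coefficients (`idem_mem`) and ω_χ(e) = 1, so e(x) and ω_χ(x) are
units for some x. Such an x is p-regular (`valuation_idempotent_lt_one`), and summing e over xQ,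
with Q a Sylow p-subgroup of the centralizer of x, bounds the class length
(`valuation_card_class_le`), which forces χ(x) to be a unit.

Fields. χ is the sum over the G-orbit of θ of the components tr(e_ω ρ(x)), and the θ-component is ψ
extended by zero. Let τ be an automorphism of ℂ fixing ℚ_{pn} and χ. It acts on the orbit of θ with
p-power order, and it is congruent to the identity on character values. If it moved θ, it would have
no fixed point on the orbit, and all values of χ would be non-units; so τ fixes θ, hence ψ
(`comp_eq_of_height_eq_zero`). Galois theory gives the equality of fields, and comparing conductors
inside cyclotomic fields gives the third assertion (`pPart_conductor_eq`).

Heights. For ψ, apply the central characters of the block of ψ to the restriction to T of the block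
idempotent of χ (`height_eq_zero_of_induce`). For θ, which is T-invariant, take x as above for ψ.
The T-class of x is a union of m N-classes of equal size, and ω_ψ(x) factors as sβ, where s comes
from the N-class sum of x acting on θ and β from the multiplicity space
(`exists_centralChar_eq_mul`). Both factors are units, and this bounds the size of the N-class by
v(θ(1)). A power of the twisted class sum is central in ℂN, so the unit property of s passes to
every θ' in the block of θ and gives the opposite bound for v(θ'(1))
(`height_eq_zero_of_invariant`). -/

theorem mvPolynomial_aeval_injective_and_isAlgebraic {F ι : Type*} [Field F] [Algebra ℚ F]
    [Algebra.IsAlgebraic ℚ F] [Algebra F ℂ] {s : ι → ℂ} (hs : IsTranscendenceBasis ℚ s) :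
    Function.Injective (MvPolynomial.aeval s : MvPolynomial ι F →ₐ[F] ℂ) ∧
      ∀ z : ℂ, ∃ q : Polynomial (MvPolynomial ι F), q ≠ 0 ∧
        q.eval₂ (MvPolynomial.aeval s : MvPolynomial ι F →ₐ[F] ℂ).toRingHom z = 0 := by
  have hind : AlgebraicIndependent F s := hs.1.extendScalars F
  have hinj : Function.Injective (MvPolynomial.aeval s : MvPolynomial ι F →ₐ[F] ℂ) := hind
  refine ⟨hinj, fun z => ?_⟩
  obtain ⟨q, hq0, hq⟩ := hs.isAlgebraic.isAlgebraic z
  have hle : ∀ c : Algebra.adjoin ℚ (Set.range s), ∃ a : MvPolynomial ι F,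
      MvPolynomial.aeval s a = (c : ℂ) := by
    intro c
    have hc : (c : ℂ) ∈ (MvPolynomial.aeval s : MvPolynomial ι F →ₐ[F] ℂ).range := by
      rw [← Algebra.adjoin_range_eq_range_aeval]
      have h : Algebra.adjoin ℚ (Set.range s) ≤
          (Algebra.adjoin F (Set.range s)).restrictScalars ℚ :=
        Algebra.adjoin_le Algebra.subset_adjoin
      exact h c.2
    exact hc
  choose f hf using hle
  have hfh : ∃ g : Algebra.adjoin ℚ (Set.range s) →+* MvPolynomial ι F,
      ∀ c, MvPolynomial.aeval s (g c) = (c : ℂ) := by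
    refine ⟨⟨⟨⟨f, hinj ?_⟩, fun a b => hinj ?_⟩, hinj ?_, fun a b => hinj ?_⟩, hf⟩ <;> simp [hf]
  obtain ⟨g, hg⟩ := hfh
  refine ⟨q.map g, ?_, ?_⟩
  · rw [Ne, Polynomial.map_eq_zero_iff]
    · exact hq0
    · intro a b hab
      have := congrArg (MvPolynomial.aeval s : MvPolynomial ι F →ₐ[F] ℂ) hab
      rw [hg, hg] at this
      exact Subtype.ext this
  · rw [Polynomial.eval₂_map, ← hq, Polynomial.aeval_def]
    congr 1
    ext c
    exact hg c

/-- Two embeddings in `ℂ` of an algebraic extension of `ℚ` differ by an automorphism of `ℂ`. -/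
theorem exists_ringEquiv_comp_eq {F : Type*} [Field F] [Algebra ℚ F] [Algebra.IsAlgebraic ℚ F]
    (φ₁ φ₂ : F →+* ℂ) : ∃ σ : ℂ ≃+* ℂ, ∀ x, σ (φ₁ x) = φ₂ x := by
  obtain ⟨s, hs⟩ := exists_isTranscendenceBasis ℚ ℂ
  have key : ∀ φ : F →+* ℂ, Function.Injective (MvPolynomial.eval₂Hom φ (Subtype.val : s → ℂ)) ∧
      ∀ z : ℂ, ∃ q : Polynomial (MvPolynomial s F), q ≠ 0 ∧
        q.eval₂ (MvPolynomial.eval₂Hom φ (Subtype.val : s → ℂ)) z = 0 := fun φ => by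
    let := φ.toAlgebra
    exact mvPolynomial_aeval_injective_and_isAlgebraic hs
  -- ℂ is an algebraic closure of F[s] in two ways, once for each embedding of F, and σ comes from
  -- uniqueness of algebraic closures. The two algebra structures live on the same ring, so they are
  -- passed explicitly.
  have main : ∀ (a₁ a₂ : Algebra (MvPolynomial s F) ℂ),
      Function.Injective a₁.algebraMap → Function.Injective a₂.algebraMap →
      (∀ z : ℂ, ∃ q : Polynomial (MvPolynomial s F), q ≠ 0 ∧ q.eval₂ a₁.algebraMap z = 0) →
      (∀ z : ℂ, ∃ q : Polynomial (MvPolynomial s F), q ≠ 0 ∧ q.eval₂ a₂.algebraMap z = 0) →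
      ∃ σ : ℂ ≃+* ℂ, ∀ x, σ (a₁.algebraMap x) = a₂.algebraMap x := by
    intro a₁ a₂ h₁ h₂ g₁ g₂
    have t₁ : @Module.IsTorsionFree (MvPolynomial s F) ℂ _ _ a₁.toModule := by
      let := a₁
      have : FaithfulSMul (MvPolynomial s F) ℂ := (faithfulSMul_iff_algebraMap_injective _ _).2 h₁
      infer_instance
    have t₂ : @Module.IsTorsionFree (MvPolynomial s F) ℂ _ _ a₂.toModule := by
      let := a₂
      have : FaithfulSMul (MvPolynomial s F) ℂ := (faithfulSMul_iff_algebraMap_injective _ _).2 h₂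
      infer_instance
    have c₁ : @IsAlgClosure (MvPolynomial s F) ℂ _ _ a₁ t₁ :=
      @IsAlgClosure.mk _ _ _ _ a₁ t₁ inferInstance (@Algebra.IsAlgebraic.mk _ _ _ _ a₁ g₁)
    have c₂ : @IsAlgClosure (MvPolynomial s F) ℂ _ _ a₂ t₂ :=
      @IsAlgClosure.mk _ _ _ _ a₂ t₂ inferInstance (@Algebra.IsAlgebraic.mk _ _ _ _ a₂ g₂)
    let e := @IsAlgClosure.equiv (MvPolynomial s F) _ _ ℂ ℂ _ _ a₂ t₂ c₂ a₁ t₁ c₁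
    exact ⟨@AlgEquiv.toRingEquiv _ _ _ _ _ _ a₁ a₂ e,
      fun x => @AlgEquiv.commutes _ _ _ _ _ _ a₁ a₂ e x⟩
  obtain ⟨σ, hσ⟩ := main (MvPolynomial.eval₂Hom φ₁ (Subtype.val : s → ℂ)).toAlgebra
    (MvPolynomial.eval₂Hom φ₂ (Subtype.val : s → ℂ)).toAlgebra (key φ₁).1 (key φ₂).1 (key φ₁).2
    (key φ₂).2
  refine ⟨σ, fun x => ?_⟩
  have := hσ (MvPolynomial.C x)
  simpa [RingHom.algebraMap_toAlgebra] using this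

end FinChar

/-! ### Galois descent and cyclotomic subfields of ℂ -/

namespace FinChar

open IntermediateField

/-- If z were outside K it would have a conjugate z' ≠ z over K; the K-embedding of K(z) sending z
to z' extends to an automorphism of ℂ, which moves z. -/
theorem mem_of_forall_ringEquiv {K : IntermediateField ℚ ℂ} [Algebra.IsAlgebraic ℚ K] {z : ℂ}
    (hz : IsAlgebraic ℚ z) (h : ∀ σ : ℂ ≃+* ℂ, (∀ x ∈ K, σ x = x) → σ z = z) : z ∈ K := by
  have hzK : IsIntegral K z := (hz.tower_top K).isIntegral
  by_contra hcon
  obtain ⟨z', hne, hz'⟩ := (notMem_iff_exists_ne_and_isConjRoot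
    (minpoly.irreducible hzK).separable (IsAlgClosed.splits _)).1
    (show z ∉ (⊥ : Subalgebra K ℂ) from fun hm => by
      obtain ⟨k, rfl⟩ := Algebra.mem_bot.1 hm
      exact hcon k.2)
  have hroot : z' ∈ (minpoly K z).aroots ℂ := by
    rw [Polynomial.mem_aroots]
    exact ⟨minpoly.ne_zero hzK, hz'.symm ▸ minpoly.aeval K z'⟩
  let ψ : K⟮z⟯ →ₐ[K] ℂ := (algHomAdjoinIntegralEquiv K hzK).symm ⟨z', hroot⟩
  have hψ : ψ (AdjoinSimple.gen K z) = z' :=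
    algHomAdjoinIntegralEquiv_symm_apply_gen K hzK ⟨z', hroot⟩
  have : Algebra.IsAlgebraic K K⟮z⟯ := isAlgebraic_adjoin (by simpa using hzK)
  have : Algebra.IsAlgebraic ℚ K⟮z⟯ := Algebra.IsAlgebraic.trans ℚ K K⟮z⟯
  obtain ⟨σ, hσ⟩ := exists_ringEquiv_comp_eq (algebraMap K⟮z⟯ ℂ) ψ.toRingHom
  have h1 : σ z = z := h σ fun x hx => by
    have := hσ (algebraMap K K⟮z⟯ ⟨x, hx⟩)
    have h2 : ψ (algebraMap K K⟮z⟯ ⟨x, hx⟩) = x := ψ.commutes _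
    exact this.trans h2
  have h2 : σ z = z' := (hσ (AdjoinSimple.gen K z)).trans hψ
  exact hne (h1.symm.trans h2)

/-- The root of unity `e^{2πi/m}`. -/
noncomputable def zeta (m : ℕ) : ℂ := Complex.exp (2 * Real.pi * Complex.I / m)

theorem zeta_isPrimitiveRoot {m : ℕ} (hm : m ≠ 0) : IsPrimitiveRoot (zeta m) m :=
  Complex.isPrimitiveRoot_exp m hm

theorem zeta_mem (m : ℕ) : zeta m ∈ cyclotomic m := mem_adjoin_simple_self ℚ _

theorem zeta_isIntegral {m : ℕ} (hm : m ≠ 0) : IsIntegral ℤ (zeta m) :=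
  (zeta_isPrimitiveRoot hm).isIntegral (Nat.pos_of_ne_zero hm)

theorem cyclotomic_isAlgebraic {m : ℕ} (hm : m ≠ 0) : Algebra.IsAlgebraic ℚ (cyclotomic m) :=
  isAlgebraic_adjoin (by
    rintro x rfl
    exact (zeta_isIntegral hm).tower_top)

theorem isAlgebraic_of_mem_cyclotomic {m : ℕ} (hm : m ≠ 0) {z : ℂ} (hz : z ∈ cyclotomic m) :
    IsAlgebraic ℚ z := by
  have := cyclotomic_isAlgebraic hm
  have h : IsAlgebraic ℚ (⟨z, hz⟩ : cyclotomic m) := Algebra.IsAlgebraic.isAlgebraic _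
  exact (isAlgebraic_algebraMap_iff (algebraMap (cyclotomic m) ℂ).injective).2 h

theorem cyclotomic_le_of_pow_eq_one {m : ℕ} (hm : m ≠ 0) {z : ℂ} (hz : z ^ m = 1) :
    z ∈ cyclotomic m := by
  have : NeZero m := ⟨hm⟩
  obtain ⟨i, -, rfl⟩ := (zeta_isPrimitiveRoot hm).eq_pow_of_pow_eq_one hz
  exact pow_mem (zeta_mem m) i

theorem cyclotomic_mono {a b : ℕ} (ha : a ≠ 0) (hb : b ≠ 0) (h : a ∣ b) :
    cyclotomic a ≤ cyclotomic b := by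
  refine adjoin_le_iff.2 (Set.singleton_subset_iff.2 (cyclotomic_le_of_pow_eq_one hb ?_))
  obtain ⟨c, rfl⟩ := h
  rw [pow_mul]
  exact (congrArg (· ^ c) (zeta_isPrimitiveRoot ha).pow_eq_one).trans (one_pow c)

/-- Ring automorphisms of `ℂ` are `ℚ`-linear. -/
noncomputable def ratEquiv (σ : ℂ ≃+* ℂ) : ℂ →ₐ[ℚ] ℂ := (σ : ℂ →+* ℂ).toRatAlgHom

theorem ringEquiv_eq_of_mem_adjoin (σ τ : ℂ ≃+* ℂ) {S : Set ℂ} (h : ∀ x ∈ S, σ x = τ x) {z : ℂ}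
    (hz : z ∈ adjoin ℚ S) : σ z = τ z := by
  have hle : adjoin ℚ S ≤
      { Subalgebra.toSubring (AlgHom.equalizer (ratEquiv σ) (ratEquiv τ)) with
        inv_mem' := fun x (hx : σ x = τ x) => show σ x⁻¹ = τ x⁻¹ by rw [map_inv₀, map_inv₀, hx]
        algebraMap_mem' := fun r => show σ _ = τ _ by simp } := adjoin_le_iff.2 h
  exact hle hz

theorem ringEquiv_eq_of_mem_cyclotomic (σ τ : ℂ ≃+* ℂ) {m : ℕ} (h : σ (zeta m) = τ (zeta m))
    {z : ℂ} (hz : z ∈ cyclotomic m) : σ z = τ z :=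
  ringEquiv_eq_of_mem_adjoin σ τ (by rintro x rfl; exact h) hz

theorem exists_ringEquiv_zeta {m u : ℕ} (hm : m ≠ 0) (hu : u.Coprime m) :
    ∃ σ : ℂ ≃+* ℂ, σ (zeta m) = zeta m ^ u := by
  have hζ := zeta_isPrimitiveRoot hm
  have hint : IsIntegral ℚ (zeta m) := (zeta_isIntegral hm).tower_top
  have hroot : zeta m ^ u ∈ (minpoly ℚ (zeta m)).aroots ℂ := by
    rw [Polynomial.mem_aroots]
    refine ⟨minpoly.ne_zero hint, ?_⟩
    rw [← Polynomial.cyclotomic_eq_minpoly_rat hζ (Nat.pos_of_ne_zero hm),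
      Polynomial.cyclotomic_eq_minpoly_rat (hζ.pow_of_coprime u hu) (Nat.pos_of_ne_zero hm)]
    exact minpoly.aeval _ _
  let ψ : ℚ⟮zeta m⟯ →ₐ[ℚ] ℂ := (algHomAdjoinIntegralEquiv ℚ hint).symm ⟨_, hroot⟩
  have hψ : ψ (AdjoinSimple.gen ℚ (zeta m)) = zeta m ^ u :=
    algHomAdjoinIntegralEquiv_symm_apply_gen ℚ hint ⟨_, hroot⟩
  have : Algebra.IsAlgebraic ℚ ℚ⟮zeta m⟯ := isAlgebraic_adjoin (by simpa using hint)
  obtain ⟨σ, hσ⟩ := exists_ringEquiv_comp_eq (algebraMap ℚ⟮zeta m⟯ ℂ) ψ.toRingHom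
  exact ⟨σ, (hσ (AdjoinSimple.gen ℚ (zeta m))).trans hψ⟩

theorem exists_ringEquiv_zeta_eq_pow (σ : ℂ ≃+* ℂ) {m : ℕ} (hm : m ≠ 0) :
    ∃ u : ℕ, u.Coprime m ∧ σ (zeta m) = zeta m ^ u := by
  have : NeZero m := ⟨hm⟩
  have hζ := zeta_isPrimitiveRoot hm
  have h := hζ.map_of_injective (f := (σ : ℂ →* ℂ)) σ.injective
  obtain ⟨u, -, hu, h'⟩ := (hζ.isPrimitiveRoot_iff).1 h
  exact ⟨u, hu, h'.symm⟩

theorem zeta_pow_div {a m : ℕ} (hm : m ≠ 0) (h : a ∣ m) : zeta m ^ (m / a) = zeta a := by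
  obtain ⟨b, rfl⟩ := h
  have ha : a ≠ 0 := left_ne_zero_of_mul hm
  have hb : b ≠ 0 := right_ne_zero_of_mul hm
  rw [Nat.mul_div_cancel_left _ (Nat.pos_of_ne_zero ha), zeta, zeta, ← Complex.exp_nat_mul]
  congr 1
  push_cast
  field_simp

theorem ringEquiv_zeta_of_dvd (σ : ℂ ≃+* ℂ) {a m u : ℕ} (hm : m ≠ 0) (h : a ∣ m)
    (hu : σ (zeta m) = zeta m ^ u) : σ (zeta a) = zeta a ^ u := by
  rw [← zeta_pow_div hm h, map_pow, hu, ← pow_mul, ← pow_mul, mul_comm]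

theorem zeta_pow_eq_pow_iff {m u w : ℕ} (hm : m ≠ 0) :
    zeta m ^ u = zeta m ^ w ↔ u ≡ w [MOD m] := by
  have hζ := zeta_isPrimitiveRoot hm
  have hmod : ∀ k, zeta m ^ k = zeta m ^ (k % m) := fun k => by
    conv_lhs => rw [← Nat.div_add_mod k m, pow_add, pow_mul, hζ.pow_eq_one, one_pow, one_mul]
  rw [hmod u, hmod w]
  exact ⟨fun h => hζ.pow_inj (Nat.mod_lt _ (Nat.pos_of_ne_zero hm))
    (Nat.mod_lt _ (Nat.pos_of_ne_zero hm)) h, fun h => by rw [h]⟩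

/-- An automorphism fixing the gcd level acts on the lcm level by an exponent u ≡ 1 modulo the gcd.
The Chinese remainder theorem yields w ≡ 1 mod a and w ≡ u mod b, and the automorphism with exponent
w agrees with σ on ℚ_b and with the identity on ℚ_a. -/
theorem mem_cyclotomic_gcd {a b : ℕ} (ha : a ≠ 0) (hb : b ≠ 0) {z : ℂ} (hza : z ∈ cyclotomic a)
    (hzb : z ∈ cyclotomic b) : z ∈ cyclotomic (a.gcd b) := by
  have hg : a.gcd b ≠ 0 := fun h => ha (Nat.gcd_eq_zero_iff.1 h).1
  have hl : a.lcm b ≠ 0 := Nat.lcm_ne_zero ha hb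
  have := cyclotomic_isAlgebraic hg
  refine mem_of_forall_ringEquiv (isAlgebraic_of_mem_cyclotomic ha hza) fun σ hσ => ?_
  obtain ⟨u, hu, hσu⟩ := exists_ringEquiv_zeta_eq_pow σ hl
  have h1 : 1 ≡ u [MOD a.gcd b] := by
    have h := ringEquiv_zeta_of_dvd σ hl ((Nat.gcd_dvd_left a b).trans (Nat.dvd_lcm_left a b)) hσu
    rw [hσ _ (zeta_mem _)] at h
    nth_rw 1 [← pow_one (zeta _)] at h
    exact (zeta_pow_eq_pow_iff hg).1 h
  obtain ⟨w, hwa, hwb⟩ := Nat.chineseRemainder' h1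
  have hwl : w.Coprime (a.lcm b) := by
    have hca : w.Coprime a := by
      rw [Nat.coprime_iff_gcd_eq_one, Nat.ModEq.gcd_eq hwa, Nat.gcd_one_left]
    have hcb : w.Coprime b := by
      rw [Nat.coprime_iff_gcd_eq_one, Nat.ModEq.gcd_eq hwb]
      exact Nat.Coprime.coprime_dvd_right (Nat.dvd_lcm_right a b) hu
    exact Nat.Coprime.coprime_dvd_right (Nat.lcm_dvd_mul a b) (Nat.Coprime.mul_right hca hcb)
  obtain ⟨τ, hτ⟩ := exists_ringEquiv_zeta hl hwl
  have e1 : σ z = τ z := ringEquiv_eq_of_mem_cyclotomic σ τ (by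
    rw [ringEquiv_zeta_of_dvd σ hl (Nat.dvd_lcm_right a b) hσu,
      ringEquiv_zeta_of_dvd τ hl (Nat.dvd_lcm_right a b) hτ, (zeta_pow_eq_pow_iff hb).2 hwb.symm]) hzb
  have e2 : τ z = RingEquiv.refl ℂ z := ringEquiv_eq_of_mem_cyclotomic τ _ (by
    rw [ringEquiv_zeta_of_dvd τ hl (Nat.dvd_lcm_left a b) hτ, (zeta_pow_eq_pow_iff ha).2 hwa, pow_one]
    rfl) hza
  exact e1.trans e2

/-! ### Conductors -/

section Conductor

variable {G H : Type*} {χ : G → ℂ} {ψ : H → ℂ}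

theorem conductor_spec {g : ℕ} (hg : g ≠ 0) (h : fieldOfValues χ ≤ cyclotomic g) :
    conductor χ ≠ 0 ∧ fieldOfValues χ ≤ cyclotomic (conductor χ) := by
  have := Nat.sInf_mem (s := {m : ℕ | 0 < m ∧ fieldOfValues χ ≤ cyclotomic m})
    ⟨g, Nat.pos_of_ne_zero hg, h⟩
  exact ⟨this.1.ne', this.2⟩

theorem conductor_dvd {m : ℕ} (hm : m ≠ 0) (h : fieldOfValues χ ≤ cyclotomic m) :
    conductor χ ∣ m := by
  obtain ⟨h0, h1⟩ := conductor_spec hm h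
  have hle : conductor χ ≤ (conductor χ).gcd m := Nat.sInf_le
    ⟨Nat.gcd_pos_of_pos_left _ (Nat.pos_of_ne_zero h0),
      fun z hz => mem_cyclotomic_gcd h0 hm (h1 hz) (h hz)⟩
  have := Nat.le_antisymm hle (Nat.gcd_le_left _ (Nat.pos_of_ne_zero h0))
  exact this ▸ Nat.gcd_dvd_right _ _

theorem cyclotomic_two_mul {n : ℕ} (hn : Odd n) : cyclotomic (2 * n) ≤ cyclotomic n := by
  have hn0 : n ≠ 0 := hn.pos.ne'
  refine adjoin_le_iff.2 (Set.singleton_subset_iff.2 ?_)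
  have hz : zeta (2 * n) ^ n = -1 := by
    have h := (zeta_isPrimitiveRoot (mul_ne_zero two_ne_zero hn0)).pow (a := n) (b := 2)
      (by omega) (mul_comm _ _)
    exact h.eq_neg_one_of_two_right
  have : -zeta (2 * n) ∈ cyclotomic n := cyclotomic_le_of_pow_eq_one hn0 (by
    rw [hn.neg_pow, hz, neg_neg])
  change zeta (2 * n) ∈ cyclotomic n
  rw [← neg_neg (zeta (2 * n))]
  exact neg_mem this

/-- c(χ) divides c(ψ), which divides lcm(pn, c(χ)) because ℚ(ψ) lies in ℚ_{pn}(χ). If p divides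
c(χ), the factor p in pn does not enlarge the p-part of the lcm. -/
theorem pPart_conductor_eq {p g n : ℕ} (hp : p.Prime) (hg : g ≠ 0) (hn : ¬ p ∣ n)
    (hle : fieldOfValues χ ≤ fieldOfValues ψ) (hψ : fieldOfValues ψ ≤ cyclotomic g)
    (heq : cyclotomicValues (p * n) χ = cyclotomicValues (p * n) ψ)
    (hc : p = 2 ∨ (Odd p ∧ p ≤ pPart p (conductor χ))) :
    pPart p (conductor χ) = pPart p (conductor ψ) := by
  have := Fact.mk hp
  have hn0 : n ≠ 0 := fun h => hn (h ▸ dvd_zero p)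
  obtain ⟨hc0, hcχ⟩ := conductor_spec hg (hle.trans hψ)
  obtain ⟨hc0', hcψ⟩ := conductor_spec hg hψ
  have h1 : conductor χ ∣ conductor ψ := conductor_dvd hc0' (hle.trans hcψ)
  have key : ∀ m, m ≠ 0 → cyclotomic (p * n) ≤ cyclotomic m →
      conductor ψ ∣ m.lcm (conductor χ) := fun m hm hmn => by
    have hl := Nat.lcm_ne_zero hm hc0
    refine conductor_dvd hl ?_
    have : fieldOfValues ψ ≤ cyclotomicValues (p * n) χ := heq ▸ le_sup_right
    refine this.trans (sup_le (hmn.trans (cyclotomic_mono hm hl (Nat.dvd_lcm_left _ _)))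
      (hcχ.trans (cyclotomic_mono hc0 hl (Nat.dvd_lcm_right _ _))))
  unfold pPart
  congr 1
  have vle : ∀ {a b : ℕ}, b ≠ 0 → a ∣ b → padicValNat p a ≤ padicValNat p b := fun hb hab =>
    (padicValNat_dvd_iff_le hb).1 (pow_padicValNat_dvd.trans hab)
  refine le_antisymm (vle hc0' h1) ?_
  have vlcm : ∀ m e : ℕ, m ≠ 0 → padicValNat p m ≤ e → e ≤ max (padicValNat p (conductor χ)) e →
      padicValNat p (m.lcm (conductor χ)) ≤ max (padicValNat p (conductor χ)) e := by
    intro m e hm hme _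
    rw [← Nat.factorization_def _ hp, Nat.factorization_lcm hm hc0]
    simp only [Finsupp.sup_apply, Nat.factorization_def _ hp]
    omega
  rcases hc with rfl | ⟨-, hc⟩
  -- For p = 2 the level 2n may be replaced by the odd number n, since both give the same field; so
  -- no condition on c(χ) is needed.
  · have hodd : Odd n := Nat.not_even_iff_odd.1 fun h => hn h.two_dvd
    have := vle (Nat.lcm_ne_zero hn0 hc0) (key n hn0 (cyclotomic_two_mul hodd))
    have h2 := vlcm n 0 hn0 (by rw [padicValNat.eq_zero_of_not_dvd hn]) (by omega)
    omega
  · have hpn : p * n ≠ 0 := mul_ne_zero hp.ne_zero hn0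
    have := vle (Nat.lcm_ne_zero hpn hc0) (key (p * n) hpn le_rfl)
    have h2 := vlcm (p * n) 1 hpn (by
      rw [padicValNat.mul hp.ne_zero hn0, padicValNat.self hp.one_lt,
        padicValNat.eq_zero_of_not_dvd hn]) (by omega)
    have h3 : padicValNat p (conductor χ) ≠ 0 := by
      intro h
      rw [pPart, h, pow_zero] at hc
      exact absurd hp.one_lt (by omega)
    omega

end Conductor

end FinChar

/-! ### Valuation rings over the maximal ideal -/

namespace FinChar

/-- `B` is a valuation ring of `ℂ` containing the algebraic integers, whose maximal ideal lies
over the maximal ideal `M`, where `p ∈ M`. -/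
structure Dominates (B : ValuationSubring ℂ) (p : ℕ) (M : Ideal (integralClosure ℤ ℂ)) : Prop where
  integral_le_one : ∀ z : ℂ, IsIntegral ℤ z → B.valuation z ≤ 1
  lt_one_iff : ∀ z : integralClosure ℤ ℂ, B.valuation (z : ℂ) < 1 ↔ z ∈ M
  mem : (p : integralClosure ℤ ℂ) ∈ M
  prime : p.Prime

theorem valuation_natCast_ne_zero (B : ValuationSubring ℂ) {n : ℕ} (hn : n ≠ 0) :
    B.valuation (n : ℂ) ≠ 0 := by
  rw [Ne, map_eq_zero]
  exact_mod_cast hn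

/-- Any proper ideal of a subring of a field extends to the nonunits of some valuation ring.
Maximality of `M` then makes every algebraic integer outside `M` a unit there. -/
theorem exists_dominates {p : ℕ} (hp : p.Prime) {M : Ideal (integralClosure ℤ ℂ)}
    (hM : M.IsMaximal) (hpM : (p : integralClosure ℤ ℂ) ∈ M) :
    ∃ B : ValuationSubring ℂ, Dominates B p M := by
  obtain ⟨B, hB, hMB⟩ := Ideal.image_subset_nonunits_valuationSubring
    (A := (integralClosure ℤ ℂ).toSubring) M hM.ne_top
  have h1 : ∀ z : ℂ, IsIntegral ℤ z → B.valuation z ≤ 1 := fun z hz =>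
    (B.valuation_le_one_iff z).2 (hB (show z ∈ (integralClosure ℤ ℂ).toSubring from hz))
  have h2 : ∀ z ∈ M, B.valuation (z : ℂ) < 1 := fun z hz =>
    B.mem_nonunits_iff.1 (hMB ⟨z, hz, rfl⟩)
  refine ⟨B, h1, fun z => ⟨fun hz => ?_, h2 z⟩, hpM, hp⟩
  by_contra hzM
  obtain ⟨y, i, hi, hy⟩ := hM.exists_inv hzM
  have e : (y : ℂ) * z + i = 1 := by exact_mod_cast congrArg Subtype.val hy
  have : B.valuation ((y : ℂ) * z + i) < 1 := by
    refine B.valuation.map_add_lt ?_ (h2 i hi)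
    rw [map_mul]
    exact (mul_le_of_le_one_left' (h1 y y.2)).trans_lt hz
  rw [e, map_one] at this
  exact lt_irrefl _ this

namespace Dominates

variable {B : ValuationSubring ℂ} {p : ℕ} {M : Ideal (integralClosure ℤ ℂ)} (hB : Dominates B p M)
include hB

theorem natCast_le_one (n : ℕ) : B.valuation (n : ℂ) ≤ 1 :=
  hB.integral_le_one _ (map_natCast (algebraMap ℤ ℂ) n ▸ isIntegral_algebraMap)

theorem prime_lt_one : B.valuation (p : ℂ) < 1 := by
  exact_mod_cast (hB.lt_one_iff (p : integralClosure ℤ ℂ)).2 hB.mem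

theorem natCast_eq_one {n : ℕ} (h : ¬ p ∣ n) : B.valuation (n : ℂ) = 1 := by
  refine le_antisymm (hB.natCast_le_one n) (not_lt.1 fun hlt => ?_)
  have hc : IsCoprime (p : ℤ) n := Nat.isCoprime_iff_coprime.2 ((hB.prime.coprime_iff_not_dvd).2 h)
  obtain ⟨a, b, hab⟩ := hc
  have hint : ∀ z : ℤ, B.valuation (z : ℂ) ≤ 1 := fun z =>
    hB.integral_le_one _ (map_intCast (algebraMap ℤ ℂ) z ▸ isIntegral_algebraMap)
  have e : (a : ℂ) * p + b * n = 1 := by exact_mod_cast hab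
  have : B.valuation ((a : ℂ) * p + b * n) < 1 := by
    refine B.valuation.map_add_lt ?_ ?_
    · rw [map_mul]
      exact (mul_le_of_le_one_left' (hint a)).trans_lt hB.prime_lt_one
    · rw [map_mul]
      exact (mul_le_of_le_one_left' (hint b)).trans_lt hlt
  rw [e, map_one] at this
  exact lt_irrefl _ this

theorem natCast_eq_pow {n : ℕ} (hn : n ≠ 0) :
    B.valuation (n : ℂ) = B.valuation (p : ℂ) ^ padicValNat p n := by
  have := Fact.mk hB.prime
  obtain ⟨e, k, hpk, rfl⟩ := Nat.exists_eq_pow_mul_and_not_dvd hn p hB.prime.ne_one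
  have hk : k ≠ 0 := right_ne_zero_of_mul hn
  rw [padicValNat.mul (pow_ne_zero _ hB.prime.ne_zero) hk, padicValNat.prime_pow,
    padicValNat.eq_zero_of_not_dvd hpk, add_zero, Nat.cast_mul, Nat.cast_pow, map_mul, map_pow,
    hB.natCast_eq_one hpk, mul_one]

theorem natCast_le_natCast_iff {m n : ℕ} (hm : m ≠ 0) (hn : n ≠ 0) :
    B.valuation (m : ℂ) ≤ B.valuation (n : ℂ) ↔ padicValNat p n ≤ padicValNat p m := by
  rw [hB.natCast_eq_pow hm, hB.natCast_eq_pow hn]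
  exact pow_le_pow_iff_right_of_lt_one₀ (by
    rw [zero_lt_iff, Ne, map_eq_zero]
    exact_mod_cast hB.prime.ne_zero) hB.prime_lt_one

/-- The residue map of `B` is additive, so a sum that is invariant under a permutation of `p`-power
order without fixed points vanishes modulo the maximal ideal. -/
theorem sum_lt_one_of_perm {X : Type*} [Fintype X] (f : X → X) (k : ℕ) (hk : f^[p ^ k] = id)
    (hfix : ∀ x, f x ≠ x) (w : X → ℂ) (hw : ∀ x, B.valuation (w x) ≤ 1)
    (hinv : ∀ x, B.valuation (w (f x) - w x) < 1) : B.valuation (∑ x, w x) < 1 := by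
  classical
  have := Fact.mk hB.prime
  let r := IsLocalRing.residue B
  have hr : ∀ b : B, r b = 0 ↔ B.valuation (b : ℂ) < 1 := fun b => by
    rw [IsLocalRing.residue_eq_zero_iff, ← B.valuation_lt_one_iff]
  let u : X → B := fun x => ⟨w x, (B.valuation_le_one_iff _).1 (hw x)⟩
  have hsum : ∑ x, w x = ((∑ x, u x : B) : ℂ) := by
    rw [AddSubmonoidClass.coe_finsetSum]
  rw [hsum, ← hr, map_sum]
  have hru : ∀ x, r (u (f x)) = r (u x) := fun x => by
    rw [← sub_eq_zero, ← map_sub, hr]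
    exact hinv x
  have hp0 : (p : IsLocalRing.ResidueField B) = 0 := by
    have h := (hr (p : B)).2 (by exact_mod_cast hB.prime_lt_one)
    rwa [map_natCast] at h
  -- Group the terms by residue. Each fibre is stable under `f`, which has p-power order and no
  -- fixed points, so its size is divisible by p and its contribution vanishes in the residue field.
  rw [← Finset.sum_fiberwise_of_maps_to (t := Finset.univ.image fun x => r (u x))
    (g := fun x => r (u x)) (fun x _ => Finset.mem_image_of_mem _ (Finset.mem_univ x))]
  refine Finset.sum_eq_zero fun c _ => ?_
  rw [Finset.sum_congr rfl (g := fun _ => c) (fun x hx => (Finset.mem_filter.1 hx).2),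
    Finset.sum_const, nsmul_eq_mul]
  let Y := {x // r (u x) = c}
  let f' : Function.End Y := fun y => ⟨f y.1, (hru _).trans y.2⟩
  have hf' : ∀ n (y : Y), ((f' ^ n) y).1 = f^[n] y.1 := by
    intro n
    induction n with
    | zero => intro y; rfl
    | succ n ih =>
      intro y
      rw [pow_succ, Function.iterate_succ_apply]
      exact ih (f' y)
  have hmod := Equiv.Perm.card_fixedPoints_modEq (f := f') (p := p) (n := k) (by
    funext y
    refine Subtype.ext ?_
    rw [hf', hk]
    rfl)
  have hempty : Fintype.card f'.fixedPoints = 0 := by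
    rw [Fintype.card_eq_zero_iff]
    exact ⟨fun y => hfix y.1.1 (congrArg Subtype.val y.2)⟩
  rw [hempty] at hmod
  have hcard : (Finset.univ.filter fun x => r (u x) = c).card = Fintype.card Y :=
    (Fintype.card_subtype _).symm
  obtain ⟨l, hl⟩ := (Nat.modEq_zero_iff_dvd).1 hmod
  rw [hcard, hl, Nat.cast_mul, hp0, zero_mul, zero_mul]

end Dominates

end FinChar

/-! ### Schur's lemma and orthogonality -/

namespace FinChar

open Representation

section Schur

variable {G V W : Type*} [Group G] [AddCommGroup V] [Module ℂ V] [FiniteDimensional ℂ V]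
  [AddCommGroup W] [Module ℂ W] [FiniteDimensional ℂ W]
  {ρ : Representation ℂ G V} {σ : Representation ℂ G W}

theorem finrank_ne_zero_of_irreducible (hρ : ρ.IsIrreducible) : Module.finrank ℂ V ≠ 0 := by
  intro h
  have hs : Subsingleton V := Module.finrank_zero_iff.1 h
  obtain ⟨a, b, hab⟩ := hρ.toNontrivial
  exact hab (Subrepresentation.ext (Subsingleton.elim _ _))

theorem exists_eq_smul_one (hρ : ρ.IsIrreducible) (A : Module.End ℂ V)
    (hA : ∀ g, A * ρ g = ρ g * A) : ∃ c : ℂ, A = c • 1 := by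
  obtain ⟨c, hc⟩ := IsIrreducible.algebraMap_intertwiningMap_bijective_of_isAlgClosed
    (ρ := ρ) |>.2 ⟨A, hA⟩
  exact ⟨c, (congrArg IntertwiningMap.toLinearMap hc).symm⟩

theorem eq_trace_smul_one (hρ : ρ.IsIrreducible) (A : Module.End ℂ V)
    (hA : ∀ g, A * ρ g = ρ g * A) :
    A = (LinearMap.trace ℂ V A / Module.finrank ℂ V) • 1 := by
  obtain ⟨c, rfl⟩ := exists_eq_smul_one hρ A hA
  have h : (Module.finrank ℂ V : ℂ) ≠ 0 := by exact_mod_cast finrank_ne_zero_of_irreducible hρ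
  rw [map_smul, LinearMap.trace_one, smul_eq_mul, mul_div_cancel_right₀ _ h]

omit [FiniteDimensional ℂ V] [FiniteDimensional ℂ W] in
theorem bijective_of_intertwines (hρ : ρ.IsIrreducible) (hσ : σ.IsIrreducible) (f : V →ₗ[ℂ] W)
    (hf : ∀ g v, f (ρ g v) = σ g (f v)) (h0 : f ≠ 0) : Function.Bijective f :=
  (IsIrreducible.bijective_or_eq_zero (f.intertwiningMap_of_isIntertwiningMap ρ σ hf)).resolve_right
    fun h => h0 (congrArg IntertwiningMap.toLinearMap h)

end Schur

section Orthogonality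

variable {G : Type*} [Group G]

theorem one_apply_eq {χ : G → ℂ} (hχ : χ ∈ Irr G) : ∃ n : ℕ, n ≠ 0 ∧ χ 1 = n := by
  obtain ⟨n, ρ, hρ, rfl⟩ := hχ
  exact ⟨n, by simpa using finrank_ne_zero_of_irreducible hρ, by simp⟩

theorem degree_ne_zero {χ : G → ℂ} (hχ : χ ∈ Irr G) : degree χ ≠ 0 := by
  obtain ⟨n, hn, h⟩ := one_apply_eq hχ
  rw [← Irr.degree_eq hχ] at h
  rwa [Nat.cast_injective h]

theorem one_apply_ne_zero {χ : G → ℂ} (hχ : χ ∈ Irr G) : χ 1 ≠ 0 := by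
  rw [← Irr.degree_eq hχ]
  exact_mod_cast degree_ne_zero hχ

variable [Fintype G]

theorem card_ne_zero' : (Nat.card G : ℂ) ≠ 0 := by
  exact_mod_cast Nat.card_pos.ne'

open Classical in
theorem sum_mul_inv_eq {χ ψ : G → ℂ} (hχ : χ ∈ Irr G) (hψ : ψ ∈ Irr G) :
    ∑ g, χ g * ψ g⁻¹ = if χ = ψ then (Nat.card G : ℂ) else 0 := by
  obtain ⟨n, ρ, hρ, rfl⟩ := hχ
  obtain ⟨m, σ, hσ, rfl⟩ := hψ
  have hc := card_ne_zero' (G := G)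
  let _ : Invertible (Nat.card G : ℂ) := invertibleOfNonzero hc
  have e1 := char_orthonormal ρ σ
  have e2 := char_orthonormal ρ ρ
  rw [if_pos ⟨Representation.Equiv.refl ρ⟩] at e2
  rw [inv_mul_eq_iff_eq_mul₀ hc] at e1 e2
  split_ifs with h
  · rw [← h, e2, mul_one]
  · rw [if_neg (fun ⟨φ⟩ => h (char_iso φ).symm)] at e1
    rw [e1, mul_zero]

theorem sum_char_mul_char_inv_eq {V W : Type*} [AddCommGroup V] [Module ℂ V]
    [FiniteDimensional ℂ V] [AddCommGroup W] [Module ℂ W] [FiniteDimensional ℂ W]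
    (ρ : Representation ℂ G V) (σ : Representation ℂ G W) :
    ∑ g, σ.character g * ρ.character g⁻¹ =
      Nat.card G * Module.finrank ℂ (IntertwiningMap ρ σ) := by
  have hc := card_ne_zero' (G := G)
  let _ : Invertible (Nat.card G : ℂ) := invertibleOfNonzero hc
  rw [← card_inv_mul_sum_char_mul_char_eq_finrank, mul_inv_cancel_left₀ hc]

theorem Irr.finite : (Irr G).Finite := by
  classical
  have hli : LinearIndependent ℂ (fun χ : Irr G => (χ : G → ℂ)) := by
    rw [linearIndependent_iff']
    intro s c hc ψ hψ
    have h := congrArg (fun f : G → ℂ => ∑ g, f g * (ψ : G → ℂ) g⁻¹) hc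
    simp only [Finset.sum_apply, Pi.smul_apply, smul_eq_mul, Pi.zero_apply, zero_mul,
      Finset.sum_const_zero, Finset.sum_mul] at h
    rw [Finset.sum_comm, Finset.sum_eq_single ψ] at h
    · simp_rw [mul_assoc, ← Finset.mul_sum, sum_mul_inv_eq ψ.2 ψ.2] at h
      rw [if_pos trivial] at h
      exact (mul_eq_zero.1 h).resolve_right card_ne_zero'
    · intro χ _ hne
      simp_rw [mul_assoc, ← Finset.mul_sum, sum_mul_inv_eq χ.2 ψ.2]
      rw [if_neg (fun h => hne (Subtype.ext h)), mul_zero]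
    · exact fun h => absurd hψ h
  have := hli.finite
  exact Set.toFinite _

end Orthogonality

/-! ### Galois conjugates and complex conjugates of characters -/

section Twist

variable {G : Type*} [Group G]

/-- Apply a ring automorphism of `ℂ` to the matrix coefficients of a representation. -/
noncomputable def twist {n : ℕ} (τ : ℂ ≃+* ℂ) (ρ : Representation ℂ G (Fin n → ℂ)) :
    Representation ℂ G (Fin n → ℂ) where
  toFun g := Matrix.toLin' ((LinearMap.toMatrix' (ρ g)).map τ)
  map_one' := by
    rw [map_one, LinearMap.toMatrix'_one, Matrix.map_one _ (map_zero τ) (map_one τ),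
      Matrix.toLin'_one]
    rfl
  map_mul' g h := by
    rw [map_mul, LinearMap.toMatrix'_mul, Matrix.map_mul, Matrix.toLin'_mul]
    rfl

theorem twist_character {n : ℕ} (τ : ℂ ≃+* ℂ) (ρ : Representation ℂ G (Fin n → ℂ)) (g : G) :
    (twist τ ρ).character g = τ (ρ.character g) := by
  rw [character, character, twist]
  simp only [MonoidHom.coe_mk, OneHom.coe_mk]
  rw [LinearMap.trace_eq_matrix_trace ℂ (Pi.basisFun ℂ (Fin n)),
    LinearMap.trace_eq_matrix_trace ℂ (Pi.basisFun ℂ (Fin n))]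
  rw [LinearMap.toMatrix_eq_toMatrix', LinearMap.toMatrix'_toLin']
  rw [Matrix.trace, Matrix.trace, map_sum]
  rfl

theorem twist_apply {n : ℕ} (τ : ℂ ≃+* ℂ) (ρ : Representation ℂ G (Fin n → ℂ)) (g : G)
    (v : Fin n → ℂ) : twist τ ρ g (τ ∘ v) = τ ∘ (ρ g v) := by
  have h : ρ g v = (LinearMap.toMatrix' (ρ g)).mulVec v := by
    rw [← Matrix.toLin'_apply, Matrix.toLin'_toMatrix']
  rw [h, twist]
  simp only [MonoidHom.coe_mk, OneHom.coe_mk, Matrix.toLin'_apply]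
  generalize LinearMap.toMatrix' (ρ g) = A
  funext i
  simp [Matrix.mulVec, dotProduct]

theorem isIrreducible_iff {V : Type*} [AddCommGroup V] [Module ℂ V] {ρ : Representation ℂ G V} :
    ρ.IsIrreducible ↔ Nontrivial V ∧
      ∀ U : Submodule ℂ V, (∀ g, ∀ v ∈ U, ρ g v ∈ U) → U = ⊥ ∨ U = ⊤ := by
  constructor
  · intro h
    refine ⟨?_, fun U hU => ?_⟩
    · by_contra hn
      rw [not_nontrivial_iff_subsingleton] at hn
      obtain ⟨a, b, hab⟩ := h.toNontrivial
      exact hab (Subrepresentation.ext (Subsingleton.elim _ _))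
    · exact (h.eq_bot_or_eq_top ⟨U, hU⟩).imp (congrArg Subrepresentation.toSubmodule)
        (congrArg Subrepresentation.toSubmodule)
  · rintro ⟨hn, h⟩
    have : Nontrivial (Subrepresentation ρ) := ⟨⊥, ⊤, fun h => by
      have : (⊥ : Submodule ℂ V) = ⊤ := congrArg Subrepresentation.toSubmodule h
      exact bot_ne_top this⟩
    exact ⟨fun a => (h a.toSubmodule a.apply_mem_toSubmodule).imp
      (fun h => Subrepresentation.ext h) (fun h => Subrepresentation.ext h)⟩

theorem twist_isIrreducible {n : ℕ} (τ : ℂ ≃+* ℂ) {ρ : Representation ℂ G (Fin n → ℂ)}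
    (hρ : ρ.IsIrreducible) : (twist τ ρ).IsIrreducible := by
  rw [isIrreducible_iff] at hρ ⊢
  refine ⟨hρ.1, fun U hU => ?_⟩
  let U' : Submodule ℂ (Fin n → ℂ) :=
    { carrier := {v | τ ∘ v ∈ U}
      add_mem' := fun {a b} ha hb => by
        have : τ ∘ (a + b) = τ ∘ a + τ ∘ b := by ext; simp
        exact (congrArg (· ∈ U) this).mpr (U.add_mem ha hb)
      zero_mem' := by
        have : τ ∘ (0 : Fin n → ℂ) = 0 := by ext; simp
        exact (congrArg (· ∈ U) this).mpr U.zero_mem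
      smul_mem' := fun c a ha => by
        have : τ ∘ (c • a) = τ c • (τ ∘ a) := by ext; simp
        exact (congrArg (· ∈ U) this).mpr (U.smul_mem _ ha) }
  have hinv : ∀ v : Fin n → ℂ, τ ∘ (τ.symm ∘ v) = v := fun v => by ext; simp
  rcases hρ.2 U' (fun g v hv => by
    have := hU g _ hv
    rwa [twist_apply] at this) with h | h
  · left
    rw [eq_bot_iff]
    intro v hv
    have h1 : τ.symm ∘ v ∈ U' := show τ ∘ (τ.symm ∘ v) ∈ U by rwa [hinv]
    rw [h, Submodule.mem_bot] at h1
    rw [Submodule.mem_bot, ← hinv v, h1]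
    ext
    simp
  · right
    rw [eq_top_iff]
    intro v _
    have h1 : τ.symm ∘ v ∈ U' := h ▸ Submodule.mem_top
    rw [← hinv v]
    exact h1

theorem Irr.comp_ringEquiv (τ : ℂ ≃+* ℂ) {χ : G → ℂ} (hχ : χ ∈ Irr G) : (τ ∘ χ) ∈ Irr G := by
  obtain ⟨n, ρ, hρ, rfl⟩ := hχ
  exact ⟨n, twist τ ρ, twist_isIrreducible τ hρ, funext fun g => (twist_character τ ρ g).symm⟩

/-- No unitary structure is used. The dual of the complex conjugate of ρ has character conj(χ(g⁻¹));
pairing it with χ gives ∑ |χ(g)|² > 0, so there is a nonzero intertwiner to ρ. It is onto by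
irreducibility, hence bijective by dimension. -/
theorem Irr.star_apply [Fintype G] {χ : G → ℂ} (hχ : χ ∈ Irr G) (g : G) :
    (starRingEnd ℂ) (χ g) = χ g⁻¹ := by
  obtain ⟨n, ρ, hρ, rfl⟩ := hχ
  let τ : ℂ ≃+* ℂ := starRingAut
  let ρ' : Representation ℂ G (Module.Dual ℂ (Fin n → ℂ)) := (twist τ ρ).dual
  have hρ' : ∀ g, ρ'.character g = (starRingEnd ℂ) (ρ.character g⁻¹) := fun g => by
    rw [char_dual, twist_character]
    rfl
  have hsum := sum_char_mul_char_inv_eq ρ' ρ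
  have hpos : ∑ g, ρ.character g * ρ'.character g⁻¹ ≠ 0 := by
    simp_rw [hρ', inv_inv, Complex.mul_conj]
    rw [← Complex.ofReal_sum]
    refine Complex.ofReal_ne_zero.2 (ne_of_gt (Finset.sum_pos' (fun i _ => Complex.normSq_nonneg _)
      ⟨1, Finset.mem_univ _, Complex.normSq_pos.2 (one_apply_ne_zero ⟨n, ρ, hρ, rfl⟩)⟩))
  rw [hsum] at hpos
  have hfr : Module.finrank ℂ (IntertwiningMap ρ' ρ) ≠ 0 := fun h => hpos (by rw [h]; simp)
  obtain ⟨f, hf⟩ : ∃ f : IntertwiningMap ρ' ρ, f ≠ 0 := by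
    by_contra hcon
    push Not at hcon
    have : Subsingleton (IntertwiningMap ρ' ρ) := ⟨fun a b => by rw [hcon a, hcon b]⟩
    exact hfr Module.finrank_zero_of_subsingleton
  have hsurj := (IsIrreducible.surjective_or_eq_zero f).resolve_right hf
  have hinj : Function.Injective f.toLinearMap :=
    (LinearMap.injective_iff_surjective_of_finrank_eq_finrank
      (Subspace.dual_finrank_eq)).2 hsurj
  have e := char_iso (f.ofBijective ⟨hinj, hsurj⟩)
  rw [← e, hρ', starRingEnd_self_apply, e]

theorem liesUnder_iff {N G : Type*} [Group N] [Fintype N] [Group G] (i : N →* G) {θ : N → ℂ}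
    (hθ : θ ∈ Irr N) (χ : G → ℂ) : LiesUnder i θ χ ↔ ∑ n, χ (i n) * θ n⁻¹ ≠ 0 := by
  rw [LiesUnder, charInner, finsum_eq_sum_of_fintype, mul_ne_zero_iff]
  simp_rw [Irr.star_apply hθ]
  exact and_iff_right (inv_ne_zero card_ne_zero')

end Twist

end FinChar

/-! ### Integrality of characters and of central characters -/

namespace FinChar

open Representation

section Integrality

variable {V : Type*} [AddCommGroup V] [Module ℂ V] [FiniteDimensional ℂ V]

theorem exists_trace_eq_sum (A : Module.End ℂ V) :
    ∃ s : Multiset ℂ, (∀ μ ∈ s, ∃ v : V, v ≠ 0 ∧ A v = μ • v) ∧ LinearMap.trace ℂ V A = s.sum := by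
  refine ⟨A.charpoly.roots, fun μ hμ => ?_,
    A.trace_eq_sum_roots_charpoly_of_splits (IsAlgClosed.splits _)⟩
  have : A.HasEigenvalue μ := by
    rw [Module.End.hasEigenvalue_iff_isRoot_charpoly]
    exact (Polynomial.mem_roots'.1 hμ).2
  obtain ⟨v, hv⟩ := this.exists_hasEigenvector
  exact ⟨v, hv.2, hv.apply_eq_smul⟩

theorem exists_trace_eq_sum_roots_of_unity {A : Module.End ℂ V} {k : ℕ} (hA : A ^ k = 1) :
    ∃ s : Multiset ℂ, (∀ μ ∈ s, μ ^ k = 1) ∧ LinearMap.trace ℂ V A = s.sum := by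
  obtain ⟨s, hs, h⟩ := exists_trace_eq_sum A
  refine ⟨s, fun μ hμ => ?_, h⟩
  obtain ⟨v, hv, hAv⟩ := hs μ hμ
  have hk : ∀ n : ℕ, (A ^ n) v = μ ^ n • v := by
    intro n
    induction n with
    | zero => simp
    | succ n ih => rw [pow_succ', Module.End.mul_apply, ih, map_smul, hAv, smul_smul, pow_succ]
  have := hk k
  rw [hA, Module.End.one_apply] at this
  exact smul_left_injective ℂ hv (this.symm.trans (one_smul ℂ v).symm)

theorem isIntegral_multiset_sum {s : Multiset ℂ} (h : ∀ μ ∈ s, IsIntegral ℤ μ) :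
    IsIntegral ℤ s.sum :=
  Subring.multiset_sum_mem (integralClosure ℤ ℂ).toSubring s h

theorem isIntegral_trace {A : Module.End ℂ V} (hA : IsIntegral ℤ A) :
    IsIntegral ℤ (LinearMap.trace ℂ V A) := by
  obtain ⟨s, hs, h⟩ := exists_trace_eq_sum A
  rw [h]
  refine isIntegral_multiset_sum fun μ hμ => ?_
  obtain ⟨v, hv, hAv⟩ := hs μ hμ
  obtain ⟨q, hq, hqA⟩ := hA
  refine ⟨q, hq, ?_⟩
  have e : (Polynomial.aeval A (q.map (algebraMap ℤ ℂ))) v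
      = (q.map (algebraMap ℤ ℂ)).eval μ • v :=
    Module.End.aeval_apply_of_hasEigenvector ⟨Module.End.mem_eigenspace_iff.2 hAv, hv⟩
  rw [Polynomial.aeval_map_algebraMap, Polynomial.aeval_def, hqA, LinearMap.zero_apply,
    Polynomial.eval_map] at e
  exact (smul_eq_zero.1 e.symm).resolve_right hv

theorem isIntegral_of_pow_eq_one' {R : Type*} [Ring R] {a : R} {k : ℕ} (hk : k ≠ 0)
    (h : a ^ k = 1) : IsIntegral ℤ a :=
  ⟨Polynomial.X ^ k - 1, Polynomial.monic_X_pow_sub_C 1 hk, by simp [h]⟩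

omit [FiniteDimensional ℂ V] in
theorem isIntegral_of_smul_one [Nontrivial V] {c : ℂ} (h : IsIntegral ℤ (c • (1 : Module.End ℂ V))) :
    IsIntegral ℤ c := by
  rw [← Algebra.algebraMap_eq_smul_one] at h
  exact (isIntegral_algebraMap_iff (algebraMap ℂ (Module.End ℂ V)).injective).1 h

/-- The integral group ring of a finite group is a finite ℤ-module, so all its elements, and their
images, are integral. This covers class sums and also sums over the intertwiner group. -/
theorem isIntegral_sum_monoidHom {P R ι : Type*} [Group P] [Finite P] [Ring R] (f : P →* R)
    (s : Finset ι) (g : ι → P) : IsIntegral ℤ (∑ i ∈ s, f (g i)) := by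
  have : Module.Finite ℤ (MonoidAlgebra ℤ P) := inferInstance
  have h : IsIntegral ℤ (∑ i ∈ s, MonoidAlgebra.of ℤ P (g i)) := Algebra.IsIntegral.isIntegral _
  have := h.map (MonoidAlgebra.lift ℤ R P f)
  simpa using this

variable {G : Type*} [Group G]

omit [FiniteDimensional ℂ V] in
theorem pow_card_eq_one_apply [Finite G] (ρ : Representation ℂ G V) (g : G) :
    ρ g ^ Nat.card G = 1 := by
  rw [← map_pow, pow_card_eq_one', map_one]

theorem isIntegral_character [Finite G] (ρ : Representation ℂ G V) (g : G) :
    IsIntegral ℤ (ρ.character g) :=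
  isIntegral_trace (isIntegral_of_pow_eq_one' Nat.card_pos.ne' (pow_card_eq_one_apply ρ g))

theorem Irr.isIntegral [Finite G] {χ : G → ℂ} (hχ : χ ∈ Irr G) (g : G) : IsIntegral ℤ (χ g) := by
  obtain ⟨n, ρ, -, rfl⟩ := hχ
  exact isIntegral_character ρ g

theorem Irr.exists_eq_sum [Finite G] {χ : G → ℂ} (hχ : χ ∈ Irr G) (g : G) :
    ∃ s : Multiset ℂ, (∀ μ ∈ s, μ ^ Nat.card G = 1) ∧ χ g = s.sum := by
  obtain ⟨n, ρ, -, rfl⟩ := hχ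
  exact exists_trace_eq_sum_roots_of_unity (pow_card_eq_one_apply ρ g)

theorem Irr.fieldOfValues_le [Finite G] {χ : G → ℂ} (hχ : χ ∈ Irr G) :
    fieldOfValues χ ≤ cyclotomic (Nat.card G) := by
  refine IntermediateField.adjoin_le_iff.2 ?_
  rintro _ ⟨g, rfl⟩
  obtain ⟨s, hs, h⟩ := Irr.exists_eq_sum hχ g
  rw [h]
  exact Subring.multiset_sum_mem (cyclotomic (Nat.card G)).toSubfield.toSubring s
    fun μ hμ => cyclotomic_le_of_pow_eq_one Nat.card_pos.ne' (hs μ hμ)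

end Integrality

section ClassFunction

variable {G : Type*} [Group G] [Fintype G]

theorem sum_smul_eq_smul_one {V : Type*} [AddCommGroup V] [Module ℂ V] [FiniteDimensional ℂ V]
    {ρ : Representation ℂ G V} (hρ : ρ.IsIrreducible) {z : G → ℂ}
    (hz : ∀ g h, z (h * g * h⁻¹) = z g) :
    ∑ g, z g • ρ g = ((∑ g, z g * ρ.character g) / ρ.character 1) • 1 := by
  have hcomm : ∀ h, (∑ g, z g • ρ g) * ρ h = ρ h * ∑ g, z g • ρ g := fun h => by
    rw [Finset.sum_mul, Finset.mul_sum]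
    refine (Fintype.sum_equiv (MulAut.conj h).toEquiv _ _ fun g => ?_).symm
    simp only [MulEquiv.toEquiv_eq_coe, EquivLike.coe_coe, MulAut.conj_apply]
    rw [hz, mul_smul_comm, smul_mul_assoc, ← map_mul, ← map_mul, inv_mul_cancel_right]
  rw [eq_trace_smul_one hρ _ hcomm, map_sum, char_one]
  simp only [map_smul, smul_eq_mul]
  rfl

open Classical in
theorem sum_filter_conj {R : Type*} [AddCommMonoid R] (x : G) (f : G → R) (c : R)
    (hf : ∀ g, f (g * x * g⁻¹) = c) :
    ∑ g with IsConj x g, f g = Nat.card (ConjClasses.mk x).carrier • c := by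
  rw [Finset.sum_congr rfl (g := fun _ => c), Finset.sum_const]
  · congr 1
    rw [Nat.card_eq_fintype_card, Fintype.card_subtype]
    congr 1
    ext g
    simp only [Finset.mem_filter, Finset.mem_univ, true_and, ConjClasses.mem_carrier_iff_mk_eq,
      ConjClasses.mk_eq_mk_iff_isConj]
    exact isConj_comm
  · intro g hg
    obtain ⟨h, rfl⟩ := isConj_iff.1 (Finset.mem_filter.1 hg).2
    exact hf h

open Classical in
theorem sum_conj_eq_smul_one {V : Type*} [AddCommGroup V] [Module ℂ V] [FiniteDimensional ℂ V]
    {ρ : Representation ℂ G V} (hρ : ρ.IsIrreducible) (x : G) :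
    ∑ g with IsConj x g, ρ g = centralChar ρ.character x • 1 := by
  have h := sum_smul_eq_smul_one hρ (z := fun g => if IsConj x g then 1 else 0) (fun g h => by
    have : IsConj x (h * g * h⁻¹) ↔ IsConj x g :=
      ⟨fun hc => hc.trans (isConj_iff.2 ⟨h⁻¹, by group⟩), fun hc => hc.trans (isConj_iff.2 ⟨h, rfl⟩)⟩
    simp only [this])
  simp only [ite_smul, one_smul, zero_smul, ite_mul, one_mul, zero_mul,
    ← Finset.sum_filter] at h
  rw [h, sum_filter_conj x ρ.character (ρ.character x) (fun g => ρ.char_conj x g), centralChar,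
    nsmul_eq_mul]

theorem isIntegral_centralChar {χ : G → ℂ} (hχ : χ ∈ Irr G) (x : G) :
    IsIntegral ℤ (centralChar χ x) := by
  classical
  obtain ⟨n, ρ, hρ, rfl⟩ := hχ
  have : Nontrivial (Fin n → ℂ) := (isIrreducible_iff.1 hρ).1
  refine isIntegral_of_smul_one (V := Fin n → ℂ) ?_
  rw [← sum_conj_eq_smul_one hρ x]
  exact isIntegral_sum_monoidHom ρ _ id

theorem sum_mul_div_eq_sum_conjClasses {χ : G → ℂ} (hχ : χ ∈ Irr G) {z : G → ℂ}
    (hz : ∀ g h, z (h * g * h⁻¹) = z g) [Fintype (ConjClasses G)] :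
    (∑ g, z g * χ g) / χ 1 = ∑ K : ConjClasses G, z K.out * centralChar χ K.out := by
  classical
  rw [← Finset.sum_fiberwise (s := Finset.univ) (g := ConjClasses.mk) (f := fun g => z g * χ g),
    Finset.sum_div]
  refine Finset.sum_congr rfl fun K _ => ?_
  have hK : ∀ g, ConjClasses.mk g = K ↔ IsConj K.out g := fun g => by
    conv_lhs => rw [← K.out_eq]
    exact eq_comm.trans ConjClasses.mk_eq_mk_iff_isConj
  simp_rw [hK]
  rw [sum_filter_conj K.out _ (z K.out * χ K.out) (fun g => by rw [hz, Irr.conj_apply hχ]),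
    centralChar, nsmul_eq_mul]
  ring

end ClassFunction

end FinChar

/-! ### The group algebra and its central idempotents -/

namespace FinChar

open Representation

section GroupAlgebra

variable {G : Type*} [Group G]

theorem equiv_apply {V W : Type*} [AddCommGroup V] [Module ℂ V] [AddCommGroup W]
    [Module ℂ W] {ρ : Representation ℂ G V} {σ : Representation ℂ G W} (φ : ρ.Equiv σ) (g : G)
    (v : V) : φ.toLinearEquiv (ρ g v) = σ g (φ.toLinearEquiv v) :=
  LinearMap.congr_fun (φ.isIntertwining' g) v

theorem isIrreducible_of_equiv {V W : Type*} [AddCommGroup V] [Module ℂ V] [AddCommGroup W]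
    [Module ℂ W] {ρ : Representation ℂ G V} {σ : Representation ℂ G W} (φ : ρ.Equiv σ)
    (hρ : ρ.IsIrreducible) : σ.IsIrreducible := by
  rw [isIrreducible_iff] at hρ ⊢
  have := hρ.1
  refine ⟨φ.toLinearEquiv.symm.toEquiv.nontrivial, fun U hU => ?_⟩
  have hφ : ∀ g v, φ.toLinearEquiv (ρ g v) = σ g (φ.toLinearEquiv v) :=
    equiv_apply φ
  refine (hρ.2 (U.comap φ.toLinearEquiv.toLinearMap) fun g v hv => ?_).imp (fun h => ?_)
    (fun h => ?_)
  · change φ.toLinearEquiv (ρ g v) ∈ U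
    rw [hφ]
    exact hU g _ hv
  · rw [eq_bot_iff]
    intro u hu
    have : φ.toLinearEquiv.symm u ∈ U.comap φ.toLinearEquiv.toLinearMap := by
      change φ.toLinearEquiv (φ.toLinearEquiv.symm u) ∈ U
      rwa [LinearEquiv.apply_symm_apply]
    rw [h, Submodule.mem_bot, LinearEquiv.map_eq_zero_iff] at this
    exact this
  · rw [eq_top_iff]
    intro u _
    have : φ.toLinearEquiv.symm u ∈ U.comap φ.toLinearEquiv.toLinearMap := h ▸ Submodule.mem_top
    change φ.toLinearEquiv (φ.toLinearEquiv.symm u) ∈ U at this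
    rwa [LinearEquiv.apply_symm_apply] at this

theorem exists_equiv_fin {V : Type*} [AddCommGroup V] [Module ℂ V] [FiniteDimensional ℂ V]
    (ρ : Representation ℂ G V) :
    ∃ (n : ℕ) (σ : Representation ℂ G (Fin n → ℂ)), Nonempty (ρ.Equiv σ) := by
  let e := (Module.finBasis ℂ V).equivFun
  refine ⟨_, (e.conjAlgEquiv ℂ : Module.End ℂ V →* _).comp ρ, ⟨.mk e fun g => ?_⟩⟩
  ext v
  simp [LinearEquiv.conjAlgEquiv_apply]

theorem character_mem_Irr {V : Type*} [AddCommGroup V] [Module ℂ V] [FiniteDimensional ℂ V]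
    {ρ : Representation ℂ G V} (hρ : ρ.IsIrreducible) : ρ.character ∈ Irr G := by
  obtain ⟨n, σ, ⟨φ⟩⟩ := exists_equiv_fin ρ
  exact ⟨n, σ, isIrreducible_of_equiv φ hρ, char_iso φ⟩

variable [Fintype G]

/-- The element `∑ z(g) g` of the group algebra. -/
noncomputable def ofFun (z : G → ℂ) : MonoidAlgebra ℂ G :=
  .ofCoeff (Finsupp.equivFunOnFinite.symm z)

omit [Group G] in
@[simp] theorem coeff_ofFun (z : G → ℂ) (g : G) : (ofFun z).coeff g = z g := rfl

theorem asAlgebraHom_eq_sum {V : Type*} [AddCommGroup V] [Module ℂ V] (ρ : Representation ℂ G V)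
    (z : MonoidAlgebra ℂ G) : ρ.asAlgebraHom z = ∑ g, z.coeff g • ρ g := by
  rw [asAlgebraHom_def, MonoidAlgebra.lift_apply]
  exact Finsupp.sum_fintype _ _ (fun _ => zero_smul _ _)

theorem isIrreducible_ofModule' {M : Type*} [AddCommGroup M] [Module ℂ M]
    [Module (MonoidAlgebra ℂ G) M] [IsScalarTower ℂ (MonoidAlgebra ℂ G) M]
    (hM : IsSimpleModule (MonoidAlgebra ℂ G) M) :
    (ofModule' M : Representation ℂ G M).IsIrreducible := by
  rw [isIrreducible_iff]
  have hact : ∀ (w : MonoidAlgebra ℂ G) (y : M),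
      (ofModule' M : Representation ℂ G M).asAlgebraHom w y = w • y := by
    intro w y
    rw [asAlgebraHom_def, ofModule', Equiv.apply_symm_apply]
    rfl
  refine ⟨IsSimpleModule.nontrivial (MonoidAlgebra ℂ G) M, fun U hU => ?_⟩
  let U' : Submodule (MonoidAlgebra ℂ G) M :=
    { U with
      smul_mem' := fun w y hy => by
        rw [← hact, asAlgebraHom_eq_sum, LinearMap.sum_apply]
        exact U.sum_mem fun g _ => U.smul_mem _ (hU g y hy) }
  refine (eq_bot_or_eq_top U').imp (fun h => ?_) (fun h => ?_)
  · ext y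
    have : y ∈ U' ↔ y ∈ (⊥ : Submodule (MonoidAlgebra ℂ G) M) := by rw [h]
    exact this
  · ext y
    have : y ∈ U' ↔ y ∈ (⊤ : Submodule (MonoidAlgebra ℂ G) M) := by rw [h]
    exact this

/-- By Maschke's theorem 1 lies in the sum of the simple left ideals, and z kills each of these
because each affords an irreducible representation. -/
theorem eq_zero_of_forall_irreducible (z : MonoidAlgebra ℂ G)
    (h : ∀ (n : ℕ) (ρ : Representation ℂ G (Fin n → ℂ)), ρ.IsIrreducible →
      ρ.asAlgebraHom z = 0) : z = 0 := by
  have hne : NeZero (Nat.card G : ℂ) := ⟨card_ne_zero'⟩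
  have hkill : ∀ m : Submodule (MonoidAlgebra ℂ G) (MonoidAlgebra ℂ G),
      IsSimpleModule (MonoidAlgebra ℂ G) m → ∀ a ∈ m, z * a = 0 := by
    intro m hm a ha
    let ρ : Representation ℂ G m := ofModule' m
    have hfin : FiniteDimensional ℂ m := FiniteDimensional.of_injective
      (m.subtype.restrictScalars ℂ) Subtype.val_injective
    obtain ⟨n, σ, ⟨φ⟩⟩ := exists_equiv_fin ρ
    have h0 := h n σ (isIrreducible_of_equiv φ (isIrreducible_ofModule' hm))
    have hact : ρ.asAlgebraHom z ⟨a, ha⟩ = z • (⟨a, ha⟩ : m) := by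
      rw [asAlgebraHom_def, show ρ = ofModule' m from rfl, ofModule', Equiv.apply_symm_apply]
      rfl
    have hφ : ∀ v, φ.toLinearEquiv (ρ.asAlgebraHom z v) = σ.asAlgebraHom z (φ.toLinearEquiv v) := by
      intro v
      rw [asAlgebraHom_eq_sum, asAlgebraHom_eq_sum, LinearMap.sum_apply, LinearMap.sum_apply,
        map_sum]
      refine Finset.sum_congr rfl fun g _ => ?_
      rw [LinearMap.smul_apply, LinearMap.smul_apply, map_smul]
      exact congrArg _ (equiv_apply φ g v)
    have h1 := hφ ⟨a, ha⟩
    rw [h0, LinearMap.zero_apply, LinearEquiv.map_eq_zero_iff, hact] at h1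
    exact congrArg Subtype.val h1
  have htop := IsSemisimpleModule.sSup_simples_eq_top (MonoidAlgebra ℂ G) (MonoidAlgebra ℂ G)
  have h1 : (1 : MonoidAlgebra ℂ G) ∈ sSup {m : Submodule (MonoidAlgebra ℂ G) (MonoidAlgebra ℂ G) |
    IsSimpleModule (MonoidAlgebra ℂ G) m} := htop ▸ Submodule.mem_top
  rw [sSup_eq_iSup'] at h1
  rw [← mul_one z]
  refine Submodule.iSup_induction _ (motive := fun a => z * a = 0) h1
    (fun m a ha => hkill m.1 m.2 a ha) (mul_zero z) (fun a b ha hb => ?_)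
  rw [mul_add, ha, hb, add_zero]

theorem eq_of_forall_irreducible {z w : MonoidAlgebra ℂ G}
    (h : ∀ (n : ℕ) (ρ : Representation ℂ G (Fin n → ℂ)), ρ.IsIrreducible →
      ρ.asAlgebraHom z = ρ.asAlgebraHom w) : z = w :=
  sub_eq_zero.1 (eq_zero_of_forall_irreducible _ fun n ρ hρ => by
    rw [map_sub, h n ρ hρ, sub_self])

/-- The coefficients of the central idempotent of `ℂG` attached to a set of irreducible
characters. -/
noncomputable def idem (S : Finset (G → ℂ)) (g : G) : ℂ :=
  (Nat.card G : ℂ)⁻¹ * ∑ χ ∈ S, χ 1 * χ g⁻¹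

omit [Fintype G] in
theorem idem_conj {S : Finset (G → ℂ)} (hS : ∀ χ ∈ S, χ ∈ Irr G) (g h : G) :
    idem S (h * g * h⁻¹) = idem S g := by
  rw [idem, idem]
  congr 1
  refine Finset.sum_congr rfl fun χ hχ => ?_
  rw [mul_inv_rev, mul_inv_rev, inv_inv, ← mul_assoc, Irr.conj_apply (hS χ hχ)]

open Classical in
theorem sum_idem_mul {S : Finset (G → ℂ)} (hS : ∀ χ ∈ S, χ ∈ Irr G) {ψ : G → ℂ}
    (hψ : ψ ∈ Irr G) : (∑ g, idem S g * ψ g) / ψ 1 = if ψ ∈ S then 1 else 0 := by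
  simp_rw [idem, mul_assoc, ← Finset.mul_sum, Finset.sum_mul]
  rw [Finset.sum_comm]
  have h : ∀ χ ∈ S, ∑ g, χ 1 * χ g⁻¹ * ψ g = if ψ = χ then χ 1 * Nat.card G else 0 := by
    intro χ hχ
    rw [← mul_ite_zero, ← sum_mul_inv_eq hψ (hS χ hχ), Finset.mul_sum]
    exact Finset.sum_congr rfl fun g _ => by ring
  rw [Finset.sum_congr rfl h, Finset.sum_ite_eq]
  split_ifs
  · rw [mul_comm (ψ 1), inv_mul_cancel_left₀ card_ne_zero', div_self (one_apply_ne_zero hψ)]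
  · rw [mul_zero, zero_div]

open Classical in
theorem asAlgebraHom_idem {S : Finset (G → ℂ)} (hS : ∀ χ ∈ S, χ ∈ Irr G) {V : Type*}
    [AddCommGroup V] [Module ℂ V] [FiniteDimensional ℂ V] {ρ : Representation ℂ G V}
    (hρ : ρ.IsIrreducible) :
    ρ.asAlgebraHom (ofFun (idem S)) = if ρ.character ∈ S then 1 else 0 := by
  rw [asAlgebraHom_eq_sum]
  simp_rw [coeff_ofFun]
  rw [sum_smul_eq_smul_one hρ (idem_conj hS), sum_idem_mul hS (character_mem_Irr hρ)]
  split_ifs <;> simp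

theorem eq_idem {S : Finset (G → ℂ)} (hS : ∀ χ ∈ S, χ ∈ Irr G) {z : MonoidAlgebra ℂ G}
    (h1 : ∀ (n : ℕ) (ρ : Representation ℂ G (Fin n → ℂ)), ρ.IsIrreducible → ρ.character ∈ S →
      ρ.asAlgebraHom z = 1)
    (h0 : ∀ (n : ℕ) (ρ : Representation ℂ G (Fin n → ℂ)), ρ.IsIrreducible → ρ.character ∉ S →
      ρ.asAlgebraHom z = 0) : z = ofFun (idem S) := by
  refine eq_of_forall_irreducible fun n ρ hρ => ?_
  rw [asAlgebraHom_idem hS hρ]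
  split_ifs with h
  · exact h1 n ρ hρ h
  · exact h0 n ρ hρ h

theorem idem_mul_idem {S : Finset (G → ℂ)} (hS : ∀ χ ∈ S, χ ∈ Irr G) :
    ofFun (idem S) * ofFun (idem S) = ofFun (idem S) := by
  classical
  refine eq_idem hS (fun n ρ hρ h => ?_) (fun n ρ hρ h => ?_) <;>
  rw [map_mul, asAlgebraHom_idem hS hρ] <;> simp [h]

end GroupAlgebra

/-! ### Integrality of block idempotents -/

section BlockIdempotent

variable {G : Type*} [Group G] [Fintype G] {B : ValuationSubring ℂ} {p : ℕ}
  {M : Ideal (integralClosure ℤ ℂ)}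

theorem mem_block_iff (hB : Dominates B p M) {χ ψ : G → ℂ} (hχ : χ ∈ Irr G) :
    ψ ∈ block M χ ↔ ψ ∈ Irr G ∧
      ∀ x, B.valuation (centralChar ψ x - centralChar χ x) < 1 := by
  refine and_congr_right fun hψ => forall_congr' fun x => ⟨?_, fun h => ?_⟩
  · rintro ⟨r, hr, e⟩
    rw [← e]
    exact (hB.lt_one_iff r).2 hr
  · exact ⟨⟨_, (isIntegral_centralChar hψ x).sub (isIntegral_centralChar hχ x)⟩,
      (hB.lt_one_iff _).1 h, rfl⟩

theorem block_finite (M : Ideal (integralClosure ℤ ℂ)) (χ : G → ℂ) : (block M χ).Finite :=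
  Irr.finite.subset fun _ h => h.1

/-- Elements of the group algebra with coefficients in `B`. -/
def integralSubring (G : Type*) [Group G] [Fintype G] (B : ValuationSubring ℂ) :
    Subring (MonoidAlgebra ℂ G) where
  carrier := {z | ∀ g, z.coeff g ∈ B}
  mul_mem' {a b} ha hb g := by
    classical
    rw [MonoidAlgebra.coeff_mul_apply_left, Finsupp.sum]
    exact B.toSubring.sum_mem fun h _ => B.mul_mem _ _ (ha h) (hb _)
  one_mem' g := by
    classical
    rw [MonoidAlgebra.one_def, MonoidAlgebra.coeff_single, Finsupp.single_apply]
    split_ifs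
    · exact B.one_mem
    · exact B.zero_mem
  add_mem' {a b} ha hb g := B.add_mem _ _ (ha g) (hb g)
  zero_mem' g := B.zero_mem
  neg_mem' {a} ha g := B.neg_mem _ (ha g)

theorem smul_mem_integralSubring {c : ℂ} (hc : c ∈ B) {z : MonoidAlgebra ℂ G}
    (hz : z ∈ integralSubring G B) : c • z ∈ integralSubring G B :=
  fun g => B.mul_mem _ _ hc (hz g)

/-- The idempotent is rebuilt as a polynomial, with coefficients in `B`, in class sums. For each η
outside the block, some class sum separates ω_η from ω_χ by a unit. -/
theorem idem_mem (hB : Dominates B p M) {χ : G → ℂ} (hχ : χ ∈ Irr G) (g : G) :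
    idem (block_finite M χ).toFinset g ∈ B := by
  classical
  let S := (block_finite M χ).toFinset
  have hS : ∀ η ∈ S, η ∈ Irr G := fun η hη => ((block_finite M χ).mem_toFinset.1 hη).1
  let R := (Irr.finite (G := G)).toFinset \ S
  have hB1 : ∀ {c : ℂ}, IsIntegral ℤ c → c ∈ B := fun hc =>
    (B.valuation_le_one_iff _).1 (hB.integral_le_one _ hc)
  have hR : ∀ η : R, ∃ x, B.valuation (centralChar η.1 x - centralChar χ x) = 1 := by
    rintro ⟨η, hη⟩
    rw [Finset.mem_sdiff, Set.Finite.mem_toFinset, Set.Finite.mem_toFinset, mem_block_iff hB hχ]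
      at hη
    obtain ⟨hη, hn⟩ := hη
    push Not at hn
    obtain ⟨x, hx⟩ := hn hη
    exact ⟨x, le_antisymm (hB.integral_le_one _
      ((isIntegral_centralChar hη x).sub (isIntegral_centralChar hχ x))) hx⟩
  choose x hx using hR
  have hRirr : ∀ η : R, η.1 ∈ Irr G := fun η =>
    (Irr.finite (G := G)).mem_toFinset.1 (Finset.mem_sdiff.1 η.2).1
  let k : R → MonoidAlgebra ℂ G := fun η => ofFun (fun g => if IsConj (x η) g then 1 else 0) -
    algebraMap ℂ _ (centralChar η.1 (x η))
  have hk : ∀ {n : ℕ} {ρ : Representation ℂ G (Fin n → ℂ)}, ρ.IsIrreducible → ∀ η : R,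
      ρ.asAlgebraHom (k η) =
        algebraMap ℂ _ (centralChar ρ.character (x η) - centralChar η.1 (x η)) := by
    intro n ρ hρ η
    rw [map_sub, AlgHom.commutes, asAlgebraHom_eq_sum, map_sub]
    congr 1
    rw [Algebra.algebraMap_eq_smul_one, ← sum_conj_eq_smul_one hρ, Finset.sum_filter]
    exact Finset.sum_congr rfl fun g _ => by simp only [coeff_ofFun, ite_smul, one_smul, zero_smul]
  have hkmem : ∀ η, k η ∈ integralSubring G B := fun η => by
    refine sub_mem (fun g => ?_) ?_
    · rw [coeff_ofFun]
      split_ifs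
      · exact B.one_mem
      · exact B.zero_mem
    · rw [Algebra.algebraMap_eq_smul_one]
      exact smul_mem_integralSubring (hB1 (isIntegral_centralChar (hRirr η) _)) (one_mem _)
  -- `b` acts on each irreducible module by the scalar `c`, which is zero outside the block and a
  -- unit on it.
  let b : MonoidAlgebra ℂ G := (Finset.univ.toList.map k).prod
  let c : (G → ℂ) → ℂ := fun ψ =>
    (Finset.univ.toList.map fun η : R => centralChar ψ (x η) - centralChar η.1 (x η)).prod
  have hb : ∀ {n : ℕ} {ρ : Representation ℂ G (Fin n → ℂ)}, ρ.IsIrreducible →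
      ρ.asAlgebraHom b = algebraMap ℂ _ (c ρ.character) := by
    intro n ρ hρ
    rw [map_list_prod, map_list_prod, List.map_map, List.map_map]
    congr 1
    exact List.map_congr_left fun η _ => hk hρ η
  have hbmem : b ∈ integralSubring G B := list_prod_mem fun y hy => by
    obtain ⟨η, -, rfl⟩ := List.mem_map.1 hy
    exact hkmem η
  have hc0 : ∀ ψ ∈ R, c ψ = 0 := fun ψ hψ => List.prod_eq_zero
    (List.mem_map.2 ⟨⟨ψ, hψ⟩, Finset.mem_toList.2 (Finset.mem_univ _), sub_self _⟩)
  have hc1 : ∀ ψ ∈ S, B.valuation (c ψ) = 1 := by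
    intro ψ hψ
    rw [map_list_prod, List.map_map]
    refine List.prod_eq_one fun y hy => ?_
    obtain ⟨η, -, rfl⟩ := List.mem_map.1 hy
    have h1 := ((mem_block_iff hB hχ).1 ((block_finite M χ).mem_toFinset.1 hψ)).2 (x η)
    have e : centralChar ψ (x η) - centralChar η.1 (x η) =
        (centralChar ψ (x η) - centralChar χ (x η)) -
          (centralChar η.1 (x η) - centralChar χ (x η)) := by ring
    change B.valuation (centralChar ψ (x η) - centralChar η.1 (x η)) = 1
    rw [e, Valuation.map_sub_eq_of_lt_right _ (by rw [hx]; exact h1), hx]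
  -- On a module in the block the factor for its own character vanishes, so `e` acts as 1; off the
  -- block `b` acts as 0, so `e` does too. Only units `c ψ` are inverted.
  let e : MonoidAlgebra ℂ G := 1 - (S.toList.map fun ψ => 1 - (c ψ)⁻¹ • b).prod
  have he : ∀ {n : ℕ} {ρ : Representation ℂ G (Fin n → ℂ)}, ρ.IsIrreducible →
      ρ.asAlgebraHom e = algebraMap ℂ _
        (1 - (S.toList.map fun ψ => 1 - (c ψ)⁻¹ * c ρ.character).prod) := by
    intro n ρ hρ
    rw [map_sub, map_sub, map_one, map_one, map_list_prod, map_list_prod, List.map_map,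
      List.map_map]
    congr 2
    refine List.map_congr_left fun ψ _ => ?_
    rw [Function.comp_apply, Function.comp_apply, map_sub, map_sub, map_one, map_one, map_smul,
      hb hρ, map_mul, ← Algebra.smul_def]
  have hemem : e ∈ integralSubring G B := by
    refine sub_mem (one_mem _) (list_prod_mem fun y hy => ?_)
    obtain ⟨ψ, hψ, rfl⟩ := List.mem_map.1 hy
    refine sub_mem (one_mem _) (smul_mem_integralSubring ?_ hbmem)
    rw [← B.valuation_le_one_iff, map_inv₀, hc1 ψ (Finset.mem_toList.1 hψ), inv_one]
  have heq : e = ofFun (idem S) := by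
    refine eq_idem hS (fun n ρ hρ h => ?_) (fun n ρ hρ h => ?_)
    · have hne : c ρ.character ≠ 0 := fun h0 => by
        have := hc1 _ h
        rw [h0, map_zero] at this
        exact zero_ne_one this
      rw [he hρ, List.prod_eq_zero, sub_zero, map_one]
      exact List.mem_map.2 ⟨_, Finset.mem_toList.2 h, by rw [inv_mul_cancel₀ hne, sub_self]⟩
    · rw [he hρ, hc0 _ (Finset.mem_sdiff.2 ⟨Irr.finite.mem_toFinset.2 ⟨n, ρ, hρ, rfl⟩, h⟩)]
      simp
  have := hemem g
  rwa [heq] at this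

end BlockIdempotent

end FinChar

/-! ### Height zero and induction -/

namespace FinChar

open Representation

section Height

variable {G : Type*} [Group G] [Fintype G] {B : ValuationSubring ℂ} {p : ℕ}
  {M : Ideal (integralClosure ℤ ℂ)}

omit [Fintype G] in
theorem height_eq_zero_iff_valuation (hB : Dominates B p M) {χ : G → ℂ} (hχ : χ ∈ Irr G) :
    height p M χ = 0 ↔ ∀ ψ ∈ block M χ, B.valuation (ψ 1) ≤ B.valuation (χ 1) := by
  rw [Irr.height_eq_zero_iff p M hχ]
  refine forall₂_congr fun ψ hψ => ?_
  rw [← Irr.degree_eq hχ, ← Irr.degree_eq hψ.1,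
    hB.natCast_le_natCast_iff (degree_ne_zero hψ.1) (degree_ne_zero hχ)]

theorem valuation_sum_class_sub_lt_one (hB : Dominates B p M) {χ ψ : G → ℂ} (hχ : χ ∈ Irr G)
    (hψ : ψ ∈ block M χ) {z : G → ℂ} (hz : ∀ g h, z (h * g * h⁻¹) = z g) (hzB : ∀ g, z g ∈ B) :
    B.valuation ((∑ g, z g * ψ g) / ψ 1 - (∑ g, z g * χ g) / χ 1) < 1 := by
  classical
  rw [sum_mul_div_eq_sum_conjClasses hψ.1 hz, sum_mul_div_eq_sum_conjClasses hχ hz,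
    ← Finset.sum_sub_distrib]
  refine B.valuation.map_sum_lt one_ne_zero fun K _ => ?_
  rw [← mul_sub, map_mul]
  exact (mul_le_of_le_one_left' ((B.valuation_le_one_iff _).2 (hzB _))).trans_lt
    (((mem_block_iff hB hχ).1 hψ).2 _)

theorem valuation_eq_one_of_sub_lt_one {x y : ℂ} (hx : B.valuation x = 1)
    (h : B.valuation (y - x) < 1) : B.valuation y = 1 := by
  have e : y = (y - x) + x := by ring
  rw [e, Valuation.map_add_eq_of_lt_right _ (by rwa [hx]), hx]

open Classical in
/-- Extension by zero of a function on a subgroup. -/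
noncomputable def extendZero {H : Subgroup G} (ψ : H → ℂ) (g : G) : ℂ :=
  if h : g ∈ H then ψ ⟨g, h⟩ else 0

omit [Fintype G] in
theorem extendZero_coe {H : Subgroup G} (ψ : H → ℂ) (h : H) : extendZero ψ h = ψ h := by
  rw [extendZero, dif_pos h.2]

omit [Fintype G] in
theorem extendZero_of_notMem {H : Subgroup G} (ψ : H → ℂ) {g : G} (h : g ∉ H) :
    extendZero ψ g = 0 := by
  rw [extendZero, dif_neg h]

omit [Fintype G] in
theorem extendZero_conj {H : Subgroup G} {ψ : H → ℂ} (hψ : ψ ∈ Irr H) (h : H) (g : G) :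
    extendZero ψ (h * g * h⁻¹) = extendZero ψ g := by
  by_cases hg : g ∈ H
  · lift g to H using hg
    exact (extendZero_coe ψ (h * g * h⁻¹)).trans
      ((Irr.conj_apply hψ g h).trans (extendZero_coe ψ g).symm)
  · rw [extendZero_of_notMem ψ hg, extendZero_of_notMem]
    intro hc
    have := H.mul_mem (H.mul_mem (H.inv_mem h.2) hc) h.2
    simp [mul_assoc] at this
    exact hg this

theorem induce_eq {H : Subgroup G} (ψ : H → ℂ) (g : G) :
    induce ψ g = (Nat.card H : ℂ)⁻¹ * ∑ x : G, extendZero ψ (x * g * x⁻¹) := by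
  rw [induce, finsum_eq_sum_of_fintype]
  rfl

theorem sum_mul_extendZero {H : Subgroup G} [Fintype H] (ψ : H → ℂ) (z : G → ℂ) :
    ∑ g, z g * extendZero ψ g = ∑ h : H, z h * ψ h := by
  classical
  symm
  refine Finset.sum_of_injOn Subtype.val Subtype.val_injective.injOn (fun _ _ => Finset.mem_univ _)
    (fun g _ hg => ?_) (fun h _ => by rw [extendZero_coe])
  rw [extendZero_of_notMem, mul_zero]
  exact fun h => hg ⟨⟨g, h⟩, Finset.mem_coe.2 (Finset.mem_univ _), rfl⟩

theorem sum_mul_induce {H : Subgroup G} [Fintype H] (ψ : H → ℂ) {z : G → ℂ}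
    (hz : ∀ g h, z (h * g * h⁻¹) = z g) :
    Nat.card H * ∑ g, z g * induce ψ g = Nat.card G * ∑ h : H, z h * ψ h := by
  have h : ∀ g, z g * induce ψ g =
      (Nat.card H : ℂ)⁻¹ * ∑ x : G, z (x * g * x⁻¹) * extendZero ψ (x * g * x⁻¹) := by
    intro g
    simp_rw [hz, induce_eq, ← Finset.mul_sum]
    ring
  simp_rw [h]
  rw [← Finset.mul_sum, mul_inv_cancel_left₀ card_ne_zero', Finset.sum_comm]
  have h2 : ∀ x : G, ∑ g, z (x * g * x⁻¹) * extendZero ψ (x * g * x⁻¹) = ∑ h : H, z h * ψ h := by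
    intro x
    rw [← sum_mul_extendZero]
    exact Fintype.sum_equiv (MulAut.conj x).toEquiv _ _ fun g => rfl
  simp_rw [h2]
  rw [Finset.sum_const, Finset.card_univ, ← Nat.card_eq_fintype_card, nsmul_eq_mul]

theorem induce_one {H : Subgroup G} (ψ : H → ℂ) :
    Nat.card H * induce ψ 1 = Nat.card G * ψ 1 := by
  classical
  have h := sum_mul_induce ψ (z := fun g => if g = 1 then 1 else 0) (fun g h => by
    simp only [conj_eq_one_iff])
  simpa using h

/-- If an irreducible character of height zero is induced from a character of a subgroup, then the
latter has height zero. -/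
theorem height_eq_zero_of_induce (hB : Dominates B p M) {χ : G → ℂ} (hχ : χ ∈ Irr G)
    (h0 : height p M χ = 0) {H : Subgroup G} {ψ : H → ℂ} (hψ : ψ ∈ Irr H)
    (hind : induce ψ = χ) : height p M ψ = 0 := by
  classical
  rw [height_eq_zero_iff_valuation hB hχ] at h0
  rw [height_eq_zero_iff_valuation hB hψ]
  intro ψ' hψ'
  let S := (block_finite M χ).toFinset
  have hmem : ∀ η, η ∈ S ↔ η ∈ block M χ := fun η => (block_finite M χ).mem_toFinset
  have hS : ∀ η ∈ S, η ∈ Irr G := fun η hη => ((hmem η).1 hη).1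
  have hcG := card_ne_zero' (G := G)
  have hcH := card_ne_zero' (G := H)
  have hdeg : Nat.card H * χ 1 = Nat.card G * ψ 1 := hind ▸ induce_one ψ
  -- Since χ is induced from ψ, the central character of ψ takes the same value on the restriction
  -- to H of the block idempotent as that of χ takes on the idempotent itself.
  have h1 : (∑ h : H, idem S h * ψ h) / ψ 1 = 1 := by
    have e1 := sum_idem_mul hS hχ
    rw [if_pos ((hmem χ).2 (Irr.mem_block M hχ)), div_eq_one_iff_eq (one_apply_ne_zero hχ)] at e1
    have e2 := sum_mul_induce ψ (idem_conj hS)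
    rw [hind, e1, hdeg] at e2
    rw [div_eq_one_iff_eq (one_apply_ne_zero hψ)]
    exact (mul_left_cancel₀ hcG e2).symm
  have h2 := valuation_sum_class_sub_lt_one hB hψ hψ' (z := fun h : H => idem S h)
    (fun g h => idem_conj hS g h) (fun g => idem_mem hB hχ g)
  rw [h1] at h2
  have h3 := valuation_eq_one_of_sub_lt_one (by rw [map_one]) h2
  have hm : ∀ η ∈ S, ∃ m : ℕ, ∑ h : H, η (h : G)⁻¹ * ψ' h = Nat.card H * m := by
    intro η hη
    obtain ⟨n, σ, hσ, rfl⟩ := hS η hη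
    obtain ⟨n', σ', hσ', rfl⟩ := hψ'.1
    have := sum_char_mul_char_inv_eq (σ.comp H.subtype) σ'
    refine ⟨_, Eq.trans (Finset.sum_congr rfl fun h _ => ?_) this⟩
    exact mul_comm _ _
  have h4 : (∑ h : H, idem S h * ψ' h) / ψ' 1 =
      ∑ η ∈ S, (Nat.card G : ℂ)⁻¹ * η 1 * (∑ h : H, η (h : G)⁻¹ * ψ' h) / ψ' 1 := by
    rw [← Finset.sum_div]
    congr 1
    simp_rw [idem, mul_assoc, Finset.sum_mul, Finset.mul_sum]
    rw [Finset.sum_comm]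
    simp_rw [mul_assoc]
  -- The sum over the block is a unit, so some term is not small. Its pairing with ψ' is |H| times a
  -- multiplicity `m`; comparing η(1) with χ(1), and using |H|χ(1) = |G|ψ(1), bounds ψ'(1).
  have h5 : ∃ η ∈ S, 1 ≤ B.valuation
      ((Nat.card G : ℂ)⁻¹ * η 1 * (∑ h : H, η (h : G)⁻¹ * ψ' h) / ψ' 1) := by
    by_contra hcon
    push Not at hcon
    have := B.valuation.map_sum_lt one_ne_zero hcon
    rw [← h4, h3] at this
    exact lt_irrefl _ this
  obtain ⟨η, hη, h5⟩ := h5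
  obtain ⟨m, hm⟩ := hm η hη
  rw [hm] at h5
  have hψ'1 := one_apply_ne_zero hψ'.1
  have e : (Nat.card G : ℂ) * ψ' 1 * ((Nat.card G : ℂ)⁻¹ * η 1 * (Nat.card H * m) / ψ' 1) =
      Nat.card H * η 1 * m := by field_simp
  have h6 : B.valuation (Nat.card G * ψ' 1) ≤ B.valuation (Nat.card H * η 1 * m) := by
    rw [← e, map_mul]
    exact le_mul_of_one_le_right' h5
  have h7 : B.valuation (Nat.card G * ψ' 1) ≤ B.valuation (Nat.card G * ψ 1) := by
    refine h6.trans ?_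
    rw [← hdeg, map_mul, map_mul, map_mul _ (Nat.card H : ℂ)]
    exact (mul_le_of_le_one_right' (hB.natCast_le_one m)).trans
      (mul_le_mul_right (h0 η ((hmem η).1 hη)) _)
  rw [map_mul, map_mul] at h7
  exact le_of_mul_le_mul_left h7 (zero_lt_iff.2 (by rwa [Ne, map_eq_zero]))

end Height

end FinChar

/-! ### Central idempotents modulo p are supported on p-regular elements -/

namespace FinChar

open Representation

section Support

variable {G : Type*} [Group G]

theorem coeff_ofFun_pow [Fintype G] (z : G → ℂ) (q : ℕ) (g : G) [DecidableEq G] :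
    (ofFun z ^ q).coeff g =
      ∑ k : Fin q → G, if (List.ofFn k).prod = g then ∏ i, z (k i) else 0 := by
  induction q generalizing g with
  | zero =>
    rw [pow_zero, MonoidAlgebra.one_def, MonoidAlgebra.coeff_single, Finsupp.single_apply]
    simp
  | succ q ih =>
    rw [pow_succ', MonoidAlgebra.coeff_mul_apply_left, Finsupp.sum_fintype _ _ (fun _ => zero_mul _),
      ← (Fin.consEquiv fun _ => G).sum_comp, Fintype.sum_prod_type]
    refine Finset.sum_congr rfl fun h _ => ?_
    rw [ih, Finset.mul_sum, coeff_ofFun]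
    refine Finset.sum_congr rfl fun k _ => ?_
    have e : (List.ofFn (Fin.consEquiv (fun _ => G) (h, k))).prod = h * (List.ofFn k).prod := by
      rw [List.ofFn_succ, List.prod_cons]
      rfl
    rw [e]
    simp only [Fin.consEquiv_apply, Fin.prod_univ_succ,
      Fin.cons_zero, Fin.cons_succ, mul_ite, mul_zero, eq_inv_mul_iff_mul_eq]

/-- Sequences in `G` with `k (i + q) = g⁻¹ k(i) g` and `k(0) ⋯ k(q - 1) = g`. They correspond to the
factorizations of `g` into `q` factors, and are permuted by the shift. -/
@[ext]
structure TwistedSeq (q : ℕ) (g : G) where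
  /-- The underlying sequence. -/
  seq : ℕ → G
  add_period : ∀ i, seq (i + q) = g⁻¹ * seq i * g
  prod_eq : ((List.range q).map seq).prod = g

namespace TwistedSeq

variable {q : ℕ} {g : G}

/-- The shift of a twisted sequence. -/
def shift (k : TwistedSeq q g) : TwistedSeq q g where
  seq i := k.seq (i + 1)
  add_period i := by rw [← k.add_period (i + 1), Nat.add_right_comm]
  prod_eq := by
    have h1 := List.prod_range_succ k.seq q
    have h2 := List.prod_range_succ' k.seq q
    have h3 := k.add_period 0
    rw [zero_add] at h3
    rw [h2, k.prod_eq, h3, mul_assoc, mul_inv_cancel_left] at h1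
    exact mul_left_cancel h1

theorem shift_iterate (k : TwistedSeq q g) (n i : ℕ) : (shift^[n] k).seq i = k.seq (i + n) := by
  induction n generalizing i with
  | zero => rfl
  | succ n ih =>
    rw [Function.iterate_succ_apply']
    change (shift^[n] k).seq (i + 1) = _
    rw [ih, Nat.add_right_comm, Nat.add_assoc]

theorem apply_add_mul (k : TwistedSeq q g) (n i : ℕ) :
    k.seq (i + q * n) = (g ^ n)⁻¹ * k.seq i * g ^ n := by
  induction n with
  | zero => simp
  | succ n ih =>
    rw [mul_add, mul_one, ← add_assoc, k.add_period, ih, pow_succ]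
    group

theorem prod_range_mul (k : TwistedSeq q g) (n : ℕ) :
    ((List.range (q * n)).map k.seq).prod = g ^ n := by
  induction n with
  | zero => simp
  | succ n ih =>
    rw [mul_add, mul_one, List.range_add, List.map_append, List.prod_append, ih, pow_succ,
      List.map_map]
    have h := (shift^[q * n] k).prod_eq
    have e : (shift^[q * n] k).seq = k.seq ∘ fun i => q * n + i := funext fun i => by
      rw [shift_iterate, Function.comp_apply, add_comm]
    rw [e] at h
    rw [h]

theorem prod_range_mul_of_periodic (k : TwistedSeq q g) {m : ℕ}
    (hk : ∀ i, k.seq (i + m) = k.seq i) (n : ℕ) :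
    ((List.range (m * n)).map k.seq).prod = ((List.range m).map k.seq).prod ^ n := by
  have hk' : ∀ n i, k.seq (i + m * n) = k.seq i := fun n => by
    induction n with
    | zero => intro i; rfl
    | succ n ih => intro i; rw [mul_add, mul_one, ← add_assoc, hk, ih]
  induction n with
  | zero => simp
  | succ n ih =>
    rw [mul_add, mul_one, List.range_add, List.map_append, List.prod_append, ih, pow_succ,
      List.map_map]
    have e : (k.seq ∘ fun i => m * n + i) = k.seq := funext fun i => by
      rw [Function.comp_apply, add_comm, hk']
    rw [e]

theorem prod_ofFn_eq (f : ℕ → G) (q : ℕ) :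
    (List.ofFn fun i : Fin q => f i).prod = ((List.range q).map f).prod := by
  rw [List.ext_getElem (l₁ := List.ofFn fun i : Fin q => f i) (l₂ := (List.range q).map f)
    (by simp) (by simp)]

/-- A twisted sequence is determined by its first `q` terms. -/
def equivFin (hq : q ≠ 0) (g : G) : TwistedSeq q g ≃ {k : Fin q → G // (List.ofFn k).prod = g} where
  toFun k := ⟨fun i => k.seq i, by rw [prod_ofFn_eq, k.prod_eq]⟩
  invFun k :=
    { seq := fun i => (g ^ (i / q))⁻¹ * k.1 ⟨i % q, Nat.mod_lt _ (Nat.pos_of_ne_zero hq)⟩ *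
        g ^ (i / q)
      add_period := fun i => by
        have h1 := Nat.add_div_right i (Nat.pos_of_ne_zero hq)
        have h2 := Nat.add_mod_right i q
        simp only [h1, h2, pow_succ]
        group
      prod_eq := by
        rw [← prod_ofFn_eq]
        conv_rhs => rw [← k.2]
        congr 2
        funext i
        simp [Nat.div_eq_of_lt i.2, Nat.mod_eq_of_lt i.2] }
  left_inv k := by
    refine TwistedSeq.ext (funext fun i => ?_)
    conv_rhs => rw [← Nat.mod_add_div i q, apply_add_mul]
  right_inv k := by
    refine Subtype.ext (funext fun i => ?_)
    simp [Nat.div_eq_of_lt i.2, Nat.mod_eq_of_lt i.2]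

/-- The weight of a twisted sequence. -/
noncomputable def weight (z : G → ℂ) (k : TwistedSeq q g) : ℂ := ∏ i ∈ Finset.range q, z (k.seq i)

theorem weight_shift {z : G → ℂ} (hz : ∀ g h, z (h * g * h⁻¹) = z g) (k : TwistedSeq q g) :
    weight z k.shift = weight z k := by
  cases q with
  | zero => rfl
  | succ q =>
    rw [weight, weight, Finset.prod_range_succ, Finset.prod_range_succ']
    congr 1
    change z (k.seq (q + 1)) = z (k.seq 0)
    have h := k.add_period 0
    rw [zero_add] at h
    rw [h]
    have := hz (k.seq 0) g⁻¹
    rwa [inv_inv] at this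

end TwistedSeq

/-- Since z equals its q-th power for q = |G|_p, z(g) is a weighted sum over factorizations of g
into q factors. The twisted cyclic shift preserves weights, and a suitable power of it has p-power
order and no fixed points. -/
theorem valuation_idempotent_lt_one [Fintype G] {B : ValuationSubring ℂ} {p : ℕ}
    {M : Ideal (integralClosure ℤ ℂ)} (hB : Dominates B p M) {z : G → ℂ}
    (hz : ∀ g h, z (h * g * h⁻¹) = z g) (hzB : ∀ g, z g ∈ B)
    (hidem : ofFun z * ofFun z = ofFun z) {g : G} (hg : p ∣ orderOf g) :
    B.valuation (z g) < 1 := by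
  classical
  have := Fact.mk hB.prime
  obtain ⟨a, N, hpN, hN⟩ := Nat.exists_eq_pow_mul_and_not_dvd (Nat.card_pos (α := G)).ne' p
    hB.prime.ne_one
  obtain ⟨b, m, hpm, hm⟩ := Nat.exists_eq_pow_mul_and_not_dvd (orderOf_pos g).ne' p
    hB.prime.ne_one
  set q := p ^ a with hqdef
  have hq : q ≠ 0 := pow_ne_zero _ hB.prime.ne_zero
  have hpow : ofFun z ^ q = ofFun z := by
    obtain ⟨q', hq'⟩ := Nat.exists_eq_succ_of_ne_zero hq
    rw [hq']
    exact IsIdempotentElem.pow_succ_eq q' hidem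
  let _ : Fintype (TwistedSeq q g) := Fintype.ofEquiv _ (TwistedSeq.equivFin hq g).symm
  have hsum : z g = ∑ k : TwistedSeq q g, k.weight z := by
    rw [← coeff_ofFun z g, ← hpow, coeff_ofFun_pow, ← Finset.sum_filter,
      Finset.sum_subtype (p := fun k : Fin q → G => (List.ofFn k).prod = g) _ (by simp),
      ← (TwistedSeq.equivFin hq g).sum_comp]
    refine Finset.sum_congr rfl fun k _ => ?_
    rw [TwistedSeq.weight, Finset.prod_range]
    rfl
  rw [hsum]
  have hw : ∀ (n : ℕ) (k : TwistedSeq q g), (TwistedSeq.shift^[n] k).weight z = k.weight z := by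
    intro n k
    induction n with
    | zero => rfl
    | succ n ih => rw [Function.iterate_succ_apply', TwistedSeq.weight_shift hz, ih]
  -- With `m` the p'-part of the order of g, the p^(a+b)-th power of this permutation shifts by q
  -- times that order, hence is trivial.
  refine hB.sum_lt_one_of_perm (TwistedSeq.shift^[m]) (a + b) ?_ (fun k hk => ?_) _ (fun k => ?_)
    (fun k => ?_)
  · rw [← Function.iterate_mul]
    funext k
    refine TwistedSeq.ext (funext fun i => ?_)
    have : m * p ^ (a + b) = q * orderOf g := by rw [hm, hqdef]; ring
    rw [TwistedSeq.shift_iterate, this, TwistedSeq.apply_add_mul, pow_orderOf_eq_one]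
    simp
  -- For a fixed sequence, the product of the first qm terms is g^m and also the q-th power of an
  -- element of G. Raising to the power `N` = |G|/q gives g^(mN) = 1, so p^b divides `N`:
  -- impossible, as p divides the order of g.
  · have hper : ∀ i, k.seq (i + m) = k.seq i := fun i => by
      rw [← TwistedSeq.shift_iterate, hk]
    have h1 := k.prod_range_mul m
    rw [mul_comm, k.prod_range_mul_of_periodic hper] at h1
    have h2 : g ^ (m * N) = 1 := by
      rw [pow_mul, ← h1, ← pow_mul, ← hN, pow_card_eq_one']
    have h3 := orderOf_dvd_of_pow_eq_one h2
    rw [hm, mul_comm] at h3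
    have hm0 : m ≠ 0 := fun h => hpm (h ▸ dvd_zero p)
    have h4 := Nat.dvd_of_mul_dvd_mul_left (Nat.pos_of_ne_zero hm0) h3
    have hb : b ≠ 0 := by
      rintro rfl
      rw [pow_zero, one_mul] at hm
      exact hpm (hm ▸ hg)
    exact hpN ((dvd_pow_self p hb).trans h4)
  · rw [B.valuation_le_one_iff]
    exact B.toSubring.prod_mem fun i _ => hzB _
  · rw [hw, sub_self, map_zero]
    exact zero_lt_one

end Support

end FinChar

/-! ### Characters of height zero take a unit value -/

namespace FinChar

open Representation

section HeightZero

variable {G : Type*} [Group G] [Fintype G]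

theorem card_centralizer_mul_card_class (x : G) :
    Nat.card (Subgroup.centralizer {x}) * Nat.card (ConjClasses.mk x).carrier = Nat.card G := by
  rw [Subgroup.nat_card_centralizer_nat_card_stabilizer, ← ConjAct.orbit_eq_carrier_conjClasses,
    mul_comm]
  classical
  simp_rw [Nat.card_eq_fintype_card]
  exact MulAction.card_orbit_mul_card_stabilizer_eq_card_group (ConjAct G) x

/-- t is the trace of ρ(y)P, with P the projection onto the D-fixed vectors. P is idempotent and
commutes with ρ(y), so ρ(y)P is a root of X^(|G|+1) − X, even though P involves division by |D|. -/
theorem exists_sum_eq_card_mul {D : Type*} [Group D] [Fintype D] (i : D →* G) {χ : G → ℂ}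
    (hχ : χ ∈ Irr G) {y : G} (hy : ∀ d, Commute y (i d)) :
    ∃ t : ℂ, IsIntegral ℤ t ∧ ∑ d, χ (y * i d) = Nat.card D * t := by
  obtain ⟨n, ρ, -, rfl⟩ := hχ
  have hD : (Nat.card D : ℂ) ≠ 0 := card_ne_zero'
  set P : Module.End ℂ (Fin n → ℂ) := (Nat.card D : ℂ)⁻¹ • ∑ d, ρ (i d) with hP
  have hmul : ∀ d, ρ (i d) * P = P := fun d => by
    rw [hP, mul_smul_comm, Finset.mul_sum]
    congr 1
    simp_rw [← map_mul]
    exact Equiv.sum_comp (Equiv.mulLeft d) fun d => ρ (i d)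
  have hPP : P * P = P := by
    conv_lhs => enter [1]; rw [hP]
    rw [smul_mul_assoc, Finset.sum_mul, Finset.sum_congr rfl fun d _ => hmul d, Finset.sum_const,
      Finset.card_univ, ← Nat.card_eq_fintype_card, ← Nat.cast_smul_eq_nsmul ℂ, inv_smul_smul₀ hD]
  have hcomm : Commute (ρ y) P := by
    rw [hP]
    exact (Commute.sum_right _ _ _ fun d _ => (hy d).map ρ).smul_right _
  have hint : IsIntegral ℤ (ρ y * P) := by
    have hk := Nat.card_pos (α := G)
    refine ⟨Polynomial.X ^ (Nat.card G + 1) - Polynomial.X, ?_, ?_⟩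
    · exact Polynomial.monic_X_pow_sub (by rw [Polynomial.degree_X]; exact_mod_cast (by omega))
    · rw [Polynomial.eval₂_sub, Polynomial.eval₂_X_pow, Polynomial.eval₂_X, hcomm.mul_pow, pow_succ,
        pow_card_eq_one_apply, one_mul,
        IsIdempotentElem.pow_succ_eq _ hPP, sub_self]
  refine ⟨_, isIntegral_trace hint, ?_⟩
  rw [hP, mul_smul_comm, map_smul, smul_eq_mul, mul_inv_cancel_left₀ hD, Finset.mul_sum, map_sum]
  simp_rw [← map_mul]
  rfl

variable {B : ValuationSubring ℂ} {p : ℕ} {M : Ideal (integralClosure ℤ ℂ)}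

/-- If the block idempotent of a character `χ` of height zero does not vanish modulo `p` at the
`p`-regular element `x`, then the class of `x` has length divisible by `χ(1)_p`. -/
theorem valuation_card_class_le (hB : Dominates B p M) {χ : G → ℂ} (hχ : χ ∈ Irr G)
    (h0 : height p M χ = 0) {x : G} (hx : ¬ p ∣ orderOf x)
    (he : B.valuation (idem (block_finite M χ).toFinset x) = 1) :
    B.valuation (Nat.card (ConjClasses.mk x).carrier : ℂ) ≤ B.valuation (χ 1) := by
  classical
  have := Fact.mk hB.prime
  rw [height_eq_zero_iff_valuation hB hχ] at h0
  set S := (block_finite M χ).toFinset with hSdef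
  have hSb : ∀ η ∈ S, η ∈ block M χ := fun η hη => (block_finite M χ).mem_toFinset.1 hη
  have hS : ∀ η ∈ S, η ∈ Irr G := fun η hη => (hSb η hη).1
  by_contra! hlt
  let P : Sylow p (Subgroup.centralizer {x}) := default
  let Q : Subgroup (Subgroup.centralizer {x}) := P
  let i : Q →* G := (Subgroup.centralizer {x}).subtype.comp Q.subtype
  have hcom : ∀ d : Q, Commute x (i d) := fun d =>
    Subgroup.mem_centralizer_iff.1 (d : Subgroup.centralizer {x}).2 x rfl
  have hcard : B.valuation (Nat.card Q : ℂ) * B.valuation (Nat.card (ConjClasses.mk x).carrier : ℂ) =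
      B.valuation (Nat.card G : ℂ) := by
    rw [← card_centralizer_mul_card_class x, ← Q.card_mul_index]
    push_cast
    rw [map_mul, map_mul, hB.natCast_eq_one (P.not_dvd_index : ¬ p ∣ Q.index), mul_one]
  have hK : B.valuation (Nat.card (ConjClasses.mk x).carrier : ℂ) ≠ 0 :=
    (lt_of_le_of_lt zero_le hlt).ne'
  have hG : B.valuation (Nat.card G : ℂ) ≠ 0 := valuation_natCast_ne_zero B Nat.card_pos.ne'
  -- Up to a p-adic unit the sum is ∑ η(1) t_η divided by the class length, whose valuation is
  -- assumed larger than every v(η(1)).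
  have hsum : B.valuation (∑ d : Q, idem S (x * i d)) < 1 := by
    choose! t ht hts using fun η (hη : η ∈ S) =>
      exists_sum_eq_card_mul i (hS η hη) (y := x⁻¹) fun d => (hcom d).inv_left
    have e : ∑ d : Q, idem S (x * i d) =
        (Nat.card G : ℂ)⁻¹ * Nat.card Q * ∑ η ∈ S, η 1 * t η := by
      simp_rw [idem]
      rw [← Finset.mul_sum, Finset.sum_comm, mul_assoc]
      congr 1
      rw [Finset.mul_sum]
      refine Finset.sum_congr rfl fun η hη => ?_
      rw [← Finset.mul_sum, mul_left_comm, ← hts η hη, ← Equiv.sum_comp (Equiv.inv Q)]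
      congr 1
      refine Finset.sum_congr rfl fun d _ => ?_
      rw [Equiv.inv_apply, map_inv, mul_inv_rev, inv_inv, ((hcom d).inv_left).eq]
    rw [e, map_mul, map_mul, map_inv₀, ← hcard, mul_inv, mul_comm (_⁻¹), mul_assoc (_⁻¹ : B.ValueGroup),
      inv_mul_cancel₀ (left_ne_zero_of_mul (hcard ▸ hG)), mul_one, inv_mul_lt_iff₀ (zero_lt_iff.2 hK),
      mul_one]
    refine lt_of_le_of_lt (B.valuation.map_sum_le fun η hη => ?_) hlt
    rw [map_mul]
    exact (mul_le_of_le_one_right' (hB.integral_le_one _ (ht η hη))).trans (h0 η (hSb η hη))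
  -- For d ≠ 1 the element xd is p-singular, so only the unit term at d = 1 survives, contradicting
  -- `hsum`.
  have hrest : ∀ d : Q, d ≠ 1 → B.valuation (idem S (x * i d)) < 1 := fun d hd => by
    refine valuation_idempotent_lt_one hB (idem_conj hS) (idem_mem hB hχ) (idem_mul_idem hS) ?_
    have hinj : Function.Injective i :=
      (Subgroup.subtype_injective _).comp (Subgroup.subtype_injective _)
    obtain ⟨k, hk⟩ := (IsPGroup.iff_orderOf.1 P.isPGroup') d
    have ho : orderOf (i d) = p ^ k := by rw [orderOf_injective i hinj, hk]
    have hk0 : k ≠ 0 := fun h => hd (orderOf_eq_one_iff.1 (by rw [hk, h, pow_zero]))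
    rw [(hcom d).orderOf_mul_eq_mul_orderOf_of_coprime, ho]
    · exact (dvd_pow_self p hk0).mul_left _
    · rw [ho]
      exact (((hB.prime.coprime_iff_not_dvd).2 hx).pow_left k).symm
  rw [← Finset.add_sum_erase _ _ (Finset.mem_univ (1 : Q)), map_one, mul_one,
    Valuation.map_add_eq_of_lt_left, he] at hsum
  · exact lt_irrefl _ hsum
  · rw [he]
    exact B.valuation.map_sum_lt one_ne_zero fun d hd => hrest d (Finset.ne_of_mem_erase hd)

/-- Expanding ω_χ(e) = 1 over classes gives x with e(x) and ω_χ(x) units. As ω_χ(x) is |K|χ(x)/χ(1)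
and v(|K|) ≤ v(χ(1)), the integral value χ(x) cannot be small. -/
theorem exists_valuation_eq_one (hB : Dominates B p M) {χ : G → ℂ} (hχ : χ ∈ Irr G)
    (h0 : height p M χ = 0) :
    ∃ x, B.valuation (χ x) = 1 ∧ B.valuation (centralChar χ x) = 1 := by
  classical
  set S := (block_finite M χ).toFinset with hSdef
  have hS : ∀ η ∈ S, η ∈ Irr G := fun η hη => ((block_finite M χ).mem_toFinset.1 hη).1
  have hmem : χ ∈ S := (block_finite M χ).mem_toFinset.2 (Irr.mem_block M hχ)
  have hone := sum_idem_mul hS hχ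
  rw [if_pos hmem, sum_mul_div_eq_sum_conjClasses hχ (idem_conj hS)] at hone
  obtain ⟨K, hK⟩ : ∃ K : ConjClasses G,
      1 ≤ B.valuation (idem S K.out * centralChar χ K.out) := by
    by_contra! h
    have := B.valuation.map_sum_lt (s := Finset.univ) one_ne_zero fun K _ => h K
    rw [hone, map_one] at this
    exact lt_irrefl _ this
  set x := K.out
  have h1 : B.valuation (idem S x) ≤ 1 := (B.valuation_le_one_iff _).2 (idem_mem hB hχ x)
  have h2 : B.valuation (centralChar χ x) ≤ 1 :=
    hB.integral_le_one _ (isIntegral_centralChar hχ x)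
  rw [map_mul] at hK
  have he : B.valuation (idem S x) = 1 := le_antisymm h1 (hK.trans (mul_le_of_le_one_right' h2))
  have hω : B.valuation (centralChar χ x) = 1 := le_antisymm h2 (by rwa [he, one_mul] at hK)
  refine ⟨x, ?_, hω⟩
  have hx : ¬ p ∣ orderOf x := fun h => by
    have := valuation_idempotent_lt_one hB (idem_conj hS) (idem_mem hB hχ) (idem_mul_idem hS) h
    rw [he] at this
    exact lt_irrefl _ this
  have hle := valuation_card_class_le hB hχ h0 hx he
  have hχ1 : B.valuation (χ 1) ≠ 0 := by
    rw [Ne, map_eq_zero]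
    exact one_apply_ne_zero hχ
  rw [centralChar, map_div₀, div_eq_one_iff_eq hχ1, map_mul] at hω
  refine le_antisymm (hB.integral_le_one _ (Irr.isIntegral hχ x)) (not_lt.1 fun hlt => ?_)
  have : B.valuation (Nat.card (ConjClasses.mk x).carrier : ℂ) ≠ 0 :=
    fun h => hχ1 (by rw [← hω, h, zero_mul])
  have := mul_lt_of_lt_one_right (zero_lt_iff.2 this) hlt
  rw [hω] at this
  exact absurd hle (not_le.2 this)

end HeightZero

end FinChar

/-! ### Clifford theory: decomposing χ along the orbit of θ -/

namespace FinChar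

open Representation

section Clifford

theorem Irr.comp_mulEquiv {N N' : Type*} [Group N] [Group N'] (α : N ≃* N') {η : N' → ℂ}
    (hη : η ∈ Irr N') : η ∘ α ∈ Irr N := by
  obtain ⟨n, σ, hσ, rfl⟩ := hη
  refine ⟨n, σ.comp α.toMonoidHom, ?_, rfl⟩
  rw [isIrreducible_iff] at hσ ⊢
  refine ⟨hσ.1, fun U hU => hσ.2 U fun g v hv => ?_⟩
  have := hU (α.symm g) v hv
  simpa using this

variable {N T : Type*} [Group N] [Fintype N] [Group T] (i : N →* T) (c : T → MulAut N)

/-- By invariance of θ the idempotent e_θ commutes with T, so it acts by a scalar; this is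
idempotent, and nonzero because its trace is a nonzero multiple of [ψ_N, θ]. -/
theorem asAlgebraHom_idem_eq_one (hc : ∀ t n, i (c t n) = t * i n * t⁻¹) {θ : N → ℂ}
    (hθ : θ ∈ Irr N) (hinv : ∀ t n, θ (c t n) = θ n) {V : Type*} [AddCommGroup V] [Module ℂ V]
    [FiniteDimensional ℂ V] {ρ : Representation ℂ T V} (hρ : ρ.IsIrreducible)
    (hlie : LiesUnder i θ ρ.character) :
    asAlgebraHom (ρ.comp i : Representation ℂ N V) (ofFun (idem {θ})) = 1 := by
  set E := asAlgebraHom (ρ.comp i : Representation ℂ N V) (ofFun (idem {θ})) with hE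
  have hEs : E = ∑ n, idem {θ} n • ρ (i n) := asAlgebraHom_eq_sum _ _
  have hidem : E * E = E := by
    rw [hE, ← map_mul, idem_mul_idem (by simpa using hθ)]
  obtain ⟨s, hs⟩ := exists_eq_smul_one hρ E fun g => by
    rw [hEs, Finset.sum_mul, Finset.mul_sum, ← Equiv.sum_comp (c g).toEquiv]
    refine Finset.sum_congr rfl fun n _ => ?_
    change idem {θ} (c g n) • ρ (i (c g n)) * ρ g = _
    have : idem {θ} (c g n) = idem {θ} n := by
      simp only [idem, Finset.sum_singleton, ← map_inv, hinv]
    rw [this, smul_mul_assoc, mul_smul_comm, ← map_mul, ← map_mul, hc, inv_mul_cancel_right]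
  have htr : LinearMap.trace ℂ V E ≠ 0 := by
    have h := (liesUnder_iff i hθ _).1 hlie
    rw [hEs, map_sum]
    simp only [map_smul, smul_eq_mul, idem, Finset.sum_singleton]
    have e : ∀ n, (Nat.card N : ℂ)⁻¹ * (θ 1 * θ n⁻¹) * LinearMap.trace ℂ V (ρ (i n)) =
        (Nat.card N : ℂ)⁻¹ * θ 1 * (ρ.character (i n) * θ n⁻¹) := fun n => by
      rw [character]; ring
    simp_rw [e, ← Finset.mul_sum]
    exact mul_ne_zero (mul_ne_zero (inv_ne_zero card_ne_zero') (one_apply_ne_zero hθ)) h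
  have hs0 : s ≠ 0 := by
    rintro rfl
    rw [hs, zero_smul, map_zero] at htr
    exact htr rfl
  rw [hs, smul_mul_smul_comm, mul_one] at hidem
  have hn : Nontrivial V := (isIrreducible_iff.1 hρ).1
  have := smul_left_injective ℂ (one_ne_zero (α := Module.End ℂ V)) hidem
  rw [hs, (mul_eq_left₀ hs0).1 this, one_smul]

open Classical in
theorem sum_inv_mul_apply_mul (hc : ∀ t n, i (c t n) = t * i n * t⁻¹) {θ : N → ℂ}
    (hθ : θ ∈ Irr N) (hinv : ∀ t n, θ (c t n) = θ n) {ψ : T → ℂ} (hψ : ψ ∈ Irr T)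
    (hlie : LiesUnder i θ ψ) {η : N → ℂ} (hη : η ∈ Irr N) (y : T) :
    ∑ n, η n⁻¹ * ψ (i n * y) = if η = θ then Nat.card N / θ 1 * ψ y else 0 := by
  obtain ⟨m, ρ, hρ, rfl⟩ := hψ
  have hN := card_ne_zero' (G := N)
  have hη1 := one_apply_ne_zero hη
  have h1 := asAlgebraHom_idem_eq_one i c hc hθ hinv hρ hlie
  have hmul : ofFun (idem {η}) * ofFun (idem {θ}) =
      if η = θ then ofFun (idem {θ}) else (0 : MonoidAlgebra ℂ N) := by
    split_ifs with h
    · rw [h, idem_mul_idem (by simpa using hθ)]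
    · refine eq_of_forall_irreducible fun n σ hσ => ?_
      rw [map_mul, asAlgebraHom_idem (by simpa using hη) hσ, asAlgebraHom_idem (by simpa using hθ) hσ,
        map_zero]
      simp only [Finset.mem_singleton, mul_ite, mul_one, mul_zero]
      split_ifs <;> simp_all
  have h2 : asAlgebraHom (ρ.comp i : Representation ℂ N _) (ofFun (idem {η})) =
      if η = θ then 1 else 0 := by
    have := congrArg (asAlgebraHom (ρ.comp i : Representation ℂ N _)) hmul
    rw [map_mul, h1, mul_one] at this
    rw [this]
    split_ifs
    · exact h1
    · exact map_zero _
  have h3 := congrArg (fun A => LinearMap.trace ℂ _ (A * ρ y)) h2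
  simp only [asAlgebraHom_eq_sum, Finset.sum_mul, map_sum, smul_mul_assoc, map_smul, smul_eq_mul,
    coeff_ofFun, idem, Finset.sum_singleton] at h3
  have h4 : (Nat.card N : ℂ)⁻¹ * η 1 * ∑ n, η n⁻¹ * ρ.character (i n * y) =
      if η = θ then ρ.character y else 0 := by
    rw [Finset.mul_sum]
    convert h3 using 1
    · refine Finset.sum_congr rfl fun n _ => ?_
      rw [character, map_mul, MonoidHom.comp_apply]
      ring
    · split_ifs <;> simp [character]
  split_ifs at h4 ⊢ with h
  · rw [← h, ← h4]
    field_simp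
  · exact (mul_eq_zero.1 h4).resolve_left (mul_ne_zero (inv_ne_zero hN) hη1)

end Clifford

section Correspondent

variable {G : Type*} [Group G] [Fintype G] {N : Subgroup G} [N.Normal] [Fintype N]

/-- The conjugate `η^g` of a function on a normal subgroup. -/
def conjFun (g : G) (η : N → ℂ) : N → ℂ := η ∘ MulAut.conjNormal g

omit [Fintype G] [Fintype N] in
theorem conjFun_mul (g h : G) (η : N → ℂ) : conjFun (g * h) η = conjFun h (conjFun g η) := by
  funext n
  simp [conjFun]

omit [Fintype G] [Fintype N] in
theorem conjFun_one (η : N → ℂ) : conjFun 1 η = η := by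
  funext n
  simp [conjFun]

omit [Fintype G] [Fintype N] in
theorem mem_inertia_iff {θ : N → ℂ} {g : G} : g ∈ inertia θ ↔ conjFun g θ = θ :=
  ⟨fun h => funext h, fun h => congrFun h⟩

omit [Fintype G] [Fintype N] in
theorem conjFun_mem {η : N → ℂ} (hη : η ∈ Irr N) (g : G) : conjFun g η ∈ Irr N :=
  Irr.comp_mulEquiv (MulAut.conjNormal g) hη

omit [Fintype G] [Fintype N] in
theorem conjFun_injective (g : G) : Function.Injective (conjFun (N := N) g) := fun η η' h => by
  have := congrArg (conjFun g⁻¹) h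
  rwa [← conjFun_mul, ← conjFun_mul, mul_inv_cancel, conjFun_one, conjFun_one] at this

/-- Conjugation by an element of the inertia group. -/
def inertiaConj (θ : N → ℂ) (t : inertia θ) : MulAut N := MulAut.conjNormal (t : G)

omit [Fintype G] [Fintype N] in
theorem inclusion_inertiaConj {θ : N → ℂ} (hθ : θ ∈ Irr N) (t : inertia θ) (n : N) :
    Subgroup.inclusion (le_inertia hθ) (inertiaConj θ t n) =
      t * Subgroup.inclusion (le_inertia hθ) n * t⁻¹ := by
  ext
  simp [inertiaConj]

omit [Fintype G] in
open Classical in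
theorem sum_inv_mul_extendZero {θ : N → ℂ} (hθ : θ ∈ Irr N) {ψ : inertia θ → ℂ}
    (hψ : ψ ∈ Irr (inertia θ)) (hlie : LiesUnder (Subgroup.inclusion (le_inertia hθ)) θ ψ)
    {η : N → ℂ} (hη : η ∈ Irr N) (y : G) :
    ∑ n : N, η n⁻¹ * extendZero ψ (n * y) =
      if η = θ then Nat.card N / θ 1 * extendZero ψ y else 0 := by
  by_cases hy : y ∈ inertia θ
  · lift y to inertia θ using hy
    have h := sum_inv_mul_apply_mul (Subgroup.inclusion (le_inertia hθ)) (inertiaConj θ)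
      (inclusion_inertiaConj hθ) hθ (fun t n => t.2 n) hψ hlie hη y
    rw [extendZero_coe, ← h]
    refine Finset.sum_congr rfl fun n _ => ?_
    have e : extendZero ψ (n * y) = ψ (Subgroup.inclusion (le_inertia hθ) n * y) :=
      extendZero_coe ψ (Subgroup.inclusion (le_inertia hθ) n * y)
    rw [e]
  · rw [extendZero_of_notMem ψ hy, mul_zero, ite_self]
    refine Finset.sum_eq_zero fun n _ => ?_
    rw [extendZero_of_notMem, mul_zero]
    rwa [Subgroup.mul_mem_cancel_left _ (le_inertia hθ n.2)]

variable {θ : N → ℂ} {hθ : θ ∈ Irr N} {χ : G → ℂ} {ψ : inertia θ → ℂ}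

open Classical in
theorem sum_inv_mul_correspondent (h : IsCliffordCorrespondent hθ χ ψ) {η : N → ℂ} (hη : η ∈ Irr N)
    (x : G) :
    ∑ n : N, η n⁻¹ * χ (n * x) = (Nat.card (inertia θ) : ℂ)⁻¹ *
      ∑ g : G, if conjFun g⁻¹ η = θ then Nat.card N / θ 1 * extendZero ψ (g * x * g⁻¹) else 0 := by
  obtain ⟨hψ, hlie, rfl⟩ := h
  simp_rw [induce_eq, mul_left_comm (η _), ← Finset.mul_sum, Finset.mul_sum Finset.univ _ (η _)]
  rw [Finset.sum_comm]
  congr 1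
  refine Finset.sum_congr rfl fun g _ => ?_
  rw [← sum_inv_mul_extendZero hθ hψ hlie (conjFun_mem hη g⁻¹),
    ← Equiv.sum_comp (MulAut.conjNormal (H := N) g).toEquiv
      fun n => conjFun g⁻¹ η n⁻¹ * extendZero ψ (n * (g * x * g⁻¹))]
  refine Finset.sum_congr rfl fun n _ => ?_
  change _ = conjFun g⁻¹ η (MulAut.conjNormal g n)⁻¹ * extendZero ψ (MulAut.conjNormal g n * _)
  congr 1
  · rw [conjFun, Function.comp_apply, ← map_inv, ← MulAut.mul_apply, ← map_mul, inv_mul_cancel,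
      map_one, MulAut.one_apply]
  · congr 1
    rw [MulAut.conjNormal_apply]
    group

/-- The `ω`-component `(θ(1) / |N|) ∑ ω(n⁻¹) χ(n x)` of `χ`. -/
noncomputable def component (θ : N → ℂ) (χ : G → ℂ) (ω : N → ℂ) (x : G) : ℂ :=
  θ 1 / Nat.card N * ∑ n : N, ω n⁻¹ * χ (n * x)

omit [Fintype G] in
theorem component_conjFun (hχ : ∀ g x, χ (g * x * g⁻¹) = χ x) (ω : N → ℂ) (g x : G) :
    component θ χ (conjFun g ω) x = component θ χ ω (g * x * g⁻¹) := by
  rw [component, component]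
  congr 1
  rw [← Equiv.sum_comp (MulAut.conjNormal (H := N) g).toEquiv (fun n => ω n⁻¹ * _)]
  refine Finset.sum_congr rfl fun n _ => ?_
  change conjFun g ω n⁻¹ * _ =
    ω (MulAut.conjNormal g n)⁻¹ * χ (MulAut.conjNormal g n * (g * x * g⁻¹))
  rw [conjFun, Function.comp_apply, map_inv, MulAut.conjNormal_apply, ← hχ g (n * x)]
  congr 2
  group

/-- Only the cosets of T stabilizing θ contribute to the induced character. This recovers ψ from χ
and θ alone, so an automorphism fixing both fixes ψ. -/
theorem component_self (h : IsCliffordCorrespondent hθ χ ψ) (x : G) :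
    component θ χ θ x = extendZero ψ x := by
  classical
  have hT := card_ne_zero' (G := inertia θ)
  have hN := card_ne_zero' (G := N)
  have h1 := one_apply_ne_zero hθ
  rw [component, sum_inv_mul_correspondent h hθ]
  have e : ∀ g : G, (if conjFun g⁻¹ θ = θ then Nat.card N / θ 1 * extendZero ψ (g * x * g⁻¹) else 0) =
      if g ∈ inertia θ then Nat.card N / θ 1 * extendZero ψ x else 0 := fun g => by
    have hiff : conjFun g⁻¹ θ = θ ↔ g ∈ inertia θ := by rw [← mem_inertia_iff, inv_mem_iff]
    simp only [hiff]
    split_ifs with hg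
    · exact congrArg _ (extendZero_conj h.1 ⟨g, hg⟩ x)
    · rfl
  simp_rw [e]
  rw [← Finset.sum_filter, Finset.sum_const, ← Fintype.card_subtype, ← Nat.card_eq_fintype_card,
    nsmul_eq_mul]
  change _ * (_ * ((Nat.card (inertia θ) : ℂ) * _)) = _
  field_simp

theorem exists_conjFun_eq (h : IsCliffordCorrespondent hθ χ ψ) {η : N → ℂ} (hη : η ∈ Irr N) {x : G}
    (hx : component θ χ η x ≠ 0) : ∃ g : G, η = conjFun g θ := by
  classical
  by_contra! hne
  refine hx ?_
  rw [component, sum_inv_mul_correspondent h hη, Finset.sum_eq_zero, mul_zero, mul_zero]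
  intro g _
  refine if_neg fun hg => hne g ?_
  rw [← hg, ← conjFun_mul, inv_mul_cancel, conjFun_one]

open Classical in
-- The induction formula sums over G the components at the conjugates of θ, and each conjugate
-- arises from exactly |T| elements of G.
theorem apply_eq_sum_component (hχ : χ ∈ Irr G) (h : IsCliffordCorrespondent hθ χ ψ) (x : G) :
    χ x = ∑ ω ∈ Finset.univ.image fun g : G => conjFun g θ, component θ χ ω x := by
  have hT := card_ne_zero' (G := inertia θ)
  have h1 : χ x = (Nat.card (inertia θ) : ℂ)⁻¹ * ∑ g : G, component θ χ (conjFun g θ) x := by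
    conv_lhs => rw [← h.2.2, induce_eq]
    simp_rw [component_conjFun (fun g x => Irr.conj_apply hχ x g), component_self h]
  rw [h1, ← Finset.sum_fiberwise_of_maps_to (g := fun g : G => conjFun g θ)
    (fun g _ => Finset.mem_image.2 ⟨g, Finset.mem_univ g, rfl⟩), Finset.mul_sum]
  refine Finset.sum_congr rfl fun ω hω => ?_
  obtain ⟨g, -, rfl⟩ := Finset.mem_image.1 hω
  rw [Finset.sum_congr rfl (g := fun _ => component θ χ (conjFun g θ) x) (fun k hk => ?_),
    Finset.sum_const, nsmul_eq_mul]
  · have : (Finset.univ.filter fun k : G => conjFun k θ = conjFun g θ).card =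
        Nat.card (inertia θ) := by
      rw [Nat.card_eq_fintype_card, ← Fintype.card_subtype]
      refine Fintype.card_congr ((Equiv.mulRight g⁻¹).subtypeEquiv fun k => ?_)
      rw [Equiv.coe_mulRight, mem_inertia_iff, conjFun_mul]
      constructor
      · intro hk
        rw [hk, ← conjFun_mul, mul_inv_cancel, conjFun_one]
      · intro hk
        have := congrArg (conjFun g) hk
        rwa [← conjFun_mul, inv_mul_cancel, conjFun_one] at this
    rw [this, inv_mul_cancel_left₀ hT]
  · rw [(Finset.mem_filter.1 hk).2]

end Correspondent

end FinChar

/-! ### Automorphisms fixing ℚ_{pn} and the orbit of θ -/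

namespace FinChar

open IntermediateField

section Galois

variable {B : ValuationSubring ℂ} {p : ℕ} {M : Ideal (integralClosure ℤ ℂ)}

/-- The residue field has characteristic p, so (η − 1)^(p^a) reduces to η^(p^a) − 1 = 0. -/
theorem valuation_sub_one_lt_one (hB : Dominates B p M) {η : ℂ} {a : ℕ} (h : η ^ p ^ a = 1) :
    B.valuation (η - 1) < 1 := by
  have := Fact.mk hB.prime
  let r := IsLocalRing.residue B
  have hr : ∀ b : B, r b = 0 ↔ B.valuation (b : ℂ) < 1 := fun b => by
    rw [IsLocalRing.residue_eq_zero_iff, ← B.valuation_lt_one_iff]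
  have hp0 : (p : IsLocalRing.ResidueField B) = 0 := by
    have h := (hr (p : B)).2 (by exact_mod_cast hB.prime_lt_one)
    rwa [map_natCast] at h
  have hchar : CharP (IsLocalRing.ResidueField B) p := (CharP.charP_iff_prime_eq_zero hB.prime).2 hp0
  have hη : η ∈ B := (B.valuation_le_one_iff _).1
    (hB.integral_le_one _ (isIntegral_of_pow_eq_one' (pow_ne_zero a hB.prime.ne_zero) h))
  let b : B := ⟨η, hη⟩
  have hb : b ^ p ^ a = 1 := Subtype.ext (by simpa [b] using h)
  refine (hr (b - 1)).1 ?_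
  have h2 : (r (b - 1)) ^ p ^ a = 0 := by
    rw [map_sub, map_one, sub_pow_char_pow, ← map_pow, hb, map_one, one_pow, sub_self]
  exact eq_zero_of_pow_eq_zero h2

variable {τ : ℂ ≃+* ℂ} {a n : ℕ}

/-- μ^(p^a) is an n-th root of unity, hence fixed by τ; so τμ/μ is a root of unity of p-power order.
-/
theorem valuation_apply_sub_lt_one (hB : Dominates B p M) (hn : n ≠ 0)
    (hτ : τ (zeta (p * n)) = zeta (p * n)) {μ : ℂ} (hμ : μ ^ (p ^ a * n) = 1) :
    B.valuation (τ μ - μ) < 1 := by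
  have hpn : p * n ≠ 0 := mul_ne_zero hB.prime.ne_zero hn
  have hμ0 : μ ≠ 0 := by
    rintro rfl
    rw [zero_pow (mul_ne_zero (pow_ne_zero a hB.prime.ne_zero) hn)] at hμ
    exact zero_ne_one hμ
  have hfix : τ (μ ^ p ^ a) = μ ^ p ^ a := by
    have hmem : μ ^ p ^ a ∈ cyclotomic (p * n) := cyclotomic_le_of_pow_eq_one hpn (by
      rw [mul_comm p n, pow_mul, ← pow_mul μ, hμ, one_pow])
    exact ringEquiv_eq_of_mem_cyclotomic τ (RingEquiv.refl ℂ) hτ hmem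
  have h1 : (τ μ / μ) ^ p ^ a = 1 := by
    rw [div_pow, ← map_pow, hfix, div_self (pow_ne_zero _ hμ0)]
  have e : τ μ - μ = μ * (τ μ / μ - 1) := by
    rw [mul_sub, mul_div_cancel₀ _ hμ0, mul_one]
  rw [e, map_mul]
  refine lt_of_le_of_lt (mul_le_of_le_one_left' (hB.integral_le_one _ ?_))
    (valuation_sub_one_lt_one hB h1)
  exact isIntegral_of_pow_eq_one' (mul_ne_zero (pow_ne_zero a hB.prime.ne_zero) hn) hμ

theorem valuation_character_sub_lt_one {H : Type*} [Group H] [Finite H] (hB : Dominates B p M)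
    (hn : n ≠ 0) (hτ : τ (zeta (p * n)) = zeta (p * n)) (hH : Nat.card H ∣ p ^ a * n) {ψ : H → ℂ}
    (hψ : ψ ∈ Irr H) (h : H) : B.valuation (τ (ψ h) - ψ h) < 1 := by
  obtain ⟨s, hs, e⟩ := Irr.exists_eq_sum hψ h
  rw [e]
  clear e
  induction s using Multiset.induction_on with
  | empty => simp
  | cons μ s ih =>
    rw [Multiset.sum_cons, map_add, add_sub_add_comm]
    refine B.valuation.map_add_lt ?_ (ih fun ν hν => hs ν (Multiset.mem_cons_of_mem hν))
    refine valuation_apply_sub_lt_one (a := a) hB hn hτ ?_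
    obtain ⟨c, hc⟩ := hH
    rw [hc, pow_mul, hs μ (Multiset.mem_cons_self _ _), one_pow]

theorem iterate_apply_of_mem_cyclotomic (hp : p.Prime) (hn : n ≠ 0) (hpn : ¬ p ∣ n)
    (hτ : τ (zeta (p * n)) = zeta (p * n)) {z : ℂ} (hz : z ∈ cyclotomic (p ^ a * n)) :
    τ^[p ^ a] z = z := by
  have hpn0 : p * n ≠ 0 := mul_ne_zero hp.ne_zero hn
  -- The exponent a + 1 makes pn divide the level even when a = 0. It is also what u ≡ 1 mod p
  -- gives: u^(p^a) ≡ 1 mod p^(a+1).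
  have hm : p ^ (a + 1) * n ≠ 0 := mul_ne_zero (pow_ne_zero _ hp.ne_zero) hn
  have hdvd : p * n ∣ p ^ (a + 1) * n := ⟨p ^ a, by ring⟩
  obtain ⟨u, -, hu⟩ := exists_ringEquiv_zeta_eq_pow τ hm
  have h1 : u ≡ 1 [MOD p * n] := by
    rw [← zeta_pow_eq_pow_iff hpn0, pow_one, ← ringEquiv_zeta_of_dvd τ hm hdvd hu, hτ]
  have h2 : u ^ p ^ a ≡ 1 [MOD p ^ (a + 1) * n] := by
    have h1' := (Nat.modEq_iff_dvd.1 h1.symm)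
    push_cast at h1'
    refine (Nat.ModEq.symm (Nat.modEq_iff_dvd.2 ?_))
    push_cast
    refine IsCoprime.mul_dvd ?_ ?_ ?_
    · exact_mod_cast (Nat.isCoprime_iff_coprime.2
        (Nat.Coprime.pow_left (a + 1) ((hp.coprime_iff_not_dvd).2 hpn)))
    · have := dvd_sub_pow_of_dvd_sub (dvd_of_mul_right_dvd h1') a
      rwa [one_pow] at this
    · have := (dvd_of_mul_left_dvd h1').trans (sub_dvd_pow_sub_pow (u : ℤ) 1 (p ^ a))
      rwa [one_pow] at this
  have hiter : ∀ k, τ^[k] (zeta (p ^ (a + 1) * n)) = zeta (p ^ (a + 1) * n) ^ u ^ k := fun k => by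
    induction k with
    | zero => simp
    | succ k ih => rw [Function.iterate_succ_apply', ih, map_pow, hu, ← pow_mul, pow_succ' u]
  have hpow : ∀ (k : ℕ) (w : ℂ), (τ ^ k : RingAut ℂ) w = τ^[k] w := fun k => by
    induction k with
    | zero => intro w; rfl
    | succ k ih =>
      intro w
      rw [pow_succ', Function.iterate_succ_apply', ← ih]
      rfl
  have hz' : z ∈ cyclotomic (p ^ (a + 1) * n) :=
    cyclotomic_mono (mul_ne_zero (pow_ne_zero _ hp.ne_zero) hn) hm ⟨p, by ring⟩ hz
  rw [← hpow]
  refine ringEquiv_eq_of_mem_cyclotomic (τ ^ p ^ a : RingAut ℂ) (RingEquiv.refl ℂ) ?_ hz'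
  rw [hpow, hiter, RingEquiv.refl_apply]
  conv_rhs => rw [← pow_one (zeta _)]
  exact (zeta_pow_eq_pow_iff hm).2 h2

end Galois

section Values

variable {G : Type*} [Group G] [Fintype G]

theorem fieldOfValues_induce_le {H : Subgroup G} (ψ : H → ℂ) :
    fieldOfValues (induce ψ) ≤ fieldOfValues ψ := by
  refine adjoin_le_iff.2 ?_
  rintro _ ⟨g, rfl⟩
  rw [induce_eq]
  refine mul_mem (inv_mem (_root_.natCast_mem _ _)) (sum_mem fun x _ => ?_)
  by_cases hx : x * g * x⁻¹ ∈ H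
  · rw [show extendZero ψ (x * g * x⁻¹) = ψ ⟨_, hx⟩ from extendZero_coe ψ ⟨_, hx⟩]
    exact subset_adjoin ℚ _ ⟨_, rfl⟩
  · rw [extendZero_of_notMem ψ hx]
    exact zero_mem _

variable {B : ValuationSubring ℂ} {p : ℕ} {M : Ideal (integralClosure ℤ ℂ)} {N : Subgroup G}
  [N.Normal] [Fintype N] {θ : N → ℂ} {hθ : θ ∈ Irr N} {χ : G → ℂ} {ψ : inertia θ → ℂ}
  {τ : ℂ ≃+* ℂ} {a n : ℕ}

omit [Fintype G] [N.Normal] in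
theorem map_component (hθ : θ ∈ Irr N) (hχ : ∀ g, τ (χ g) = χ g) (ω : N → ℂ) (x : G) :
    τ (component θ χ ω x) = component θ χ (τ ∘ ω) x := by
  obtain ⟨d, -, hd⟩ := one_apply_eq hθ
  simp only [component, map_mul, map_div₀, map_sum, hχ, hd, map_natCast, Function.comp_apply]

theorem comp_eq_of_height_eq_zero (hB : Dominates B p M) (hχ : χ ∈ Irr G)
    (h0 : height p M χ = 0) (h : IsCliffordCorrespondent hθ χ ψ) (hn : n ≠ 0) (hpn : ¬ p ∣ n)
    (hG : Nat.card G = p ^ a * n) (hτ : τ (zeta (p * n)) = zeta (p * n))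
    (hτχ : ∀ g, τ (χ g) = χ g) : τ ∘ θ = θ := by
  classical
  have hconj : ∀ g x, χ (g * x * g⁻¹) = χ x := fun g x => Irr.conj_apply hχ x g
  -- The component of χ at τθ has value τ(ψ(1)) ≠ 0 at 1, so τθ lies in the orbit of θ.
  obtain ⟨k, hk⟩ : ∃ k : G, τ ∘ θ = conjFun k θ := by
    refine exists_conjFun_eq h (Irr.comp_ringEquiv τ hθ) (x := 1) ?_
    rw [← map_component hθ hτχ, component_self h, Ne, map_eq_zero_iff τ τ.injective]
    exact (extendZero_coe ψ 1).symm ▸ one_apply_ne_zero h.1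
  by_contra hne
  obtain ⟨x, hx, -⟩ := exists_valuation_eq_one hB hχ h0
  refine hx.not_lt ?_
  rw [apply_eq_sum_component hχ h, ← Finset.sum_coe_sort]
  have hdvd : ∀ H : Subgroup G, Nat.card H ∣ p ^ a * n := fun H => hG ▸ H.card_subgroup_dvd_card
  have hval : ∀ y, B.valuation (extendZero ψ y) ≤ 1 ∧
      B.valuation (τ (extendZero ψ y) - extendZero ψ y) < 1 := fun y => by
    by_cases hy : y ∈ inertia θ
    · lift y to inertia θ using hy
      rw [extendZero_coe]
      exact ⟨hB.integral_le_one _ (Irr.isIntegral h.1 y),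
        valuation_character_sub_lt_one hB hn hτ (hdvd _) h.1 y⟩
    · rw [extendZero_of_notMem ψ hy]
      simp
  have hmem : ∀ ω : {ω // ω ∈ Finset.univ.image fun g : G => conjFun g θ}, ∃ g, ω.1 = conjFun g θ :=
    fun ω => by
      obtain ⟨g, -, hg⟩ := Finset.mem_image.1 ω.2
      exact ⟨g, hg.symm⟩
  have hcomm : ∀ g : G, τ ∘ conjFun g θ = conjFun g (τ ∘ θ) := fun g => rfl
  let f : {ω // ω ∈ Finset.univ.image fun g : G => conjFun g θ} →
      {ω // ω ∈ Finset.univ.image fun g : G => conjFun g θ} := fun ω => ⟨τ ∘ ω.1, by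
    obtain ⟨g, hg⟩ := hmem ω
    exact Finset.mem_image.2 ⟨k * g, Finset.mem_univ _, by rw [hg, hcomm, hk, conjFun_mul]⟩⟩
  have hf : ∀ (l : ℕ) ω (m : N), (f^[l] ω).1 m = τ^[l] (ω.1 m) := fun l => by
    induction l with
    | zero => intro ω m; rfl
    | succ l ih =>
      intro ω m
      rw [Function.iterate_succ_apply', Function.iterate_succ_apply', ← ih]
      rfl
  refine hB.sum_lt_one_of_perm f a ?_ ?_ (fun ω => component θ χ ω.1 x) ?_ ?_
  · refine funext fun ω => Subtype.ext (funext fun m => ?_)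
    obtain ⟨g, hg⟩ := hmem ω
    rw [hf]
    refine iterate_apply_of_mem_cyclotomic hB.prime hn hpn hτ ?_
    have hle := Irr.fieldOfValues_le (hg ▸ conjFun_mem hθ g : ω.1 ∈ Irr N)
    exact cyclotomic_mono Nat.card_pos.ne' (hG ▸ Nat.card_pos.ne') (hdvd N)
      (hle (subset_adjoin ℚ _ ⟨m, rfl⟩))
  -- The Galois action commutes with conjugation, so fixing one conjugate of θ would mean fixing θ.
  · intro ω hω
    obtain ⟨g, hg⟩ := hmem ω
    have := congrArg Subtype.val hω
    refine hne (conjFun_injective g ?_)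
    rw [← hcomm, ← hg]
    exact this
  · intro ω
    obtain ⟨g, hg⟩ := hmem ω
    rw [hg, component_conjFun hconj, component_self h]
    exact (hval _).1
  · intro ω
    obtain ⟨g, hg⟩ := hmem ω
    change B.valuation (component θ χ (τ ∘ ω.1) x - _) < 1
    rw [← map_component hθ hτχ, hg, component_conjFun hconj, component_self h]
    exact (hval _).2

theorem cyclotomicValues_eq (hB : Dominates B p M) (hχ : χ ∈ Irr G)
    (h0 : height p M χ = 0) (h : IsCliffordCorrespondent hθ χ ψ) (hn : n ≠ 0) (hpn : ¬ p ∣ n)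
    (hG : Nat.card G = p ^ a * n) : cyclotomicValues (p * n) χ = cyclotomicValues (p * n) ψ := by
  have hpn0 : p * n ≠ 0 := mul_ne_zero hB.prime.ne_zero hn
  have hm : p * Nat.card G ≠ 0 := mul_ne_zero hB.prime.ne_zero Nat.card_pos.ne'
  have hle : fieldOfValues χ ≤ fieldOfValues ψ := h.2.2 ▸ fieldOfValues_induce_le ψ
  refine le_antisymm (sup_le_sup_left hle _) (sup_le le_sup_left ?_)
  have hK : cyclotomicValues (p * n) χ ≤ cyclotomic (p * Nat.card G) :=
    sup_le (cyclotomic_mono hpn0 hm ⟨p ^ a, by rw [hG]; ring⟩)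
      ((Irr.fieldOfValues_le hχ).trans (cyclotomic_mono Nat.card_pos.ne' hm ⟨p, mul_comm _ _⟩))
  have : Algebra.IsAlgebraic ℚ (cyclotomicValues (p * n) χ) := ⟨fun z =>
    (isAlgebraic_algebraMap_iff (algebraMap (cyclotomicValues (p * n) χ) ℂ).injective).1
      (isAlgebraic_of_mem_cyclotomic hm (hK z.2))⟩
  refine adjoin_le_iff.2 ?_
  rintro _ ⟨t, rfl⟩
  refine mem_of_forall_ringEquiv (Irr.isIntegral h.1 t).tower_top.isAlgebraic fun τ hτ => ?_
  have hτχ : ∀ g, τ (χ g) = χ g := fun g =>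
    hτ _ (le_sup_right (a := cyclotomic (p * n)) (subset_adjoin ℚ _ ⟨g, rfl⟩))
  have hθτ := comp_eq_of_height_eq_zero hB hχ h0 h hn hpn hG
    (hτ _ (le_sup_left (b := fieldOfValues χ) (zeta_mem _))) hτχ
  rw [← extendZero_coe ψ t, ← component_self h, map_component hθ hτχ, hθτ]

end Values

end FinChar

/-! ### Twisted conjugacy classes and their sums -/

namespace FinChar

open Representation

section TwistedClass

variable {N : Type*} [Group N] [Fintype N]

open Classical in
/-- The `α`-twisted conjugacy class `{n α(n)⁻¹}` of the identity. In a group containing `N` and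
an element `x` inducing `α` on `N`, right multiplication by `x` maps it onto the `N`-class of `x`. -/
noncomputable def twistedClass (α : MulAut N) : Finset N :=
  Finset.univ.image fun n => n * (α n)⁻¹

theorem mem_twistedClass {α : MulAut N} {r : N} : r ∈ twistedClass α ↔ ∃ n, n * (α n)⁻¹ = r := by
  simp [twistedClass]

theorem twistedClass_mul_mem_iff (α : MulAut N) (n r : N) :
    n * r * (α n)⁻¹ ∈ twistedClass α ↔ r ∈ twistedClass α := by
  simp_rw [mem_twistedClass]
  constructor
  · rintro ⟨m, hm⟩
    refine ⟨n⁻¹ * m, ?_⟩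
    rw [map_mul, map_inv, mul_inv_rev, inv_inv, mul_assoc, ← mul_assoc m, hm]
    group
  · rintro ⟨m, rfl⟩
    exact ⟨n * m, by rw [map_mul]; group⟩

theorem mul_sum_twistedClass {R : Type*} [Semiring R] (f : N →* R) (α : MulAut N) (n : N) :
    f n * ∑ r ∈ twistedClass α, f r = (∑ r ∈ twistedClass α, f r) * f (α n) := by
  rw [Finset.mul_sum, Finset.sum_mul]
  refine Finset.sum_bij (fun r _ => n * r * (α n)⁻¹)
    (fun r hr => (twistedClass_mul_mem_iff α n r).2 hr)
    (fun r _ s _ h => mul_left_cancel (mul_right_cancel h))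
    (fun s hs => ⟨n⁻¹ * s * α n, ?_, by group⟩) (fun r _ => ?_)
  · rw [← twistedClass_mul_mem_iff α n]
    convert hs using 1
    group
  · rw [← map_mul, ← map_mul, inv_mul_cancel_right]

theorem twistedClass_conj (α β : MulAut N) :
    twistedClass (β * α * β⁻¹) = (twistedClass α).map β.toEquiv.toEmbedding := by
  ext r
  simp only [mem_twistedClass, Finset.mem_map]
  constructor
  · rintro ⟨n, rfl⟩
    refine ⟨_, ⟨β⁻¹ n, rfl⟩, ?_⟩
    simp [MulAut.mul_apply]
  · rintro ⟨_, ⟨n, rfl⟩, rfl⟩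
    exact ⟨β n, by simp [MulAut.mul_apply]⟩

/-- The coefficients at `N x ^ k` of the `k`-th power of the sum of the `N`-class of `x`, where `x`
induces `α` on `N`. -/
noncomputable def twistedPower (α : MulAut N) : ℕ → MonoidAlgebra ℂ N
  | 0 => 1
  | k + 1 => (∑ r ∈ twistedClass α, MonoidAlgebra.of ℂ N r) *
      MonoidAlgebra.domCongr ℂ ℂ α (twistedPower α k)

theorem twistedPower_mem (B : ValuationSubring ℂ) (α : MulAut N) (k : ℕ) :
    twistedPower α k ∈ integralSubring N B := by
  induction k with
  | zero => exact one_mem _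
  | succ k ih =>
    refine mul_mem (sum_mem fun r _ n => ?_) fun n => ?_
    · classical
      rw [MonoidAlgebra.of_apply, MonoidAlgebra.coeff_single, Finsupp.single_apply]
      split_ifs
      · exact B.one_mem
      · exact B.zero_mem
    · rw [MonoidAlgebra.coeff_domCongr]
      exact ih _

theorem of_mul_twistedPower (α : MulAut N) (k : ℕ) (n : N) :
    MonoidAlgebra.of ℂ N n * twistedPower α k =
      twistedPower α k * MonoidAlgebra.of ℂ N ((α ^ k) n) := by
  induction k generalizing n with
  | zero => rw [twistedPower, mul_one, one_mul, pow_zero, MulAut.one_apply]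
  | succ k ih =>
    have e : ∀ m, MonoidAlgebra.domCongr ℂ ℂ α (MonoidAlgebra.of ℂ N m) =
        MonoidAlgebra.of ℂ N (α m) := fun m => MonoidAlgebra.domCongr_single _ _ _
    rw [twistedPower, ← mul_assoc, mul_sum_twistedClass, mul_assoc, mul_assoc, pow_succ',
      MulAut.mul_apply, ← e, ← e, ← map_mul, ← map_mul, ih]

theorem coeff_twistedPower_conj {α : MulAut N} {k : ℕ} (hα : α ^ k = 1) (g h : N) :
    (twistedPower α k).coeff (h * g * h⁻¹) = (twistedPower α k).coeff g := by
  have e := of_mul_twistedPower α k h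
  rw [hα, MulAut.one_apply] at e
  have := congrArg (fun z : MonoidAlgebra ℂ N => z.coeff (h * g)) e
  simp only [MonoidAlgebra.of_apply, MonoidAlgebra.coeff_single_mul_apply,
    MonoidAlgebra.coeff_mul_single_apply, one_mul, mul_one, inv_mul_cancel_left] at this
  exact this.symm

variable {V : Type*} [AddCommGroup V] [Module ℂ V]

/-- Moving the twisted class sum R past σ(α(z)) turns it into σ(z)R, so the twists in the recursion
cancel. No extension of σ is needed, so this applies to every character in the block of θ, invariant
or not. -/
theorem asAlgebraHom_twistedPower (σ : Representation ℂ N V) (α : MulAut N) (k : ℕ) :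
    σ.asAlgebraHom (twistedPower α k) = (∑ r ∈ twistedClass α, σ r) ^ k := by
  induction k with
  | zero => rw [twistedPower, map_one, pow_zero]
  | succ k ih =>
    have e : ∀ z : MonoidAlgebra ℂ N, (∑ r ∈ twistedClass α, σ r) *
        σ.asAlgebraHom (MonoidAlgebra.domCongr ℂ ℂ α z) =
        σ.asAlgebraHom z * ∑ r ∈ twistedClass α, σ r := fun z => by
      rw [asAlgebraHom_eq_sum, asAlgebraHom_eq_sum, ← Equiv.sum_comp α.toEquiv, Finset.mul_sum,
        Finset.sum_mul]
      refine Finset.sum_congr rfl fun n _ => ?_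
      rw [MonoidAlgebra.coeff_domCongr, mul_smul_comm, smul_mul_assoc,
        mul_sum_twistedClass (f := (σ : N →* Module.End ℂ V))]
      simp
    rw [twistedPower, map_mul, map_sum, pow_succ, ← ih, ← e]
    simp_rw [asAlgebraHom_of]

variable [FiniteDimensional ℂ V]

omit [Fintype N] in
/-- A nonzero twisted intertwiner can be normalised to have order dividing that of the twist. -/
theorem exists_unit_intertwines {σ : Representation ℂ N V} (hσ : σ.IsIrreducible) {α : MulAut N}
    {k : ℕ} (hk : k ≠ 0) (hα : α ^ k = 1) {A : Module.End ℂ V} (hA : A ≠ 0)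
    (hAσ : ∀ n, σ n * A = A * σ (α n)) :
    ∃ a : (Module.End ℂ V)ˣ, a ^ k = 1 ∧ ∀ n, a * σ n = σ (α n) * a := by
  have hn : Nontrivial V := (isIrreducible_iff.1 hσ).1
  have hbij : Function.Bijective A := by
    let σ' : Representation ℂ N V := σ.comp α.toMonoidHom
    have hirr : σ'.IsIrreducible := by
      rw [isIrreducible_iff] at hσ ⊢
      refine ⟨hn, fun U hU => hσ.2 U fun g v hv => ?_⟩
      have : σ (α (α.symm g)) v ∈ U := hU (α.symm g) v hv
      rwa [MulEquiv.apply_symm_apply] at this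
    exact bijective_of_intertwines hirr hσ A
      (fun n v => (LinearMap.congr_fun (hAσ n) v : σ n (A v) = A (σ (α n) v)).symm) hA
  have hu : IsUnit A := (Module.End.isUnit_iff A).2 hbij
  obtain ⟨u, rfl⟩ := hu
  have hpow : ∀ j n, σ n * (u : Module.End ℂ V) ^ j = (u : Module.End ℂ V) ^ j * σ ((α ^ j) n) :=
    fun j => by
      induction j with
      | zero => simp
      | succ j ih =>
        intro n
        rw [pow_succ, ← mul_assoc, ih, mul_assoc, hAσ, mul_assoc, pow_succ', MulAut.mul_apply]
  obtain ⟨s, hs⟩ := exists_eq_smul_one hσ ((u : Module.End ℂ V) ^ k) fun n => by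
    rw [hpow, hα, MulAut.one_apply]
  have hs0 : s ≠ 0 := by
    rintro rfl
    rw [zero_smul] at hs
    exact (u ^ k).ne_zero (by exact_mod_cast hs)
  -- `u ^ k` is the scalar s, so multiplying `u⁻¹` by a k-th root of s gives k-th power 1. The
  -- inverse is taken because `u` intertwines in the opposite direction.
  obtain ⟨c, hc⟩ := IsAlgClosed.exists_pow_nat_eq s (Nat.pos_of_ne_zero hk)
  have hc0 : c ≠ 0 := by
    rintro rfl
    exact hs0 (by rw [← hc, zero_pow hk])
  let z : (Module.End ℂ V)ˣ := Units.map (algebraMap ℂ (Module.End ℂ V)) (Units.mk0 c hc0)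
  have hz : ∀ T : Module.End ℂ V, (z : Module.End ℂ V) * T = T * z := fun T =>
    Algebra.commutes c T
  refine ⟨z * u⁻¹, ?_, fun n => ?_⟩
  · have hcomm : Commute z u⁻¹ := Units.ext (hz _)
    have hzk : z ^ k = u ^ k := Units.ext (by
      rw [Units.val_pow_eq_pow_val, Units.val_pow_eq_pow_val, hs, ← hc]
      exact (map_pow (algebraMap ℂ (Module.End ℂ V)) c k).symm.trans
        (Algebra.algebraMap_eq_smul_one _))
    rw [hcomm.mul_pow, hzk, inv_pow, mul_inv_cancel]
  · have h1 : ((u⁻¹ : (Module.End ℂ V)ˣ) : Module.End ℂ V) * σ n =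
        σ (α n) * ((u⁻¹ : (Module.End ℂ V)ˣ) : Module.End ℂ V) := by
      rw [Units.inv_mul_eq_iff_eq_mul, ← mul_assoc, Units.eq_mul_inv_iff_mul_eq, hAσ]
    rw [Units.val_mul, mul_assoc, h1, ← mul_assoc, hz, mul_assoc]

/-- Ra commutes with σ, R being the twisted class sum. Each term σ(n)σ(α(n))⁻¹a equals σ(n)aσ(n)⁻¹,
of trace tr a. Since R = ca⁻¹ and aᵏ = 1, the scalar of Rᵏ is cᵏ. -/
theorem sum_twistedClass_mul_eq {σ : Representation ℂ N V} (hσ : σ.IsIrreducible) {α : MulAut N}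
    {k : ℕ} (hα : α ^ k = 1) {a : (Module.End ℂ V)ˣ} (hak : a ^ k = 1)
    (ha : ∀ n, a * σ n = σ (α n) * a) :
    ∃ c : ℂ, (∑ r ∈ twistedClass α, σ r) * a = c • 1 ∧
      c * σ.character 1 = (twistedClass α).card * LinearMap.trace ℂ V a ∧
      (∑ n, (twistedPower α k).coeff n * σ.character n) / σ.character 1 = c ^ k := by
  have hn : Nontrivial V := (isIrreducible_iff.1 hσ).1
  set R := ∑ r ∈ twistedClass α, σ r with hR
  obtain ⟨c, hc⟩ := exists_eq_smul_one hσ (R * a) fun n => by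
    rw [mul_assoc, ha, ← mul_assoc, ← mul_sum_twistedClass (f := (σ : N →* Module.End ℂ V)),
      mul_assoc]
  refine ⟨c, hc, ?_, ?_⟩
  · have h1 : LinearMap.trace ℂ V (R * a) = c * σ.character 1 := by
      rw [hc, map_smul, smul_eq_mul, character, map_one σ]
    rw [← h1, hR, Finset.sum_mul, map_sum, Finset.sum_congr rfl, Finset.sum_const, nsmul_eq_mul]
    intro r hr
    obtain ⟨n, rfl⟩ := mem_twistedClass.1 hr
    have h2 : σ (α n)⁻¹ * a = a * σ n⁻¹ := by rw [ha, map_inv α]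
    rw [map_mul σ, mul_assoc, h2, LinearMap.trace_mul_comm, mul_assoc, ← map_mul σ, inv_mul_cancel,
      map_one σ, mul_one]
  · have h1 := sum_smul_eq_smul_one hσ (coeff_twistedPower_conj hα)
    rw [← asAlgebraHom_eq_sum, asAlgebraHom_twistedPower, ← hR] at h1
    have h2 : R = c • ((a⁻¹ : (Module.End ℂ V)ˣ) : Module.End ℂ V) := by
      rw [← mul_one R, ← a.mul_inv, ← mul_assoc, hc, smul_mul_assoc, one_mul]
    rw [h2, smul_pow, ← Units.val_pow_eq_pow_val, inv_pow, hak, inv_one, Units.val_one] at h1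
    exact (smul_left_injective ℂ (one_ne_zero (α := Module.End ℂ V)) h1).symm

end TwistedClass

end FinChar

/-! ### N-classes in T and the multiplicity space -/

namespace FinChar

open Representation

section InvariantCharacter

variable {N T : Type*} [Group N] [Group T] {i : N →* T} {c : T →* MulAut N}

section Orbits

/-- Two elements of `T` are equivalent if they are conjugate by an element of the image of `N`. -/
def normalConjSetoid (i : N →* T) : Setoid T where
  r g h := ∃ n, i n * g * (i n)⁻¹ = h
  iseqv :=
    { refl := fun g => ⟨1, by simp⟩
      symm := by
        rintro g _ ⟨n, rfl⟩
        exact ⟨n⁻¹, by rw [map_inv]; group⟩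
      trans := by
        rintro g _ _ ⟨n, rfl⟩ ⟨m, rfl⟩
        exact ⟨m * n, by rw [map_mul]; group⟩ }

variable [Fintype N] [Fintype T]

open Classical in
theorem sum_isConj_eq (hi : Function.Injective i) (hc : ∀ t n, i (c t n) = t * i n * t⁻¹)
    {A : Type*} [AddCommMonoid A] (F : T → A) (x : T) :
    ∑ g with IsConj x g, F g =
      ∑ O : Quotient (normalConjSetoid i) with IsConj x O.out,
        ∑ r ∈ twistedClass (c O.out), F (i r * O.out) := by
  have hout : ∀ g : T, ∃ n, i n * (Quotient.mk (normalConjSetoid i) g).out * (i n)⁻¹ = g :=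
    fun g => Quotient.exact (Quotient.out_eq (Quotient.mk (normalConjSetoid i) g))
  rw [← Finset.sum_fiberwise_of_maps_to (g := Quotient.mk (normalConjSetoid i))
    (t := Finset.univ.filter fun O : Quotient (normalConjSetoid i) => IsConj x O.out)]
  · refine Finset.sum_congr rfl fun O hO => ?_
    rw [← Finset.sum_image (f := F) (g := fun r => i r * O.out)
      (fun r _ s _ h => hi (mul_right_cancel h))]
    refine Finset.sum_congr (Finset.ext fun g => ?_) fun _ _ => rfl
    have key : ∀ n, i (n * (c O.out n)⁻¹) * O.out = i n * O.out * (i n)⁻¹ := fun n => by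
      rw [map_mul, map_inv, hc]
      group
    simp only [Finset.mem_filter, Finset.mem_univ, true_and, Finset.mem_image, mem_twistedClass]
    constructor
    · rintro ⟨-, rfl⟩
      obtain ⟨n, hn⟩ := hout g
      exact ⟨_, ⟨n, rfl⟩, (key n).trans hn⟩
    · rintro ⟨_, ⟨n, rfl⟩, rfl⟩
      rw [key]
      refine ⟨(Finset.mem_filter.1 hO).2.trans (isConj_iff.2 ⟨i n, rfl⟩), ?_⟩
      conv_rhs => rw [← Quotient.out_eq O]
      exact Quotient.sound (s := normalConjSetoid i) ⟨n⁻¹, by rw [map_inv]; group⟩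
  · intro g hg
    rw [Finset.mem_filter] at hg ⊢
    obtain ⟨n, hn⟩ := hout g
    exact ⟨Finset.mem_univ _, hg.2.trans (isConj_iff.2 ⟨i n, hn⟩).symm⟩

end Orbits

variable {W V : Type*} [AddCommGroup W] [Module ℂ W] [AddCommGroup V] [Module ℂ V]

/-- The restriction of a representation along a homomorphism. -/
def restrict (i : N →* T) (ρ : Representation ℂ T V) : Representation ℂ N V := ρ.comp i

/-- The group of pairs `(g, b)` where `b` intertwines `σ` with its conjugate by `g` and `det b` is
a `k`-th root of unity. -/
def intertwinerGroup (c : T →* MulAut N) (σ : Representation ℂ N W) (k : ℕ) :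
    Subgroup (T × (Module.End ℂ W)ˣ) where
  carrier := {q | (∀ n, q.2 * σ n = σ (c q.1 n) * q.2) ∧ LinearMap.det (q.2 : Module.End ℂ W) ^ k = 1}
  one_mem' := ⟨fun n => by simp, by simp⟩
  mul_mem' {q r} hq hr := by
    refine ⟨fun n => ?_, ?_⟩
    · rw [Prod.snd_mul, Units.val_mul, mul_assoc, hr.1, ← mul_assoc, hq.1, mul_assoc, Prod.fst_mul,
        map_mul, MulAut.mul_apply]
    · rw [Prod.snd_mul, Units.val_mul, map_mul, mul_pow, hq.2, hr.2, mul_one]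
  inv_mem' {q} hq := by
    refine ⟨fun n => ?_, ?_⟩
    · have h := hq.1 ((c q.1)⁻¹ n)
      rw [← MulAut.mul_apply, mul_inv_cancel, MulAut.one_apply] at h
      rw [Prod.snd_inv, Units.inv_mul_eq_iff_eq_mul, ← mul_assoc, Prod.fst_inv, map_inv, h,
        Units.mul_inv_cancel_right]
    · have h : LinearMap.det (q.2 : Module.End ℂ W) *
          LinearMap.det ((q.2⁻¹ : (Module.End ℂ W)ˣ) : Module.End ℂ W) = 1 := by
        rw [← map_mul, ← Units.val_mul, mul_inv_cancel, Units.val_one, map_one]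
      have h2 := congrArg (· ^ k) h
      simp only [mul_pow, hq.2, one_mul, one_pow] at h2
      exact h2

/-- By Schur, two intertwiners over the same g differ by a scalar, which the determinant condition
makes a root of unity of bounded order. Finiteness yields integrality for the action on the
multiplicity space. -/
theorem intertwinerGroup_finite [Finite T] [FiniteDimensional ℂ W] {σ : Representation ℂ N W}
    (hσ : σ.IsIrreducible) {k : ℕ} (hk : k ≠ 0) : Finite (intertwinerGroup c σ k) := by
  have hn : Nontrivial W := (isIrreducible_iff.1 hσ).1
  refine Set.Finite.of_finite_fibers (s := (intertwinerGroup c σ k : Set (T × (Module.End ℂ W)ˣ)))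
    Prod.fst (Set.toFinite _) ?_
  rintro _ ⟨⟨g, b⟩, hb, rfl⟩
  have hd : Module.finrank ℂ W * k ≠ 0 := mul_ne_zero Module.finrank_pos.ne' hk
  have hfin : {s : ℂ | s ^ (Module.finrank ℂ W * k) = 1}.Finite := by
    have := (Polynomial.X_pow_sub_C_ne_zero (R := ℂ) (Nat.pos_of_ne_zero hd) 1)
    refine (Polynomial.finite_setOfPred_isRoot this).subset fun s hs => ?_
    simpa [Polynomial.IsRoot, sub_eq_zero] using hs
  refine Set.Finite.of_finite_image (f := fun q => (q.2 : Module.End ℂ W))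
    ((hfin.image fun s => s • (b : Module.End ℂ W)).subset ?_) ?_
  · rintro _ ⟨⟨g', b'⟩, ⟨hb', rfl⟩, rfl⟩
    obtain ⟨s, hs⟩ := exists_eq_smul_one hσ
      (((b⁻¹ : (Module.End ℂ W)ˣ) : Module.End ℂ W) * b') fun n => by
        have h1 := hb.1 n
        have h2 := hb'.1 n
        simp only at h1 h2
        rw [mul_assoc, h2, ← mul_assoc, ← mul_assoc]
        congr 1
        rw [Units.inv_mul_eq_iff_eq_mul, ← mul_assoc, Units.eq_mul_inv_iff_mul_eq, h1]
    have hs' : (b' : Module.End ℂ W) = s • (b : Module.End ℂ W) := by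
      rw [Units.inv_mul_eq_iff_eq_mul] at hs
      rw [hs, mul_smul_comm, mul_one]
    refine ⟨s, ?_, hs'.symm⟩
    have h3 := hb'.2
    have h4 := hb.2
    simp only at h3 h4
    rwa [hs', LinearMap.det_smul, mul_pow, h4, mul_one, ← pow_mul] at h3
  · rintro ⟨g1, b1⟩ h1 ⟨g2, b2⟩ h2 h
    exact Prod.ext (h1.2.trans h2.2.symm) (Units.ext h)

/-- The action of the intertwiner group on the multiplicity space `Hom_N(W, V)`. -/
def multiplicityRep (hc : ∀ t n, i (c t n) = t * i n * t⁻¹) (ρ : Representation ℂ T V)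
    (σ : Representation ℂ N W) (k : ℕ) :
    intertwinerGroup c σ k →* Module.End ℂ (IntertwiningMap σ (restrict i ρ)) where
  toFun q :=
    { toFun := fun f =>
        (ρ q.1.1 ∘ₗ f.toLinearMap ∘ₗ
          ((q.1.2⁻¹ : (Module.End ℂ W)ˣ) : Module.End ℂ W)).intertwiningMap_of_isIntertwiningMap
            σ (restrict i ρ) fun n w => by
          have h1 := q.2.1 ((c q.1.1)⁻¹ n)
          rw [← MulAut.mul_apply, mul_inv_cancel, MulAut.one_apply] at h1
          have h2 : ((q.1.2⁻¹ : (Module.End ℂ W)ˣ) : Module.End ℂ W) * σ n =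
              σ ((c q.1.1)⁻¹ n) * ((q.1.2⁻¹ : (Module.End ℂ W)ˣ) : Module.End ℂ W) := by
            rw [Units.inv_mul_eq_iff_eq_mul, ← mul_assoc, Units.eq_mul_inv_iff_mul_eq, h1]
          have h3 := LinearMap.congr_fun h2 w
          have h4 : q.1.1 * i ((c q.1.1)⁻¹ n) = i n * q.1.1 := by
            have := hc q.1.1 ((c q.1.1)⁻¹ n)
            rw [← MulAut.mul_apply, mul_inv_cancel, MulAut.one_apply] at this
            rw [this, inv_mul_cancel_right]
          simp only [Module.End.mul_apply] at h3
          simp only [LinearMap.comp_apply, h3, IntertwiningMap.toLinearMap_apply,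
            IntertwiningMap.isIntertwining]
          change (ρ q.1.1 * ρ (i _)) _ = (ρ (i n) * ρ q.1.1) _
          rw [← map_mul, ← map_mul, h4]
      map_add' := fun f f' => IntertwiningMap.ext (LinearMap.ext fun w => map_add (ρ q.1.1) _ _)
      map_smul' := fun s f => IntertwiningMap.ext (LinearMap.ext fun w => map_smul (ρ q.1.1) _ _) }
  map_one' := LinearMap.ext fun f => IntertwiningMap.ext (LinearMap.ext fun w => by
    change ρ 1 (f (((1⁻¹ : (Module.End ℂ W)ˣ) : Module.End ℂ W) w)) = f w
    rw [map_one, inv_one]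
    rfl)
  map_mul' q r := LinearMap.ext fun f => IntertwiningMap.ext (LinearMap.ext fun w => by
    change ρ (q.1.1 * r.1.1) (f (((q.1.2 * r.1.2)⁻¹ : (Module.End ℂ W)ˣ).val w)) =
      ρ q.1.1 (ρ r.1.1 (f ((r.1.2⁻¹ : (Module.End ℂ W)ˣ).val ((q.1.2⁻¹ : (Module.End ℂ W)ˣ).val w))))
    rw [map_mul, mul_inv_rev]
    rfl)

theorem multiplicityRep_apply (hc : ∀ t n, i (c t n) = t * i n * t⁻¹) (ρ : Representation ℂ T V)
    (σ : Representation ℂ N W) {k : ℕ} (q : intertwinerGroup c σ k)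
    (f : IntertwiningMap σ (restrict i ρ)) (w : W) :
    multiplicityRep hc ρ σ k q f (q.1.2.val w) = ρ q.1.1 (f w) := by
  change ρ q.1.1 (f ((q.1.2⁻¹ : (Module.End ℂ W)ˣ).val (q.1.2.val w))) = _
  rw [← Module.End.mul_apply, Units.inv_mul, Module.End.one_apply]

end InvariantCharacter

end FinChar

/-! ### Height zero passes to invariant characters of normal subgroups -/

namespace FinChar

open Representation

section InvariantHeight

variable {N T : Type*} [Group N] [Group T] [Fintype N] [Fintype T] {i : N →* T} {c : T →* MulAut N}
  {W V : Type*} [AddCommGroup W] [Module ℂ W] [FiniteDimensional ℂ W] [AddCommGroup V] [Module ℂ V]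
  [FiniteDimensional ℂ V]

omit [Group T] [Fintype T] in
theorem exists_unit_of_character_invariant {σ : Representation ℂ N W} (hσ : σ.IsIrreducible)
    {α : MulAut N} {k : ℕ} (hk : k ≠ 0) (hα : α ^ k = 1)
    (hinv : ∀ n, σ.character (α n) = σ.character n) :
    ∃ a : (Module.End ℂ W)ˣ, a ^ k = 1 ∧ ∀ n, a * σ n = σ (α n) * a := by
  have h := sum_char_mul_char_inv_eq (restrict α.toMonoidHom σ) σ
  have h1 : ∀ n, (restrict α.toMonoidHom σ).character n = σ.character n := hinv
  simp_rw [h1] at h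
  rw [sum_mul_inv_eq (character_mem_Irr hσ) (character_mem_Irr hσ), if_pos rfl] at h
  have h2 : Module.finrank ℂ (IntertwiningMap (restrict α.toMonoidHom σ) σ) ≠ 0 := by
    intro h0
    rw [h0, Nat.cast_zero, mul_zero] at h
    exact card_ne_zero' h
  have h3 := Module.nontrivial_of_finrank_pos (Nat.pos_of_ne_zero h2)
  obtain ⟨f, hf⟩ := exists_ne (0 : IntertwiningMap (restrict α.toMonoidHom σ) σ)
  exact exists_unit_intertwines hσ hk hα (A := f.toLinearMap)
    (fun h => hf (IntertwiningMap.ext h)) fun n => (f.isIntertwining' n).symm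

/-- V restricted to the θ-part behaves like W tensored with Hom_N(W, V). The N-class sum of x acts
by s on W and by an element of the intertwiner group on the multiplicity space, so β is the scalar
of a sum of m conjugates of one such element, and y is its trace. -/
theorem exists_centralChar_eq_mul (hi : Function.Injective i)
    (hc : ∀ t n, i (c t n) = t * i n * t⁻¹) {σ : Representation ℂ N W} (hσ : σ.IsIrreducible)
    (hinv : ∀ t n, σ.character (c t n) = σ.character n) {ρ : Representation ℂ T V}
    (hρ : ρ.IsIrreducible) (hH : Module.finrank ℂ (IntertwiningMap σ (restrict i ρ)) ≠ 0) {x : T}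
    {a : (Module.End ℂ W)ˣ} (hak : a ^ Nat.card T = 1) (ha : ∀ n, a * σ n = σ (c x n) * a) {s : ℂ}
    (hs : (∑ r ∈ twistedClass (c x), σ r) * a = s • 1) (hω : centralChar ρ.character x ≠ 0) :
    ∃ (m : ℕ) (β y : ℂ), IsIntegral ℤ β ∧ IsIntegral ℤ y ∧
      centralChar ρ.character x = s * β ∧
      β * Module.finrank ℂ (IntertwiningMap σ (restrict i ρ)) = m * y ∧
      Nat.card (ConjClasses.mk x).carrier = m * (twistedClass (c x)).card := by
  classical
  have hk : Nat.card T ≠ 0 := Nat.card_pos.ne'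
  have hcard : ∀ t, c t ^ Nat.card T = 1 := fun t => by rw [← map_pow, pow_card_eq_one', map_one]
  have hdet : ∀ b : (Module.End ℂ W)ˣ, b ^ Nat.card T = 1 →
      LinearMap.det (b : Module.End ℂ W) ^ Nat.card T = 1 := fun b hb => by
    rw [← map_pow, ← Units.val_pow_eq_pow_val, hb, Units.val_one, map_one]
  choose b hbk hb using fun t => exists_unit_of_character_invariant hσ hk (hcard t) (hinv t)
  let P := intertwinerGroup c σ (Nat.card T)
  have hPfin : Finite P := intertwinerGroup_finite hσ hk
  let qx : P := ⟨(x, a), ha, hdet a hak⟩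
  let q : T → P := fun t => ⟨(t, b t), hb t, hdet _ (hbk t)⟩
  let S := Finset.univ.filter fun O : Quotient (normalConjSetoid i) => IsConj x O.out
  choose! t ht using fun O (hO : O ∈ S) => isConj_iff.1 (Finset.mem_filter.1 hO).2
  -- The lift of each orbit representative is taken conjugate to `qx`: this gives all orbits the
  -- same scalar `s` and the same trace on the multiplicity space.
  let qO : Quotient (normalConjSetoid i) → P := fun O => q (t O) * qx * (q (t O))⁻¹
  have hq1 : ∀ O ∈ S, (qO O).1.1 = O.out := fun O hO => ht O hO
  let Y := multiplicityRep hc ρ σ (Nat.card T)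
  have htc : ∀ O ∈ S, twistedClass (c O.out) =
      (twistedClass (c x)).map (c (t O)).toEquiv.toEmbedding := fun O hO => by
    rw [← ht O hO, map_mul, map_mul, map_inv, twistedClass_conj]
  have hR : ∀ O ∈ S, (∑ r ∈ twistedClass (c O.out), σ r) * ((qO O).1.2 : Module.End ℂ W) =
      s • 1 := fun O hO => by
    have e : (∑ r ∈ twistedClass (c O.out), σ r) * (b (t O) : Module.End ℂ W) =
        b (t O) * ∑ r ∈ twistedClass (c x), σ r := by
      rw [htc O hO, Finset.sum_map, Finset.sum_mul, Finset.mul_sum]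
      exact Finset.sum_congr rfl fun r _ => (hb (t O) r).symm
    change _ * (((b (t O) * a * (b (t O))⁻¹ : (Module.End ℂ W)ˣ)) : Module.End ℂ W) = _
    rw [Units.val_mul, Units.val_mul, ← mul_assoc, ← mul_assoc, e, mul_assoc (b (t O) : Module.End ℂ W),
      hs, mul_smul_comm, mul_one, smul_mul_assoc, Units.mul_inv]
  have hY : s • ∑ O ∈ S, Y (qO O) = centralChar ρ.character x • 1 := by
    refine LinearMap.ext fun f => IntertwiningMap.ext (LinearMap.ext fun w => ?_)
    have h1 := LinearMap.congr_fun (sum_conj_eq_smul_one hρ x) (f w)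
    rw [LinearMap.sum_apply, sum_isConj_eq hi hc (fun g => ρ g (f w))] at h1
    have h2 : ∀ O ∈ S, ∑ r ∈ twistedClass (c O.out), ρ (i r * O.out) (f w) =
        s • Y (qO O) f w := fun O hO => by
      have h3 := LinearMap.congr_fun (hR O hO) w
      rw [Module.End.mul_apply, LinearMap.sum_apply] at h3
      have h4 := congrArg (Y (qO O) f) h3
      rw [map_sum] at h4
      refine Eq.trans (Finset.sum_congr rfl fun r _ => ?_) (h4.trans (map_smul (Y (qO O) f) s w))
      rw [IntertwiningMap.isIntertwining, multiplicityRep_apply, hq1 O hO, map_mul]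
      rfl
    rw [Finset.sum_congr rfl h2] at h1
    rw [LinearMap.smul_apply, LinearMap.sum_apply]
    let ev : IntertwiningMap σ (restrict i ρ) →ₗ[ℂ] V :=
      { toFun := fun z => z.toLinearMap w, map_add' := fun _ _ => rfl, map_smul' := fun _ _ => rfl }
    change ev (s • ∑ O ∈ S, Y (qO O) f) = ev (centralChar ρ.character x • f)
    rw [map_smul, map_sum, Finset.smul_sum]
    exact h1
  have hs0 : s ≠ 0 := by
    rintro rfl
    rw [zero_smul] at hY
    have := Module.nontrivial_of_finrank_pos (Nat.pos_of_ne_zero hH)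
    exact smul_ne_zero hω one_ne_zero hY.symm
  have hY' : ∑ O ∈ S, Y (qO O) = (centralChar ρ.character x / s) • 1 := by
    rw [div_eq_inv_mul, mul_smul, ← hY, inv_smul_smul₀ hs0]
  have hHn := Module.nontrivial_of_finrank_pos (Nat.pos_of_ne_zero hH)
  have hPk : ∀ r : P, r ^ Nat.card P = 1 := fun r => pow_card_eq_one'
  refine ⟨S.card, centralChar ρ.character x / s, LinearMap.trace ℂ _ (Y qx), ?_, ?_,
    (mul_div_cancel₀ _ hs0).symm, ?_, ?_⟩
  · have := isIntegral_sum_monoidHom Y S qO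
    rw [hY'] at this
    exact isIntegral_of_smul_one this
  · exact isIntegral_trace (isIntegral_of_pow_eq_one' Nat.card_pos.ne'
      (by rw [← map_pow, hPk, map_one]))
  · have h := congrArg (LinearMap.trace ℂ _) hY'
    rw [map_smul, LinearMap.trace_one, smul_eq_mul] at h
    rw [← h, map_sum, Finset.sum_congr rfl (g := fun _ => LinearMap.trace ℂ _ (Y qx)),
      Finset.sum_const, nsmul_eq_mul]
    intro O _
    rw [map_mul Y, map_mul Y, LinearMap.trace_mul_comm, ← mul_assoc, ← map_mul Y, inv_mul_cancel,
      map_one Y, one_mul]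
  · have h := sum_isConj_eq hi hc (fun _ => 1) x
    rw [sum_filter_conj x (fun _ => 1) 1 (fun _ => rfl), smul_eq_mul, mul_one] at h
    rw [h, Finset.sum_congr rfl (g := fun _ => (twistedClass (c x)).card), Finset.sum_const,
      smul_eq_mul]
    intro O hO
    rw [Finset.sum_const, smul_eq_mul, mul_one, htc O hO, Finset.card_map]

variable {B : ValuationSubring ℂ} {p : ℕ} {M : Ideal (integralClosure ℤ ℂ)}

omit [Group T] [Fintype T] in
theorem valuation_sum_twistedPower_le (hB : Dominates B p M) {θ : N → ℂ} (hθ : θ ∈ Irr N)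
    {α : MulAut N} {k : ℕ} (hα : α ^ k = 1) :
    B.valuation ((∑ n, (twistedPower α k).coeff n * θ n) / θ 1) ≤ 1 := by
  classical
  rw [sum_mul_div_eq_sum_conjClasses hθ (coeff_twistedPower_conj hα)]
  refine B.valuation.map_sum_le fun K _ => ?_
  rw [map_mul]
  exact mul_le_one' ((B.valuation_le_one_iff _).2 (twistedPower_mem B α k _))
    (hB.integral_le_one _ (isIntegral_centralChar hθ _))

omit [Group T] [Fintype T] in
-- The unit hypothesis makes the twisted class sum act nontrivially, so it is itself a twisted
-- intertwiner and supplies a. With scalar s for the sum times a, sθ(1) = |class|·tr a, where s is a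
-- unit and tr a is integral.
theorem valuation_one_le_card_twistedClass (hB : Dominates B p M) {θ : N → ℂ} (hθ : θ ∈ Irr N)
    {α : MulAut N} {k : ℕ} (hk : k ≠ 0) (hα : α ^ k = 1)
    (h : B.valuation ((∑ n, (twistedPower α k).coeff n * θ n) / θ 1) = 1) :
    B.valuation (θ 1) ≤ B.valuation ((twistedClass α).card : ℂ) := by
  obtain ⟨d, σ, hσ, rfl⟩ := hθ
  have hne : ∑ r ∈ twistedClass α, σ r ≠ 0 := by
    intro h0
    have h1 := sum_smul_eq_smul_one hσ (coeff_twistedPower_conj hα)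
    rw [← asAlgebraHom_eq_sum, asAlgebraHom_twistedPower, h0, zero_pow hk] at h1
    have hn : Nontrivial (Fin d → ℂ) := (isIrreducible_iff.1 hσ).1
    rw [(smul_eq_zero.1 h1.symm).resolve_right one_ne_zero, map_zero] at h
    exact zero_ne_one h
  obtain ⟨a, hak, ha⟩ := exists_unit_intertwines hσ hk hα hne
    fun n => mul_sum_twistedClass (f := (σ : N →* Module.End ℂ (Fin d → ℂ))) α n
  obtain ⟨s, -, h1, h2⟩ := sum_twistedClass_mul_eq hσ hα hak ha
  rw [h2, map_pow] at h
  have hs : B.valuation s = 1 := (pow_eq_one_iff.1 h).resolve_right hk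
  have h3 := congrArg B.valuation h1
  rw [map_mul, map_mul, hs, one_mul] at h3
  rw [h3]
  refine mul_le_of_le_one_right' (hB.integral_le_one _ (isIntegral_trace ?_))
  exact isIntegral_of_pow_eq_one' hk (by rw [← Units.val_pow_eq_pow_val, hak, Units.val_one])

/-- At the x of `exists_valuation_eq_one` the T-class length has valuation v(ψ(1)) = v(e)v(θ(1)),
and it is m times the N-class size. As β is a unit, βe = my gives v(e) ≤ v(m), so the N-class size
has valuation at most v(θ(1)); it is at least v(θ'(1)) for each θ' in the block. -/
theorem height_eq_zero_of_invariant (hB : Dominates B p M) (hi : Function.Injective i)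
    (hc : ∀ t n, i (c t n) = t * i n * t⁻¹) {θ : N → ℂ} (hθ : θ ∈ Irr N)
    (hinv : ∀ t n, θ (c t n) = θ n) {ψ : T → ℂ} (hψ : ψ ∈ Irr T) (hlie : LiesUnder i θ ψ)
    (h0 : height p M ψ = 0) : height p M θ = 0 := by
  obtain ⟨x, hx, hωx⟩ := exists_valuation_eq_one hB hψ h0
  have hk : Nat.card T ≠ 0 := Nat.card_pos.ne'
  have hα : c x ^ Nat.card T = 1 := by rw [← map_pow, pow_card_eq_one', map_one]
  have hvψ : B.valuation (ψ 1) ≠ 0 := by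
    rw [Ne, map_eq_zero]
    exact one_apply_ne_zero hψ
  have hcl : B.valuation (Nat.card (ConjClasses.mk x).carrier : ℂ) = B.valuation (ψ 1) := by
    have := hωx
    rwa [centralChar, map_div₀, div_eq_one_iff_eq hvψ, map_mul, hx, mul_one] at this
  obtain ⟨m, e, he, hv, hm, hω⟩ : ∃ m e : ℕ, ψ 1 = e * θ 1 ∧
      B.valuation (e : ℂ) ≤ B.valuation (m : ℂ) ∧
      Nat.card (ConjClasses.mk x).carrier = m * (twistedClass (c x)).card ∧
      B.valuation ((∑ n, (twistedPower (c x) (Nat.card T)).coeff n * θ n) / θ 1) = 1 := by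
    have hω0 : centralChar ψ x ≠ 0 := by
      intro h
      rw [h, map_zero] at hωx
      exact zero_ne_one hωx
    have hsum := sum_inv_mul_apply_mul i c hc hθ hinv hψ hlie hθ 1
    have hle := valuation_sum_twistedPower_le hB hθ hα
    have hθ1 := one_apply_ne_zero hθ
    have hψ1 := one_apply_ne_zero hψ
    obtain ⟨d, σ, hσ, rfl⟩ := hθ
    obtain ⟨d', ρ, hρ, rfl⟩ := hψ
    have he : ρ.character 1 =
        Module.finrank ℂ (IntertwiningMap σ (restrict i ρ)) * σ.character 1 := by
      have h := sum_char_mul_char_inv_eq σ (restrict i ρ)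
      rw [if_pos rfl] at hsum
      simp_rw [mul_one, mul_comm (σ.character _)] at hsum
      have h2 := h.symm.trans hsum
      have hN := card_ne_zero' (G := N)
      field_simp at h2
      exact h2.symm
    have hH : Module.finrank ℂ (IntertwiningMap σ (restrict i ρ)) ≠ 0 := by
      intro h
      rw [h, Nat.cast_zero, zero_mul] at he
      exact hψ1 he
    obtain ⟨a, hak, ha⟩ := exists_unit_of_character_invariant hσ hk hα (hinv x)
    obtain ⟨s, hs, -, hω⟩ := sum_twistedClass_mul_eq hσ hα hak ha
    obtain ⟨m, β, y, hβ, hy, hsβ, hβy, hm⟩ :=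
      exists_centralChar_eq_mul hi hc hσ hinv hρ hH hak ha hs hω0
    rw [hω, map_pow] at hle
    have hs1 : B.valuation s ≤ 1 := (pow_le_one_iff hk).1 hle
    have hβ1 := hB.integral_le_one _ hβ
    rw [hsβ, map_mul] at hωx
    have hs2 : B.valuation s = 1 :=
      le_antisymm hs1 (hωx.symm.le.trans (mul_le_of_le_one_right' hβ1))
    rw [hs2, one_mul] at hωx
    refine ⟨m, _, he, ?_, hm, by rw [hω, map_pow, hs2, one_pow]⟩
    have h := congrArg B.valuation hβy
    rw [map_mul, map_mul, hωx, one_mul] at h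
    rw [h]
    exact mul_le_of_le_one_right' (hB.integral_le_one _ hy)
  have hle : B.valuation ((twistedClass (c x)).card : ℂ) ≤ B.valuation (θ 1) := by
    rw [he, hm, Nat.cast_mul, map_mul, map_mul] at hcl
    have hm0 : B.valuation (m : ℂ) ≠ 0 := by
      intro h
      rw [he, map_mul] at hvψ
      rw [h] at hv
      exact left_ne_zero_of_mul hvψ (le_antisymm hv zero_le)
    refine le_of_mul_le_mul_left ?_ (zero_lt_iff.2 hm0)
    rw [hcl]
    exact mul_le_mul_left hv _
  rw [height_eq_zero_iff_valuation hB hθ]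
  intro θ' hθ'
  refine (valuation_one_le_card_twistedClass hB hθ'.1 hk hα ?_).trans hle
  exact valuation_eq_one_of_sub_lt_one hω (valuation_sum_class_sub_lt_one hB hθ hθ'
    (coeff_twistedPower_conj hα) (twistedPower_mem B _ _))

end InvariantHeight

end FinChar

/-! ### The main theorem -/

theorem mainTheorem10 {G : Type*} [Group G] [Finite G] (p : ℕ) (hp : p.Prime)
    (M : Ideal (integralClosure ℤ ℂ)) (hM : M.IsMaximal) (hpM : (p : integralClosure ℤ ℂ) ∈ M)
    (χ : G → ℂ) (hχ : χ ∈ FinChar.Irr G) (hχ0 : FinChar.height p M χ = 0)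
    (N : Subgroup G) [N.Normal]
    (θ : N → ℂ) (hθ : θ ∈ FinChar.Irr N) (hθχ : FinChar.LiesUnder N.subtype θ χ)
    (ψ : FinChar.inertia θ → ℂ) (hψ : FinChar.IsCliffordCorrespondent hθ χ ψ) :
    FinChar.height p M ψ = 0 ∧
    FinChar.height p M θ = 0 ∧
    FinChar.cyclotomicValues (p * FinChar.pPrimePart p (Nat.card G)) χ =
      FinChar.cyclotomicValues (p * FinChar.pPrimePart p (Nat.card G)) ψ ∧
    (p = 2 ∨ (Odd p ∧ p ≤ FinChar.pPart p (FinChar.conductor χ)) →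
      FinChar.pPart p (FinChar.conductor χ) = FinChar.pPart p (FinChar.conductor ψ)) := by
  have := Fintype.ofFinite G
  have := Fintype.ofFinite N
  have := Fintype.ofFinite (FinChar.inertia θ)
  have := Fact.mk hp
  obtain ⟨B, hB⟩ := FinChar.exists_dominates hp hM hpM
  have hcard : Nat.card G ≠ 0 := Nat.card_pos.ne'
  have hG : Nat.card G =
      p ^ padicValNat p (Nat.card G) * FinChar.pPrimePart p (Nat.card G) :=
    (Nat.mul_div_cancel' pow_padicValNat_dvd).symm
  have hn : ¬ p ∣ FinChar.pPrimePart p (Nat.card G) := by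
    have h := Nat.not_dvd_ordCompl hp hcard
    rwa [Nat.factorization_def _ hp] at h
  have hn0 : FinChar.pPrimePart p (Nat.card G) ≠ 0 := fun h => hn (h ▸ dvd_zero p)
  have hψ0 : FinChar.height p M ψ = 0 :=
    FinChar.height_eq_zero_of_induce hB hχ hχ0 hψ.1 hψ.2.2
  have h2 := FinChar.cyclotomicValues_eq hB hχ hχ0 hψ hn0 hn hG
  refine ⟨hψ0, ?_, h2, fun hc => ?_⟩
  · exact FinChar.height_eq_zero_of_invariant
      (i := Subgroup.inclusion (FinChar.le_inertia hθ))
      (c := (MulAut.conjNormal (H := N)).comp (FinChar.inertia θ).subtype) hB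
      (Subgroup.inclusion_injective _) (FinChar.inclusion_inertiaConj hθ) hθ
      (fun t n => t.2 n) hψ.1 hψ.2.1 hψ0
  · refine FinChar.pPart_conductor_eq hp hcard hn
      (hψ.2.2 ▸ FinChar.fieldOfValues_induce_le ψ) ?_ h2 hc
    exact (FinChar.Irr.fieldOfValues_le hψ.1).trans (FinChar.cyclotomic_mono Nat.card_pos.ne' hcard
      (Subgroup.card_subgroup_dvd_card _))
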